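/- Let $a_0,a_1,a_2,\dots$ be independent standard complex Gaussian random variables (density $\pi^{-1}e^{-|w|^2}$ on $\mathbb C$), let $F(z)=\sum_{k\ge 0}a_k z^k/\sqrt{k!}$ be the Gaussian entire function, and let $h(z)=|F(z)|e^{-|z|^2/2}$ be the square root of the white noise spectrogram with Gaussian window. Call $z$ a critical point if $\nabla'_zF(z):=F'(z)-\bar z F(z)=0$ (almost surely, these are exactly the critical points of $h^2$ at which $h\neq 0$); a critical point is a saddle point if it is not a local extremum of $h$. Let $d\nu=\frac1\pi dz$ be Lebesgue measure on $\mathbb C$ divided by $\pi$. Then the expected densities, per unit $\nu$-area, of the heights $h(\xi)$ at the local maxima, the saddle points and all the critical points $\xi$ are given, for $x\ge 0$, by $$D^{\max}(x)=2x\left(x^2-2+2e^{-x^2/2}\right)e^{-x^2},\qquad D^{\mathrm{sadd}}(x)=4x\,e^{-\frac32x^2},$$ $$D^{\mathrm{crit}}(x)=D^{\mathrm{sadd}}(x)+D^{\max}(x)=2x\left(x^2-2+4e^{-x^2/2}\right)e^{-x^2}$$ respectively. That is, if $X$ is the random set of the critical points that are local maxima of $h$, of the saddle points, or of all critical points, and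 $D$ is the corresponding function, then $D\ge 0$ on $[0,\infty)$ and, for every compact $K\subset\mathbb C$ with $\nu(K)>0$ and every Borel function $\psi:\mathbb R\to[0,\infty]$, $$\mathbb E\left[\frac1{\nu(K)}\sum_{\xi\in K\cap X}\psi(h(\xi))\right]=\int_0^\infty\psi(x)D(x)\,dx .$$ -/

import Mathlib

open MeasureTheory ProbabilityTheory
open scoped ENNReal ComplexConjugate

noncomputable section

namespace GaussianEntire

/-- The standard complex Gaussian law (mean zero, `E|a|² = 1`, circularly symmetric):
density `π⁻¹ exp (-|z|²)` with respect to Lebesgue measure on `ℂ`. -/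
def stdComplexGaussian : Measure ℂ :=
  volume.withDensity fun z => ENNReal.ofReal (Real.pi⁻¹ * Real.exp (-‖z‖ ^ 2))

/-- The power series `∑ aₖ zᵏ / √(k!)`. When the coefficients are i.i.d. standard complex
Gaussian variables it almost surely converges for all `z`. -/
def gef (a : ℕ → ℂ) (z : ℂ) : ℂ :=
  ∑' k : ℕ, a k * z ^ k / (Real.sqrt (k.factorial : ℝ) : ℂ)

/-- The square root of the spectrogram, `|F(z)| exp (-|z|²/2)`. -/
def height (F : ℂ → ℂ) (z : ℂ) : ℝ :=
  ‖F z‖ * Real.exp (-‖z‖ ^ 2 / 2)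

/-- The translation-invariant derivative `∇'F(z) = ∂F(z) - conj z * F(z)`. -/
def chernDeriv (F : ℂ → ℂ) (z : ℂ) : ℂ :=
  deriv F z - conj z * F z

/-- The critical points: the solutions of `∇'F(z) = 0`. -/
def criticalPoints (F : ℂ → ℂ) : Set ℂ :=
  {z | chernDeriv F z = 0}

/-- The critical points which are local maxima of the height. -/
def maxPoints (F : ℂ → ℂ) : Set ℂ :=
  {z | z ∈ criticalPoints F ∧ IsLocalMax (height F) z}

/-- The saddle points: the critical points which are not local extrema of the height. -/
def saddlePoints (F : ℂ → ℂ) : Set ℂ :=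
  {z | z ∈ criticalPoints F ∧ ¬ IsLocalExtr (height F) z}

/-- The area measure `dν = dz / π`. -/
def areaMeasure : Measure ℂ :=
  ENNReal.ofReal Real.pi⁻¹ • volume

/-- `D` is the expected density, per unit `ν`-area, of the heights at the points of the random
set `X (F ω)`: for each compact `K` of positive area, the expectation of
`ν(K)⁻¹ ∑ ψ (height at ξ)`, over the points `ξ` of the set in `K`, is the integral over
`(0, ∞)` of `ψ x * D x`.
Test functions are all Borel functions with values in `[0, ∞]`; the random sum is required to
be measurable up to a null set, so that its expectation is meaningful. -/
def IsExpectedHeightDensity {Ω : Type*} [MeasurableSpace Ω] (P : Measure Ω)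
    (F : Ω → ℂ → ℂ) (X : (ℂ → ℂ) → Set ℂ) (D : ℝ → ℝ) : Prop :=
  (∀ x : ℝ, 0 ≤ x → 0 ≤ D x) ∧
  ∀ K : Set ℂ, IsCompact K → 0 < areaMeasure K → ∀ ψ : ℝ → ℝ≥0∞, Measurable ψ →
    AEMeasurable (fun ω => ∑' ξ : (K ∩ X (F ω) : Set ℂ), ψ (height (F ω) ξ)) P ∧
    ∫⁻ ω, (areaMeasure K)⁻¹ * ∑' ξ : (K ∩ X (F ω) : Set ℂ), ψ (height (F ω) ξ) ∂P =
      ∫⁻ x in Set.Ioi (0 : ℝ), ψ x * ENNReal.ofReal (D x)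

/-- The density at local maxima. -/
def densityMax (x : ℝ) : ℝ :=
  2 * x * (x ^ 2 - 2 + 2 * Real.exp (-x ^ 2 / 2)) * Real.exp (-x ^ 2)

/-- The density at saddle points. -/
def densitySaddle (x : ℝ) : ℝ :=
  4 * x * Real.exp (-(3 / 2) * x ^ 2)

/-- The density over all critical points. -/
def densityCrit (x : ℝ) : ℝ :=
  2 * x * (x ^ 2 - 2 + 4 * Real.exp (-x ^ 2 / 2)) * Real.exp (-x ^ 2)

end GaussianEntire

end

open MeasureTheory ProbabilityTheory
open scoped ENNReal ComplexConjugate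

noncomputable section


/-! The proof is a Kac–Rice computation carried out as a change of variables. Write F(z) = a₀ + a₁z
+ R(z). For a fixed tail R, F has a critical point z with value u exactly when (a₀, a₁) = `critMap R
(z, u)`. The pairs (critical point, value) are therefore the fibre of a C¹ self-map of ℂ² over a
point with Gaussian law. The area formula with R as a parameter
(`measurable_fiberSum_and_lintegral`) turns the mean of a sum over nondegenerate critical points
into an integral over (z, u) of the Gaussian density at `critMap R (z, u)` times the Jacobian,
averaged over R. By `det_fderiv_critMap` the Jacobian is |∇'²F|² − |u|², where ∇'²F = F'' − z̄²F at
a critical point.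

The average over R is explicit because, after multiplication by exp(−|z|²/2), the variables F(z),
∇'F(z) and ∇'²F(z)/√2 are independent standard Gaussians (`map_normCoeff_gaussianSeq`). This law
fixes densities only almost everywhere, whereas critical points live on the null set ∇'F = 0;
continuity gives the density at every value (`lintegral_jetDensity`). All powers of exp(|z|²) then
cancel, and the mean per unit ν-area is E[ψ(|u|) ·||u|² − 2|s|²|] over independent standard
Gaussians u, s, restricted to the chosen sign of |u|² − 2|s|² (`lintegral_critSum`).

That sign decides the type of the critical point. Near ξ the height is a constant times |F(ξ) +
w²g(w)| exp(−|w|²/2) with 2g(0) = ∇'²F(ξ), so |∇'²F| < |F| gives a local maximum and |∇'²F| > |F| >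
0 a saddle (`isLocalMax_height`, `not_isLocalExtr_height`). Equality is almost surely excluded by
Sard's theorem (`ae_isRegular`), and zero height by the mean formula itself (`ae_gef_ne_zero`). The
densities follow by integrating the positive and negative parts of x² − 2t² against 2t exp(−t²). -/

namespace GaussianEntire
-- Area formula and Sard's theorem for C¹ maps with a measurable parameter.
section AreaFormula
set_option linter.unusedSectionVars false
open Set Filter Topology Function

variable {Θ E : Type*} [MeasurableSpace Θ]
  [NormedAddCommGroup E] [NormedSpace ℝ E] [FiniteDimensional ℝ E] [MeasurableSpace E]
  [BorelSpace E]

/-- The sum of `g` over the points of `A` in the fibre over `y` of the map with parameter `θ`. -/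
noncomputable def fiberSum (Φ : Θ → E → E) (A : Set (Θ × E)) (g : Θ × E → ℝ≥0∞) (q : Θ × E) : ℝ≥0∞ :=
  ∑' x : E, ({x | Φ q.1 x = q.2 ∧ (q.1, x) ∈ A}).indicator (fun x => g (q.1, x)) x

lemma fiberSum_apply_of_injOn {Φ : Θ → E → E} {A : Set (Θ × E)}
    (hinj : InjOn (fun p : Θ × E => (p.1, Φ p.1 p.2)) A) (g : Θ × E → ℝ≥0∞)
    {θ : Θ} {x : E} (hx : (θ, x) ∈ A) : fiberSum Φ A g (θ, Φ θ x) = g (θ, x) := by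
  unfold fiberSum
  rw [tsum_eq_single x]
  · simp [hx]
  · intro x' hx'
    refine indicator_of_notMem (fun h => hx' ?_) _
    have := @hinj (θ, x') h.2 (θ, x) hx (by simpa using h.1)
    simpa using this

lemma fiberSum_eq_zero {Φ : Θ → E → E} {A : Set (Θ × E)} (g : Θ × E → ℝ≥0∞)
    {θ : Θ} {y : E} (hy : ∀ x, (θ, x) ∈ A → Φ θ x ≠ y) : fiberSum Φ A g (θ, y) = 0 := by
  unfold fiberSum
  rw [ENNReal.tsum_eq_zero]
  intro x
  exact indicator_of_notMem (fun h => hy x h.2 h.1) _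

lemma fiberSum_iUnion {Φ : Θ → E → E} {A : ℕ → Set (Θ × E)} (hA : Pairwise (Disjoint on A))
    (g : Θ × E → ℝ≥0∞) (q : Θ × E) :
    fiberSum Φ (⋃ n, A n) g q = ∑' n, fiberSum Φ (A n) g q := by
  unfold fiberSum
  rw [ENNReal.tsum_comm]
  congr 1
  ext x
  by_cases hx : ∃ n, Φ q.1 x = q.2 ∧ (q.1, x) ∈ A n
  · obtain ⟨n, h1, h2⟩ := hx
    rw [tsum_eq_single n, indicator_of_mem, indicator_of_mem]
    · exact ⟨h1, h2⟩
    · exact ⟨h1, mem_iUnion.2 ⟨n, h2⟩⟩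
    · exact fun m hm => indicator_of_notMem (fun h => (hA hm).le_bot ⟨h.2, h2⟩) _
  · rw [indicator_of_notMem, ENNReal.tsum_eq_zero.2]
    · exact fun n => indicator_of_notMem (s := {x | Φ q.1 x = q.2 ∧ (q.1, x) ∈ A n})
        (fun h => hx ⟨n, h⟩) _
    · rintro ⟨h1, h2⟩
      obtain ⟨n, hn⟩ := mem_iUnion.1 h2
      exact hx ⟨n, h1, hn⟩

/-- By the Lusin–Souslin theorem an injective measurable map between standard Borel spaces is a
measurable embedding; the fibre sum is `g` transported along it and extended by zero. -/
lemma measurable_fiberSum_of_injOn [StandardBorelSpace Θ] {Φ : Θ → E → E} {A : Set (Θ × E)}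
    (hΦ : Measurable fun p : Θ × E => Φ p.1 p.2) (hA : MeasurableSet A)
    (hinj : InjOn (fun p : Θ × E => (p.1, Φ p.1 p.2)) A) {g : Θ × E → ℝ≥0∞} (hg : Measurable g) :
    Measurable (fiberSum Φ A g) := by
  set Ψ : A → Θ × E := fun p => (p.1.1, Φ p.1.1 p.1.2) with hΨ
  have : StandardBorelSpace A := hA.standardBorel
  have hme : MeasurableEmbedding Ψ := by
    refine Measurable.measurableEmbedding ?_ ?_
    · exact (measurable_fst.prodMk hΦ).comp measurable_subtype_coe
    · exact hinj.injective
  have h := hme.measurable_extend (hg.comp measurable_subtype_coe)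
    (measurable_const (a := (0 : ℝ≥0∞)))
  convert h using 1
  ext q
  by_cases hq : ∃ p, Ψ p = q
  · obtain ⟨p, rfl⟩ := hq
    rw [hme.injective.extend_apply]
    exact fiberSum_apply_of_injOn hinj g p.2
  · rw [Function.extend_apply' _ _ _ hq]
    refine fiberSum_eq_zero g fun x hx hxy => hq ⟨⟨(q.1, x), hx⟩, ?_⟩
    simp [hΨ, hxy]

lemma lintegral_fiberSum_of_injOn [StandardBorelSpace Θ] {Φ : Θ → E → E} {Φ' : Θ → E → E →L[ℝ] E}
    {A : Set (Θ × E)} (hA : MeasurableSet A)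
    (hinj : InjOn (fun p : Θ × E => (p.1, Φ p.1 p.2)) A)
    (hd : ∀ θ x, HasFDerivAt (Φ θ) (Φ' θ x) x) (g : Θ × E → ℝ≥0∞)
    (μ : Measure E) [μ.IsAddHaarMeasure] (p : E → ℝ≥0∞) (θ : Θ) :
    ∫⁻ y, p y * fiberSum Φ A g (θ, y) ∂μ =
      ∫⁻ x, A.indicator (fun q => p (Φ q.1 q.2) * g q * ENNReal.ofReal |(Φ' q.1 q.2).det|) (θ, x)
        ∂μ := by
  set B : Set E := {x | (θ, x) ∈ A}
  have hB : MeasurableSet B := measurable_prodMk_left hA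
  have hinjB : InjOn (Φ θ) B := fun x hx y hy h => by
    have := @hinj (θ, x) hx (θ, y) hy (by simpa using h)
    simpa using this
  have hm : MeasurableSet (Φ θ '' B) :=
    measurable_image_of_fderivWithin hB (fun x _ => (hd θ x).hasFDerivWithinAt) hinjB
  have h1 : ∫⁻ y, p y * fiberSum Φ A g (θ, y) ∂μ =
      ∫⁻ y in Φ θ '' B, p y * fiberSum Φ A g (θ, y) ∂μ := by
    rw [← lintegral_indicator hm]
    congr 1
    ext y
    by_cases hy : y ∈ Φ θ '' B
    · rw [indicator_of_mem hy]
    · rw [indicator_of_notMem hy, fiberSum_eq_zero g fun x hx hxy => hy ⟨x, hx, hxy⟩, mul_zero]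
  rw [h1, lintegral_image_eq_lintegral_abs_det_fderiv_mul μ hB
    (fun x _ => (hd θ x).hasFDerivWithinAt) hinjB, ← lintegral_indicator hB]
  congr 1
  ext x
  by_cases hx : x ∈ B
  · have hx' : (θ, x) ∈ A := hx
    rw [indicator_of_mem hx, indicator_of_mem hx', fiberSum_apply_of_injOn hinj g hx', mul_comm]
  · have hx' : (θ, x) ∉ A := hx
    rw [indicator_of_notMem hx, indicator_of_notMem hx']

/-- The points near a dense-sequence point where the map is quantitatively injective. -/
def antilipschitzPiece (Φ : Θ → E → E) (i : ℕ × ℕ × ℕ) : Set (Θ × E) :=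
  {θ | ∀ j k : ℕ, TopologicalSpace.denseSeq E j ∈
      Metric.ball (TopologicalSpace.denseSeq E i.1) (1 / ((i.2.1 : ℝ) + 1)) →
    TopologicalSpace.denseSeq E k ∈
      Metric.ball (TopologicalSpace.denseSeq E i.1) (1 / ((i.2.1 : ℝ) + 1)) →
    dist (TopologicalSpace.denseSeq E j) (TopologicalSpace.denseSeq E k) ≤
      i.2.2 * dist (Φ θ (TopologicalSpace.denseSeq E j)) (Φ θ (TopologicalSpace.denseSeq E k))}
  ×ˢ Metric.ball (TopologicalSpace.denseSeq E i.1) (1 / ((i.2.1 : ℝ) + 1))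

lemma measurableSet_antilipschitzPiece {Φ : Θ → E → E}
    (hΦ : Measurable fun p : Θ × E => Φ p.1 p.2) (i : ℕ × ℕ × ℕ) :
    MeasurableSet (antilipschitzPiece Φ i) := by
  have hx : ∀ x, Measurable fun θ => Φ θ x := fun x =>
    hΦ.comp (measurable_id.prodMk measurable_const)
  refine MeasurableSet.prod ?_ Metric.isOpen_ball.measurableSet
  have : ∀ j k : ℕ, Measurable fun θ => (i.2.2 : ℝ) *
      dist (Φ θ (TopologicalSpace.denseSeq E j)) (Φ θ (TopologicalSpace.denseSeq E k)) :=
    fun j k => ((hx _).dist (hx _)).const_mul _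
  refine measurableSet_setOfPred.2 ?_
  refine Measurable.forall fun j => Measurable.forall fun k => ?_
  refine Measurable.imp measurable_const (Measurable.imp measurable_const ?_)
  exact measurableSet_setOfPred.1 (measurableSet_le measurable_const (this j k))

/-- The antilipschitz bound is imposed on a dense sequence only, so that countably many measurable
conditions on `θ` suffice. Continuity of `Φ θ` extends it to the whole ball, where it forces
injectivity. -/
lemma injOn_antilipschitzPiece {Φ : Θ → E → E} (hc : ∀ θ, Continuous (Φ θ)) (i : ℕ × ℕ × ℕ) :
    InjOn (fun p : Θ × E => (p.1, Φ p.1 p.2)) (antilipschitzPiece Φ i) := by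
  rintro ⟨θ, x⟩ ⟨h, hx⟩ ⟨θ', y⟩ ⟨-, hy⟩ he
  simp only [Prod.mk.injEq] at he
  obtain ⟨rfl, he⟩ := he
  set B := Metric.ball (TopologicalSpace.denseSeq E i.1) (1 / ((i.2.1 : ℝ) + 1))
  set D := range (TopologicalSpace.denseSeq E)
  have hD : Dense D := TopologicalSpace.denseRange_denseSeq E
  have hsub : B ⊆ closure (D ∩ B) := by
    have := hD.open_subset_closure_inter (Metric.isOpen_ball : IsOpen B)
    rwa [inter_comm] at this
  have key : ∀ q ∈ closure ((D ∩ B) ×ˢ (D ∩ B)), dist q.1 q.2 ≤ i.2.2 * dist (Φ θ q.1) (Φ θ q.2) := by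
    refine fun q hq => closure_minimal (t := {q : E × E | dist q.1 q.2 ≤
      i.2.2 * dist (Φ θ q.1) (Φ θ q.2)}) ?_ ?_ hq
    · rintro ⟨_, _⟩ ⟨⟨⟨j, rfl⟩, hj⟩, ⟨⟨k, rfl⟩, hk⟩⟩
      exact h j k hj hk
    · have := hc θ
      exact isClosed_le (by fun_prop) (by fun_prop)
  have h1 := key (x, y) (by rw [closure_prod_eq]; exact ⟨hsub hx, hsub hy⟩)
  simp only [he, dist_self, mul_zero] at h1
  simp [dist_le_zero.1 h1]

/-- Where the determinant is nonzero, strict differentiability makes `Φ θ` antilipschitz near the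
point. The centre, radius and constant can then be taken from countable families. -/
lemma subset_iUnion_antilipschitzPiece {Φ : Θ → E → E} {Φ' : Θ → E → E →L[ℝ] E}
    (hd : ∀ θ x, HasFDerivAt (Φ θ) (Φ' θ x) x) (hc : ∀ θ, Continuous (Φ' θ)) :
    {p : Θ × E | (Φ' p.1 p.2).det ≠ 0} ⊆ ⋃ i, antilipschitzPiece Φ i := by
  rintro ⟨θ, x⟩ hx
  have hx : (Φ' θ x).det ≠ 0 := hx
  have hs : HasStrictFDerivAt (Φ θ) (Φ' θ x) x :=
    hasStrictFDerivAt_of_hasFDerivAt_of_continuousAt (Eventually.of_forall fun y => hd θ y)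
      (hc θ).continuousAt
  set e := (Φ' θ x).toContinuousLinearEquivOfDetNeZero hx
  have he : (e : E →L[ℝ] E) = Φ' θ x := by ext; rfl
  rw [← he] at hs
  obtain ⟨K, s, hs, hK⟩ : ∃ K : NNReal, ∃ s ∈ 𝓝 x, AntilipschitzWith K (s.domRestrict (Φ θ)) := by
    obtain ⟨s, hs1, hs2⟩ := hs.approximates_deriv_on_nhds
      (c := ‖(e.symm : E →L[ℝ] E)‖₊⁻¹ / 2) (e.subsingleton_or_nnnorm_symm_pos.imp id
        fun h => half_pos (inv_pos.2 h))
    exact ⟨_, s, hs1, hs2.antilipschitz (e.subsingleton_or_nnnorm_symm_pos.imp id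
        fun h => half_lt_self (inv_pos.2 h))⟩
  obtain ⟨ε, hε, hball⟩ := Metric.mem_nhds_iff.1 hs
  -- Half of `ε`, because the ball is centred at a nearby point of the dense sequence and not at
  -- `x`.
  obtain ⟨n, hn⟩ := exists_nat_one_div_lt (half_pos hε)
  have hpos : (0 : ℝ) < 1 / ((n : ℝ) + 1) := by positivity
  obtain ⟨i, hi⟩ := Metric.denseRange_iff.1 (TopologicalSpace.denseRange_denseSeq E) x _ hpos
  obtain ⟨m, hm⟩ := exists_nat_ge (K : ℝ)
  refine mem_iUnion.2 ⟨(i, n, m), ⟨?_, hi⟩⟩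
  have hsub : Metric.ball (TopologicalSpace.denseSeq E i) (1 / ((n : ℝ) + 1)) ⊆ s := by
    intro y hy
    apply hball
    have h1 : dist y (TopologicalSpace.denseSeq E i) < 1 / ((n : ℝ) + 1) := hy
    have := dist_triangle_right y x (TopologicalSpace.denseSeq E i)
    exact Metric.mem_ball.2 (by linarith)
  intro j k hj hk
  have := hK.le_mul_dist ⟨_, hsub hj⟩ ⟨_, hsub hk⟩
  refine this.trans ?_
  simp only [domRestrict_apply]
  gcongr

/-- The area formula for a family of `C¹` maps with a parameter, outside the critical points. -/
theorem measurable_fiberSum_and_lintegral [StandardBorelSpace Θ] {Φ : Θ → E → E}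
    {Φ' : Θ → E → E →L[ℝ] E}
    (hΦ : Measurable fun p : Θ × E => Φ p.1 p.2)
    (hd : ∀ θ x, HasFDerivAt (Φ θ) (Φ' θ x) x) (hc : ∀ θ, Continuous (Φ' θ))
    (hJ : Measurable fun p : Θ × E => (Φ' p.1 p.2).det) {g : Θ × E → ℝ≥0∞} (hg : Measurable g)
    (μ : Measure E) [μ.IsAddHaarMeasure] {p : E → ℝ≥0∞} (hp : Measurable p) :
    Measurable (fiberSum Φ {p | (Φ' p.1 p.2).det ≠ 0} g) ∧
    ∀ θ, ∫⁻ y, p y * fiberSum Φ {p | (Φ' p.1 p.2).det ≠ 0} g (θ, y) ∂μ =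
      ∫⁻ x, p (Φ θ x) * g (θ, x) * ENNReal.ofReal |(Φ' θ x).det| ∂μ := by
  set Z : Set (Θ × E) := {p | (Φ' p.1 p.2).det ≠ 0}
  have hZ : MeasurableSet Z := (hJ (measurableSet_singleton 0)).compl
  have hcΦ : ∀ θ, Continuous (Φ θ) := fun θ =>
    continuous_iff_continuousAt.2 fun x => (hd θ x).continuousAt
  set B : ℕ → Set (Θ × E) := fun n =>
    Z ∩ antilipschitzPiece Φ ((Denumerable.eqv (ℕ × ℕ × ℕ)).symm n) with hB
  -- With disjoint pieces each point of a fibre is counted once, so the fibre sum is a countable sum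
  -- of injective ones.
  set A := disjointed B with hA
  have hBm : ∀ n, MeasurableSet (B n) := fun n =>
    hZ.inter (measurableSet_antilipschitzPiece hΦ _)
  have hAm : ∀ n, MeasurableSet (A n) := fun n => MeasurableSet.disjointed hBm n
  have hinj : ∀ n, InjOn (fun p : Θ × E => (p.1, Φ p.1 p.2)) (A n) := fun n =>
    (injOn_antilipschitzPiece hcΦ _).mono ((disjointed_subset B n).trans inter_subset_right)
  have hdisj : Pairwise (Disjoint on A) := disjoint_disjointed B
  have hU : Z = ⋃ n, A n := by
    rw [hA, iUnion_disjointed, hB, ← inter_iUnion,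
      (Denumerable.eqv (ℕ × ℕ × ℕ)).symm.surjective.iUnion_comp (antilipschitzPiece Φ)]
    exact (inter_eq_left.2 (subset_iUnion_antilipschitzPiece hd hc)).symm
  have hme : ∀ n, Measurable (fiberSum Φ (A n) g) := fun n =>
    measurable_fiberSum_of_injOn hΦ (hAm n) (hinj n) hg
  have hsum : fiberSum Φ Z g = fun q => ∑' n, fiberSum Φ (A n) g q := by
    ext q
    rw [hU, fiberSum_iUnion hdisj]
  refine ⟨by rw [hsum]; exact Measurable.tsum hme, fun θ => ?_⟩
  have hmt : Measurable fun q : Θ × E =>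
      p (Φ q.1 q.2) * g q * ENNReal.ofReal |(Φ' q.1 q.2).det| :=
    ((hp.comp hΦ).mul hg).mul hJ.abs.ennreal_ofReal
  rw [hsum]
  simp_rw [← ENNReal.tsum_mul_left]
  rw [lintegral_tsum (f := fun n y => p y * fiberSum Φ (A n) g (θ, y))
    fun n => (hp.mul ((hme n).comp measurable_prodMk_left)).aemeasurable]
  simp_rw [lintegral_fiberSum_of_injOn (hAm _) (hinj _) hd g μ p θ]
  rw [← lintegral_tsum (f := fun n x => (A n).indicator (fun q : Θ × E =>
      p (Φ q.1 q.2) * g q * ENNReal.ofReal |(Φ' q.1 q.2).det|) (θ, x)) fun n =>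
    ((hmt.indicator (hAm n)).comp measurable_prodMk_left).aemeasurable]
  congr 1
  ext x
  have h1 : ∀ f : Θ × E → ℝ≥0∞, ∑' n, (A n).indicator f (θ, x) = Z.indicator f (θ, x) := by
    intro f
    rw [hU]
    by_cases hx : ∃ n, (θ, x) ∈ A n
    · obtain ⟨n, hn⟩ := hx
      rw [tsum_eq_single n, indicator_of_mem hn, indicator_of_mem (mem_iUnion.2 ⟨n, hn⟩)]
      exact fun m hm => indicator_of_notMem (fun h => (hdisj hm).le_bot ⟨h, hn⟩) _
    · rw [indicator_of_notMem (by simpa using hx), ENNReal.tsum_eq_zero.2]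
      exact fun n => indicator_of_notMem (fun h => hx ⟨n, h⟩) _
  rw [h1]
  by_cases hx : (θ, x) ∈ Z
  · rw [indicator_of_mem hx]
  · have h0 : (Φ' θ x).det = 0 := not_not.1 hx
    rw [indicator_of_notMem hx, h0]
    simp

/-- Sard's theorem with a parameter: the critical values form a measurable set with null
sections. -/
theorem criticalValues_measurable_null {Φ : Θ → E → E}
    {Φ' : Θ → E → E →L[ℝ] E}
    (hΦ : Measurable fun p : Θ × E => Φ p.1 p.2)
    (hd : ∀ θ x, HasFDerivAt (Φ θ) (Φ' θ x) x) (hc : ∀ θ, Continuous (Φ' θ))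
    (hJ : Measurable fun p : Θ × E => (Φ' p.1 p.2).det) (μ : Measure E) [μ.IsAddHaarMeasure] :
    MeasurableSet {q : Θ × E | ∃ x, Φ q.1 x = q.2 ∧ (Φ' q.1 x).det = 0} ∧
    ∀ θ, μ {y | ∃ x, Φ θ x = y ∧ (Φ' θ x).det = 0} = 0 := by
  have hcΦ : ∀ θ, Continuous (Φ θ) := fun θ =>
    continuous_iff_continuousAt.2 fun x => (hd θ x).continuousAt
  refine ⟨?_, fun θ => ?_⟩
  · have hx : ∀ x, Measurable fun θ => Φ θ x := fun x =>
      hΦ.comp (measurable_id.prodMk measurable_const)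
    have hx' : ∀ x, Measurable fun θ => (Φ' θ x).det := fun x =>
      hJ.comp (measurable_id.prodMk measurable_const)
    -- The quantifier over `x` is made countable: inside some ball, points of the dense sequence
    -- make `dist + |det|` arbitrarily small, and compactness turns this into an exact zero.
    have key : {q : Θ × E | ∃ x, Φ q.1 x = q.2 ∧ (Φ' q.1 x).det = 0} =
        ⋃ n : ℕ, ⋂ m : ℕ, ⋃ j : ℕ, {q : Θ × E |
          TopologicalSpace.denseSeq E j ∈ Metric.ball (0 : E) n ∧
          dist (Φ q.1 (TopologicalSpace.denseSeq E j)) q.2 +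
            |(Φ' q.1 (TopologicalSpace.denseSeq E j)).det| < 1 / ((m : ℝ) + 1)} := by
      ext ⟨θ, y⟩
      simp only [mem_ofPred_eq, mem_iUnion, mem_iInter]
      set G : E → ℝ := fun x => dist (Φ θ x) y + |(Φ' θ x).det| with hG
      have hGc : Continuous G := by
        have := hcΦ θ
        have h2 := ContinuousLinearMap.continuous_det.comp (hc θ)
        exact (this.dist continuous_const).add h2.abs
      constructor
      · rintro ⟨x, hx1, hx2⟩
        obtain ⟨n, hn⟩ := exists_nat_gt ‖x‖
        refine ⟨n, fun m => ?_⟩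
        have ho : IsOpen (Metric.ball (0 : E) n ∩ G ⁻¹' (Iio (1 / ((m : ℝ) + 1)))) :=
          Metric.isOpen_ball.inter (isOpen_Iio.preimage hGc)
        obtain ⟨j, hj⟩ := (TopologicalSpace.denseRange_denseSeq E).exists_mem_open ho
          ⟨x, by simpa using hn, by simp [hG, hx1, hx2]; positivity⟩
        exact ⟨j, hj⟩
      · rintro ⟨n, hn⟩
        choose j hj using hn
        obtain ⟨x, -, φ, hφ, hx⟩ := (isCompact_closedBall (0 : E) n).tendsto_subseq
          (x := fun m => TopologicalSpace.denseSeq E (j m))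
          fun m => Metric.ball_subset_closedBall (hj m).1
        have h0 : Tendsto (fun m => G (TopologicalSpace.denseSeq E (j (φ m)))) atTop (𝓝 0) :=
          squeeze_zero (fun m => by positivity) (fun m => (hj (φ m)).2.le)
            (tendsto_one_div_add_atTop_nhds_zero_nat.comp hφ.tendsto_atTop)
        have h1 := tendsto_nhds_unique ((hGc.tendsto x).comp hx) h0
        have h2 : dist (Φ θ x) y = 0 ∧ |(Φ' θ x).det| = 0 := by
          constructor <;> linarith [dist_nonneg (x := Φ θ x) (y := y), abs_nonneg (Φ' θ x).det, h1]
        exact ⟨x, dist_eq_zero.1 h2.1, abs_eq_zero.1 h2.2⟩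
    rw [key]
    refine MeasurableSet.iUnion fun n => MeasurableSet.iInter fun m => MeasurableSet.iUnion fun j => ?_
    refine MeasurableSet.inter (s₂ := {q : Θ × E | dist (Φ q.1 (TopologicalSpace.denseSeq E j)) q.2 +
        |(Φ' q.1 (TopologicalSpace.denseSeq E j)).det| < 1 / ((m : ℝ) + 1)}) (MeasurableSet.const _)
      (measurableSet_lt ?_ measurable_const)
    exact (((hx _).comp measurable_fst).dist measurable_snd).add ((hx' _).comp measurable_fst).abs
  · have := addHaar_image_eq_zero_of_det_fderivWithin_eq_zero μ (s := {x | (Φ' θ x).det = 0})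
      (f := Φ θ) (f' := Φ' θ) (fun x _ => (hd θ x).hasFDerivWithinAt) (fun x hx => hx)
    convert this using 2
    ext y
    simp [and_comm]

end AreaFormula
end GaussianEntire

namespace GaussianEntire
-- The type of a critical point from a second-order expansion of the height.
section LocalAnalysis
open Set Filter Topology

/-- Two divided differences at `0` remove the double zero of `f - f 0`. Keeping the quotient as a
continuous function spares a separate estimate of the Taylor remainder. -/
lemma exists_quadratic_expansion {f : ℂ → ℂ} (hf : Differentiable ℂ f) (h0 : deriv f 0 = 0) :
    ∃ g : ℂ → ℂ, Continuous g ∧ g 0 = deriv (deriv f) 0 / 2 ∧ ∀ w, f w = f 0 + w ^ 2 * g w := by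
  have hd : ∀ {h : ℂ → ℂ}, Differentiable ℂ h → Differentiable ℂ (dslope h 0) := fun hh =>
    differentiableOn_univ.1 ((Complex.differentiableOn_dslope univ_mem).2 hh.differentiableOn)
  set k := dslope f 0
  have hk : Differentiable ℂ k := hd hf
  set g := dslope k 0
  have hg : Differentiable ℂ g := hd hk
  have hk0 : k 0 = 0 := by simp [k, h0]
  have e1 : ∀ w, f w = f 0 + w ^ 2 * g w := by
    intro w
    have h1 := sub_smul_dslope f 0 w
    have h2 := sub_smul_dslope k 0 w
    simp only [sub_zero, smul_eq_mul, hk0] at h1 h2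
    change w * k w = _ at h1
    change w * g w = _ at h2
    rw [pow_two, mul_assoc, h2, h1]
    ring
  refine ⟨g, hg.continuous, ?_, e1⟩
  have e2 : deriv f = fun w => 2 * w * g w + w ^ 2 * deriv g w := by
    ext w
    rw [funext e1]
    have := ((hasDerivAt_pow 2 w).mul (hg w).hasDerivAt).const_add (f 0)
    rw [HasDerivAt.deriv (f := fun w => f 0 + w ^ 2 * g w) this]
    simp
  have hg' : Differentiable ℂ (deriv g) := by
    have := (hg.contDiff (n := 2))
    exact ContDiff.differentiable_deriv_two this
  have := ((((hasDerivAt_id (0:ℂ)).const_mul 2).mul (hg 0).hasDerivAt)).add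
    ((hasDerivAt_pow 2 (0:ℂ)).mul (hg' 0).hasDerivAt)
  rw [e2, HasDerivAt.deriv (f := fun w => 2 * w * g w + w ^ 2 * deriv g w) this]
  simp

/-- The cross term 2 Re(ξ̄w) of |ξ + w|² is absorbed by the entire factor exp(−ξ̄w). This is the
Bargmann–Fock translation moving `ξ` to the origin. -/
lemma height_add (F : ℂ → ℂ) (ξ w : ℂ) :
    height F (ξ + w) = ‖F (ξ + w) * Complex.exp (-(conj ξ * w))‖ * Real.exp (-‖w‖ ^ 2 / 2) *
      Real.exp (-‖ξ‖ ^ 2 / 2) := by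
  rw [height, norm_mul, Complex.norm_exp, mul_assoc, mul_assoc, ← Real.exp_add,
    ← Real.exp_add]
  congr 2
  rw [← Complex.normSq_eq_norm_sq, ← Complex.normSq_eq_norm_sq, ← Complex.normSq_eq_norm_sq,
    Complex.normSq_add]
  simp [Complex.mul_re]
  ring

/-- Near a critical point, the height is governed by a quadratic expansion. -/
lemma exists_height_expansion {F : ℂ → ℂ} (hF : Differentiable ℂ F) {ξ : ℂ}
    (hξ : ξ ∈ criticalPoints F) :
    ∃ g : ℂ → ℂ, Continuous g ∧ 2 * g 0 = deriv (deriv F) ξ - conj ξ ^ 2 * F ξ ∧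
      ∀ w, height F (ξ + w) =
        ‖F ξ + w ^ 2 * g w‖ * Real.exp (-‖w‖ ^ 2 / 2) * Real.exp (-‖ξ‖ ^ 2 / 2) := by
  have hξ' : deriv F ξ = conj ξ * F ξ := sub_eq_zero.1 hξ
  set f : ℂ → ℂ := fun w => F (ξ + w) * Complex.exp (-(conj ξ * w)) with hf
  have hF' : Differentiable ℂ (deriv F) := ContDiff.differentiable_deriv_two hF.contDiff
  have e : ∀ w, HasDerivAt (fun w => Complex.exp (-(conj ξ * w)))
      (Complex.exp (-(conj ξ * w)) * -conj ξ) w := by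
    intro w
    simpa using (((hasDerivAt_id w).const_mul (conj ξ)).neg).cexp
  have hd : ∀ {G : ℂ → ℂ}, Differentiable ℂ G → ∀ w,
      HasDerivAt (fun w => G (ξ + w)) (deriv G (ξ + w)) w := fun hG w =>
    (hG (ξ + w)).hasDerivAt.comp_const_add ξ w
  have d1 : ∀ w, HasDerivAt f ((deriv F (ξ + w) - conj ξ * F (ξ + w)) *
      Complex.exp (-(conj ξ * w))) w := by
    intro w
    refine ((hd hF w).mul (e w)).congr_deriv ?_
    ring
  have e1 : deriv f = fun w => (deriv F (ξ + w) - conj ξ * F (ξ + w)) *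
      Complex.exp (-(conj ξ * w)) := funext fun w => (d1 w).deriv
  have d2 := ((hd hF' 0).sub ((hd hF 0).const_mul (conj ξ))).mul (e 0)
  obtain ⟨g, hg, hg0, hfg⟩ := exists_quadratic_expansion (f := f)
    (fun w => (d1 w).differentiableAt) (by rw [e1]; simp [hξ'])
  refine ⟨g, hg, ?_, fun w => ?_⟩
  · rw [hg0, e1, HasDerivAt.deriv (f := fun w => (deriv F (ξ + w) - conj ξ * F (ξ + w)) *
      Complex.exp (-(conj ξ * w))) d2]
    simp [hξ']
    ring
  · rw [height_add]
    have := hfg w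
    simp only [hf, add_zero, mul_zero, neg_zero, Complex.exp_zero, mul_one] at this
    rw [this]

/-- With u = F(ξ), the modulus is at most |u|(1 + |w|²/2) ≤ |u| exp(|w|²/2) near the critical point,
and the Gaussian factor compensates this growth exactly. -/
lemma isLocalMax_height {F : ℂ → ℂ} (hF : Differentiable ℂ F) {ξ : ℂ}
    (hξ : ξ ∈ criticalPoints F) (h : ‖deriv (deriv F) ξ - conj ξ ^ 2 * F ξ‖ < ‖F ξ‖) :
    IsLocalMax (height F) ξ := by
  obtain ⟨g, hg, hg0, hh⟩ := exists_height_expansion hF hξ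
  have h1 : ‖g 0‖ < ‖F ξ‖ / 2 := by
    rw [← hg0, norm_mul] at h
    simp at h
    linarith
  have h2 : ∀ᶠ w in 𝓝 (0 : ℂ), ‖g w‖ < ‖F ξ‖ / 2 := hg.norm.continuousAt.eventually_lt_const h1
  have h3 : Tendsto (fun z => z - ξ) (𝓝 ξ) (𝓝 0) := by
    simpa using (continuous_sub_right ξ).tendsto ξ
  filter_upwards [h3.eventually h2] with z hz
  have e0 := hh 0
  have ez := hh (z - ξ)
  simp only [add_zero, add_sub_cancel] at e0 ez
  rw [e0, ez]
  set w := z - ξ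
  refine mul_le_mul_of_nonneg_right ?_ (Real.exp_pos _).le
  have : ‖F ξ + w ^ 2 * g w‖ ≤ ‖F ξ‖ * (‖w‖ ^ 2 / 2 + 1) := by
    refine (norm_add_le _ _).trans ?_
    rw [norm_mul, norm_pow]
    nlinarith [mul_le_mul_of_nonneg_left hz.le (sq_nonneg ‖w‖)]
  have h4 := Real.add_one_le_exp (‖w‖ ^ 2 / 2)
  calc _ ≤ ‖F ξ‖ * Real.exp (‖w‖ ^ 2 / 2) * Real.exp (-‖w‖ ^ 2 / 2) := by
        refine mul_le_mul_of_nonneg_right (this.trans ?_) (Real.exp_pos _).le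
        gcongr
    _ = _ := by
        rw [mul_assoc, ← Real.exp_add, neg_div, add_neg_cancel]
        simp

lemma exists_unit_sq_mul_eq (ρ : ℂ) : ∃ η : ℂ, ‖η‖ = 1 ∧ η ^ 2 * ρ = ‖ρ‖ := by
  refine ⟨Complex.exp ((-(ρ.arg) / 2 : ℝ) * Complex.I), Complex.norm_exp_ofReal_mul_I _, ?_⟩
  nth_rewrite 2 [← Complex.norm_mul_exp_arg_mul_I ρ]
  rw [← Complex.exp_nat_mul, mul_left_comm, ← Complex.exp_add]
  convert mul_one _
  rw [Complex.exp_eq_one_iff]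
  exact ⟨0, by push_cast; ring⟩

/-- Along the ray tζ the height is proportional to |1 + xk| exp(−x) with x = t²/2 and k → ζ²ρ, where
|ρ| > 1. It increases from t = 0 in the direction with ζ²ρ = |ρ|, and decreases after ζ is
multiplied by i. -/
lemma not_isLocalExtr_height {F : ℂ → ℂ} (hF : Differentiable ℂ F) {ξ : ℂ}
    (hξ : ξ ∈ criticalPoints F) (h0 : F ξ ≠ 0)
    (h : ‖F ξ‖ < ‖deriv (deriv F) ξ - conj ξ ^ 2 * F ξ‖) :
    ¬ IsLocalExtr (height F) ξ := by
  obtain ⟨g, hg, hg0, hh⟩ := exists_height_expansion hF hξ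
  set u := F ξ
  have hu : 0 < ‖u‖ := norm_pos_iff.2 h0
  set ρ := 2 * g 0 / u with hρ
  have hρ1 : 1 < ‖ρ‖ := by rw [hρ, norm_div, hg0, one_lt_div hu]; exact h
  obtain ⟨η, hη, hηρ⟩ := exists_unit_sq_mul_eq ρ
  have e0 := hh 0
  simp only [add_zero, norm_zero, ne_eq, OfNat.ofNat_ne_zero, not_false_eq_true, zero_pow, neg_zero,
    zero_div, Real.exp_zero, mul_one, zero_mul] at e0
  -- the behaviour along the ray in direction `ζ`
  have ray : ∀ ζ : ℂ, ‖ζ‖ = 1 → ∀ t : ℝ, height F (ξ + t * ζ) = ‖u‖ *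
      ‖1 + ((t ^ 2 / 2 : ℝ) : ℂ) * (2 * ζ ^ 2 * g (t * ζ) / u)‖ *
        Real.exp (-(t ^ 2 / 2)) * Real.exp (-‖ξ‖ ^ 2 / 2) := by
    intro ζ hζ t
    rw [hh, ← norm_mul]
    congr 3
    · field_simp
      push_cast
      ring
    · rw [norm_mul, hζ]
      simp
      ring
  have lim : ∀ ζ : ℂ, Tendsto (fun t : ℝ => 2 * ζ ^ 2 * g (t * ζ) / u) (𝓝[>] 0)
      (𝓝 (ζ ^ 2 * ρ)) := by
    intro ζ
    have : Continuous fun t : ℝ => 2 * ζ ^ 2 * g (t * ζ) / u := by fun_prop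
    have h1 := (this.tendsto 0).mono_left (nhdsWithin_le_nhds (s := Ioi 0))
    convert h1 using 2
    simp [hρ]
    ring
  have toξ : ∀ ζ : ℂ, Tendsto (fun t : ℝ => ξ + t * ζ) (𝓝[>] 0) (𝓝 ξ) := by
    intro ζ
    have : Continuous fun t : ℝ => ξ + t * ζ := by fun_prop
    have h1 := (this.tendsto 0).mono_left (nhdsWithin_le_nhds (s := Ioi 0))
    convert h1 using 2
    simp
  have small : ∀ᶠ t : ℝ in 𝓝[>] 0, 0 < t := eventually_mem_nhdsWithin
  have e2 : ∀ c > 0, ∀ᶠ t : ℝ in 𝓝[>] 0, t ^ 2 / 2 < c := by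
    intro c hc
    have : Continuous fun t : ℝ => t ^ 2 / 2 := by fun_prop
    exact ((this.tendsto 0).mono_left (nhdsWithin_le_nhds (s := Ioi 0))).eventually_lt_const
      (by simpa using hc)
  rintro (hmin | hmax)
  · have hη' : ‖η * Complex.I‖ = 1 := by simp [hη]
    have hl := lim (η * Complex.I)
    have : (η * Complex.I) ^ 2 * ρ = -‖ρ‖ := by
      rw [mul_pow, Complex.I_sq, ← hηρ]; ring
    rw [this] at hl
    have hl2 : ∀ᶠ t : ℝ in 𝓝[>] 0,
        ‖2 * (η * Complex.I) ^ 2 * g (t * (η * Complex.I)) / u + ‖ρ‖‖ < 1 := by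
      have := (hl.add_const (‖ρ‖ : ℂ)).norm
      refine this.eventually_lt_const ?_
      simp
    -- For `x < 1 / ‖ρ‖` the main term `1 - x * ‖ρ‖` is positive; as `‖ρ‖ > 1`, an error smaller
    -- than `x` cannot bring the modulus back to 1.
    obtain ⟨t, ht, ht1, ht2, hm⟩ := (small.and (hl2.and ((e2 (1 / ‖ρ‖) (by positivity)).and
      ((toξ (η * Complex.I)).eventually hmin)))).exists
    rw [ray _ hη', e0] at hm
    set k := 2 * (η * Complex.I) ^ 2 * g (t * (η * Complex.I)) / u
    set x := t ^ 2 / 2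
    have hx : 0 < x := by positivity
    have h1 : ‖1 + (x : ℂ) * k‖ < 1 := by
      have : 1 + (x : ℂ) * k = ((1 - x * ‖ρ‖ : ℝ) : ℂ) + x * (k + ‖ρ‖) := by push_cast; ring
      rw [this]
      refine (norm_add_le _ _).trans_lt ?_
      rw [norm_mul, Complex.norm_real, Complex.norm_real, Real.norm_of_nonneg hx.le,
        Real.norm_of_nonneg (by
          have := (lt_div_iff₀ (by positivity)).1 ht2
          linarith)]
      nlinarith
    have h2 : Real.exp (-x) ≤ 1 := Real.exp_le_one_iff.2 (by linarith)
    have h3 : ‖1 + (x : ℂ) * k‖ * Real.exp (-x) < 1 := by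
      nlinarith [norm_nonneg (1 + (x : ℂ) * k), Real.exp_pos (-x)]
    have h4 : ‖u‖ * Real.exp (-‖ξ‖ ^ 2 / 2) * (‖1 + (x : ℂ) * k‖ * Real.exp (-x)) <
      ‖u‖ * Real.exp (-‖ξ‖ ^ 2 / 2) * 1 := by gcongr
    linarith
  · have hl := lim η
    rw [hηρ] at hl
    set c := (1 + ‖ρ‖) / 2
    have hc1 : 1 < c := by simp only [c]; linarith
    have hl2 : ∀ᶠ t : ℝ in 𝓝[>] 0, c < (2 * η ^ 2 * g (t * η) / u).re := by
      have := (Complex.continuous_re.tendsto _).comp hl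
      refine this.eventually_const_lt ?_
      simp only [Complex.ofReal_re, c]
      linarith
    -- For `x > 0`, the bound `x < (c - 1) / c` is equivalent to `1 < (1 + x * c) * (1 - x)`.
    obtain ⟨t, ht, ht1, ht2, hm⟩ := (small.and (hl2.and ((e2 ((c - 1) / c)
      (by apply div_pos <;> linarith)).and ((toξ η).eventually hmax)))).exists
    rw [ray _ hη, e0] at hm
    set k := 2 * η ^ 2 * g (t * η) / u
    set x := t ^ 2 / 2
    have hx : 0 < x := by positivity
    have h1 : 1 + x * c ≤ ‖1 + (x : ℂ) * k‖ := by
      refine le_trans ?_ (Complex.re_le_norm _)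
      simp
      nlinarith
    have h2 := Real.one_sub_le_exp_neg x
    have hxc := (lt_div_iff₀ (by linarith)).1 ht2
    have h3 : 1 < ‖1 + (x : ℂ) * k‖ * Real.exp (-x) := by
      have : x < 1 := by nlinarith
      calc 1 < (1 + x * c) * (1 - x) := by nlinarith
        _ ≤ _ := by gcongr
    have h4 : ‖u‖ * Real.exp (-‖ξ‖ ^ 2 / 2) * 1 <
      ‖u‖ * Real.exp (-‖ξ‖ ^ 2 / 2) * (‖1 + (x : ℂ) * k‖ * Real.exp (-x)) := by gcongr
    linarith

end LocalAnalysis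
end GaussianEntire

namespace GaussianEntire
-- The map from a critical point and its value to the first two coefficients.
section CriticalMap
open Set Filter Topology

lemma det_conj_add (u s : ℂ) (J : ℂ →ₗ[ℝ] ℂ) (hJ : ∀ w, J w = u * conj w - s * w) :
    LinearMap.det J = ‖s‖ ^ 2 - ‖u‖ ^ 2 := by
  rw [← LinearMap.det_toMatrix Complex.basisOneI, Matrix.det_fin_two]
  simp only [LinearMap.toMatrix_apply, hJ, Complex.coe_basisOneI_repr, Complex.coe_basisOneI]
  rw [← Complex.normSq_eq_norm_sq, ← Complex.normSq_eq_norm_sq, Complex.normSq_apply,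
    Complex.normSq_apply]
  simp
  ring

lemma det_real_of_complex (V : ℂ × ℂ →ₗ[ℂ] ℂ × ℂ) (a b c d : ℂ)
    (hV : ∀ p, V p = (a * p.1 + b * p.2, c * p.1 + d * p.2)) :
    LinearMap.det (V.restrictScalars ℝ) = ‖a * d - b * c‖ ^ 2 := by
  rw [LinearMap.det_restrictScalars, ← LinearMap.det_toMatrix (Module.Basis.finTwoProd ℂ),
    Matrix.det_fin_two]
  simp [LinearMap.toMatrix_apply, hV, Complex.normSq_eq_norm_sq, Algebra.norm_complex_apply]

/-- The coefficients `(a₀, a₁)` for which `a₀ + a₁ z + R z` has a critical point at `z` with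
value `u`. -/
noncomputable def critMap (R : ℂ → ℂ) (p : ℂ × ℂ) : ℂ × ℂ :=
  (p.2 - p.1 * (conj p.1 * p.2 - deriv R p.1) - R p.1, conj p.1 * p.2 - deriv R p.1)

lemma contDiff_critMap {R : ℂ → ℂ} (hR : Differentiable ℂ R) : ContDiff ℝ 1 (critMap R) := by
  have h1 : ContDiff ℂ 2 R := hR.contDiff
  have h2 : ContDiff ℂ 1 (deriv R) := by
    have : ContDiff ℂ (1 + 1) R := hR.contDiff
    exact (contDiff_succ_iff_deriv.1 this).2.2
  have h3 : ContDiff ℝ 1 R := (hR.contDiff (n := 1)).restrict_scalars ℝ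
  have h4 : ContDiff ℝ 1 (deriv R) := h2.restrict_scalars ℝ
  have h5 : ContDiff ℝ 1 (fun z : ℂ => conj z) := Complex.conjCLE.contDiff
  unfold critMap
  have h6 : ContDiff ℝ 1 fun p : ℂ × ℂ => conj p.1 * p.2 - deriv R p.1 :=
    ((h5.comp contDiff_fst).mul contDiff_snd).sub (h4.comp contDiff_fst)
  exact ((contDiff_snd.sub (contDiff_fst.mul h6)).sub (h3.comp contDiff_fst)).prodMk h6

lemma fderiv_critMap_apply {R : ℂ → ℂ} (hR : Differentiable ℂ R) (p q : ℂ × ℂ) :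
    fderiv ℝ (critMap R) p q =
      (q.2 - q.1 * (conj p.1 * p.2 - deriv R p.1) -
        p.1 * (conj p.1 * q.2 + conj q.1 * p.2 - deriv (deriv R) p.1 * q.1) - deriv R p.1 * q.1,
       conj p.1 * q.2 + conj q.1 * p.2 - deriv (deriv R) p.1 * q.1) := by
  have hR' : Differentiable ℂ (deriv R) := ContDiff.differentiable_deriv_two hR.contDiff
  have h1 : HasFDerivAt (fun p : ℂ × ℂ => R p.1) _ p :=
    ((hR p.1).hasDerivAt.hasFDerivAt.restrictScalars ℝ).comp p (hasFDerivAt_fst (𝕜 := ℝ))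
  have h2 : HasFDerivAt (fun p : ℂ × ℂ => deriv R p.1) _ p :=
    ((hR' p.1).hasDerivAt.hasFDerivAt.restrictScalars ℝ).comp p (hasFDerivAt_fst (𝕜 := ℝ))
  have h3 : HasFDerivAt (fun p : ℂ × ℂ => conj p.1) _ p :=
    (Complex.conjCLE.hasFDerivAt).comp p (hasFDerivAt_fst (𝕜 := ℝ))
  have h4 := (h3.mul (hasFDerivAt_snd (𝕜 := ℝ) (p := p))).sub h2
  have h5 := (((hasFDerivAt_snd (𝕜 := ℝ) (p := p)).sub
    ((hasFDerivAt_fst (𝕜 := ℝ) (p := p)).mul h4)).sub h1).prodMk h4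
  rw [HasFDerivAt.fderiv (f := critMap R) h5]
  simp
  constructor <;> ring

/-- Up to the complex-linear maps `V` and `W`, of determinants −1 and 1, the differential is the
identity in one variable and `w ↦ u * conj w - s * w` in the other. The antilinear part comes from
differentiating the factor z̄. -/
lemma det_fderiv_critMap {R : ℂ → ℂ} (hR : Differentiable ℂ R) (p : ℂ × ℂ) :
    (fderiv ℝ (critMap R) p).det =
      ‖deriv (deriv R) p.1 - conj p.1 ^ 2 * p.2‖ ^ 2 - ‖p.2‖ ^ 2 := by
  obtain ⟨z, u⟩ := p
  set s := deriv (deriv R) z - conj z ^ 2 * u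
  let mk : ℂ → ℂ → ℂ → ℂ → (ℂ × ℂ →ₗ[ℂ] ℂ × ℂ) := fun a b c d =>
    (a • LinearMap.fst ℂ ℂ ℂ + b • LinearMap.snd ℂ ℂ ℂ).prod
      (c • LinearMap.fst ℂ ℂ ℂ + d • LinearMap.snd ℂ ℂ ℂ)
  have hmk : ∀ a b c d q, mk a b c d q = (a * q.1 + b * q.2, c * q.1 + d * q.2) :=
    fun _ _ _ _ _ => rfl
  let V := mk (-z) (1 - z * conj z) 1 (conj z)
  let W := mk 1 0 (-(conj z * u)) 1
  let J : ℂ →ₗ[ℝ] ℂ := u • (Complex.conjCLE : ℂ →L[ℝ] ℂ).toLinearMap - s • LinearMap.id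
  have hJ : ∀ w, J w = u * conj w - s * w := fun w => by simp [J]
  have key : (fderiv ℝ (critMap R) (z, u) : ℂ × ℂ →ₗ[ℝ] ℂ × ℂ) =
      V.restrictScalars ℝ ∘ₗ J.prodMap LinearMap.id ∘ₗ W.restrictScalars ℝ := by
    refine LinearMap.ext fun q => ?_
    rw [ContinuousLinearMap.coe_coe, fderiv_critMap_apply hR]
    simp only [LinearMap.comp_apply, LinearMap.restrictScalars_apply, LinearMap.prodMap_apply,
      LinearMap.id_apply, V, W, hmk, hJ, s]
    ext1 <;> ring_nf
  rw [ContinuousLinearMap.det, key, LinearMap.det_comp, LinearMap.det_comp, LinearMap.det_prodMap,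
    det_conj_add u s J hJ, det_real_of_complex V _ _ _ _ (fun p => rfl),
    det_real_of_complex W _ _ _ _ (fun p => rfl), LinearMap.det_id, show -z * conj z - (1 - z * conj z) * 1 = -1 by ring]
  simp [s]

end CriticalMap
end GaussianEntire

namespace GaussianEntire
-- The power series, its derivatives, and the splitting off of leading coefficients.
section Series
open Set Filter Topology

/-- The `k`-th monomial `zᵏ / √(k!)`, and its first two derivatives. -/
noncomputable def basisFun : Fin 3 → ℕ → ℂ → ℂ
  | 0, k, z => z ^ k / (Real.sqrt (k.factorial : ℝ) : ℂ)
  | 1, k, z => k * z ^ (k - 1) / (Real.sqrt (k.factorial : ℝ) : ℂ)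
  | 2, k, z => k * ((k - 1 : ℕ) * z ^ (k - 1 - 1)) / (Real.sqrt (k.factorial : ℝ) : ℂ)

/-- The series of the Gaussian entire function and of its first two derivatives. -/
noncomputable def derivSeries (j : Fin 3) (a : ℕ → ℂ) (z : ℂ) : ℂ :=
  ∑' k : ℕ, a k * basisFun j k z

lemma gef_eq_derivSeries (a : ℕ → ℂ) : gef a = derivSeries 0 a := by
  ext z
  simp only [gef, derivSeries, basisFun, mul_div_assoc]

/-- The coefficient sequences for which the series converges absolutely everywhere. -/
def goodSeq : Set (ℕ → ℂ) :=
  {a | ∀ n : ℕ, ∑' k : ℕ, ENNReal.ofReal (‖a k‖ * (n ^ k / Real.sqrt (k.factorial : ℝ))) ≠ ∞}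

lemma measurableSet_goodSeq : MeasurableSet goodSeq := by
  refine measurableSet_setOfPred.2 (Measurable.forall fun n => measurableSet_setOfPred.1 ?_)
  have : Measurable fun a : ℕ → ℂ =>
      ∑' k : ℕ, ENNReal.ofReal (‖a k‖ * (n ^ k / Real.sqrt (k.factorial : ℝ))) := by
    refine Measurable.tsum fun k => ?_
    exact ((measurable_pi_apply k).norm.mul_const _).ennreal_ofReal
  exact (this (measurableSet_singleton ∞)).compl

lemma summable_of_mem_goodSeq {a : ℕ → ℂ} (ha : a ∈ goodSeq) (n : ℕ) :
    Summable fun k => ‖a k‖ * (n ^ k / Real.sqrt (k.factorial : ℝ)) := by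
  refine (ENNReal.summable_toReal (ha n)).congr fun k => ?_
  rw [ENNReal.toReal_ofReal (by positivity)]

lemma mem_goodSeq {a : ℕ → ℂ}
    (h : ∀ n : ℕ, Summable fun k => ‖a k‖ * ((n : ℝ) ^ k / Real.sqrt (k.factorial : ℝ))) :
    a ∈ goodSeq := by
  intro n
  rw [← ENNReal.ofReal_tsum_of_nonneg (fun k => by positivity) (h n)]
  exact ENNReal.ofReal_ne_top

/-- Differentiating at most twice costs a factor of at most k² ≤ 4ᵏ, and the base n + 1 ≥ 1 allows
the lowered exponent to be raised back to k. Summability at integer radii thus controls the series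
and both derivatives. -/
lemma norm_basisFun_le (j : Fin 3) (k : ℕ) {z : ℂ} {n : ℕ} (hz : ‖z‖ ≤ n) :
    ‖basisFun j k z‖ ≤ ((4 * (n + 1) : ℕ) : ℝ) ^ k / Real.sqrt (k.factorial : ℝ) := by
  have h1 : ∀ m ≤ k, ‖z‖ ^ m ≤ ((n : ℝ) + 1) ^ k := fun m hm =>
    (pow_le_pow_left₀ (norm_nonneg _) (by linarith) m).trans
      (pow_le_pow_right₀ (by linarith [Nat.cast_nonneg (α := ℝ) n]) hm)
  have h2 : (k : ℝ) ≤ 2 ^ k := by exact_mod_cast Nat.lt_two_pow_self.le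
  have h2' : ((k - 1 : ℕ) : ℝ) ≤ 2 ^ k :=
    le_trans (by exact_mod_cast Nat.sub_le k 1) h2
  have h3 : (1 : ℝ) ≤ 4 ^ k := one_le_pow₀ (by norm_num)
  have h4 : (2 : ℝ) ^ k * 2 ^ k = 4 ^ k := by rw [← mul_pow]; norm_num
  have h5 : (2 : ℝ) ^ k ≤ 4 ^ k := pow_le_pow_left₀ (by norm_num) (by norm_num) k
  push_cast
  rw [mul_pow]
  fin_cases j
  · simp only [basisFun, norm_div, norm_pow, Complex.norm_real,
      Real.norm_of_nonneg (Real.sqrt_nonneg _)]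
    gcongr
    nlinarith [h1 k le_rfl, pow_nonneg (norm_nonneg z) k]
  · simp only [basisFun, norm_div, norm_pow, norm_mul, Complex.norm_real,
      Real.norm_of_nonneg (Real.sqrt_nonneg _), RCLike.norm_natCast]
    gcongr
    · exact h2.trans h5
    · exact h1 _ (by omega)
  · simp only [basisFun, norm_div, norm_pow, norm_mul, Complex.norm_real,
      Real.norm_of_nonneg (Real.sqrt_nonneg _), RCLike.norm_natCast]
    rw [← h4, mul_assoc]
    gcongr
    exact h1 _ (by omega)

lemma summable_derivSeries {a : ℕ → ℂ} (ha : a ∈ goodSeq) (j : Fin 3) (z : ℂ) :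
    Summable fun k => a k * basisFun j k z := by
  obtain ⟨n, hn⟩ := exists_nat_ge ‖z‖
  refine Summable.of_norm_bounded (summable_of_mem_goodSeq ha (4 * (n + 1))) fun k => ?_
  rw [norm_mul]
  gcongr
  exact norm_basisFun_le j k hn

lemma hasDerivAt_basisFun (j : Fin 2) (k : ℕ) (z : ℂ) :
    HasDerivAt (basisFun j.castSucc k) (basisFun j.succ k z) z := by
  fin_cases j
  · exact (hasDerivAt_pow k z).div_const _
  · exact (((hasDerivAt_pow (k - 1) z).const_mul (k : ℂ))).div_const _

lemma hasDerivAt_derivSeries {a : ℕ → ℂ} (ha : a ∈ goodSeq) (j : Fin 2) (z : ℂ) :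
    HasDerivAt (derivSeries j.castSucc a) (derivSeries j.succ a z) z := by
  obtain ⟨n, hn⟩ := exists_nat_gt ‖z‖
  have hd : ∀ k w, HasDerivAt (fun w => a k * basisFun j.castSucc k w)
      (a k * basisFun j.succ k w) w := fun k w => (hasDerivAt_basisFun j k w).const_mul _
  have hb : ∀ k, ∀ w ∈ Metric.ball (0 : ℂ) n, ‖a k * basisFun j.castSucc k w‖ ≤
      ‖a k‖ * ((4 * (n + 1) : ℕ) ^ k / Real.sqrt (k.factorial : ℝ)) := by
    intro k w hw
    rw [norm_mul]
    gcongr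
    exact norm_basisFun_le _ k (by simpa using (mem_ball_zero_iff.1 hw).le)
  have hz : z ∈ Metric.ball (0 : ℂ) n := by simpa using hn
  have hs := summable_of_mem_goodSeq ha (4 * (n + 1))
  have h1 := Complex.hasSum_deriv_of_summable_norm hs
    (fun k => fun w _ => (hd k w).differentiableAt.differentiableWithinAt) Metric.isOpen_ball hb hz
  have h2 := (Complex.differentiableOn_tsum_of_summable_norm hs
    (fun k => fun w _ => (hd k w).differentiableAt.differentiableWithinAt)
    Metric.isOpen_ball hb).differentiableAt (Metric.isOpen_ball.mem_nhds hz)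
  have h3 := h2.hasDerivAt
  rw [← h1.tsum_eq] at h3
  exact h3.congr_deriv (tsum_congr fun k => (hd k z).deriv)

lemma differentiable_gef {a : ℕ → ℂ} (ha : a ∈ goodSeq) : Differentiable ℂ (gef a) := by
  rw [gef_eq_derivSeries]
  exact fun z => (hasDerivAt_derivSeries ha 0 z).differentiableAt

lemma deriv_gef {a : ℕ → ℂ} (ha : a ∈ goodSeq) : deriv (gef a) = derivSeries 1 a := by
  rw [gef_eq_derivSeries]
  exact funext fun z => (hasDerivAt_derivSeries ha 0 z).deriv

lemma deriv_deriv_gef {a : ℕ → ℂ} (ha : a ∈ goodSeq) :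
    deriv (deriv (gef a)) = derivSeries 2 a := by
  rw [deriv_gef ha]
  exact funext fun z => (hasDerivAt_derivSeries ha 1 z).deriv

lemma continuous_basisFun (j : Fin 3) (k : ℕ) : Continuous (basisFun j k) := by
  match j with
  | 0 => unfold basisFun; fun_prop
  | 1 => unfold basisFun; fun_prop
  | 2 => unfold basisFun; fun_prop

lemma measurable_derivSeries (j : Fin 3) :
    Measurable fun p : (ℕ → ℂ) × ℂ => derivSeries j p.1 p.2 := by
  unfold derivSeries
  refine Measurable.tsum fun k => ?_
  exact ((measurable_pi_apply k).comp measurable_fst).mul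
    ((continuous_basisFun j k).measurable.comp measurable_snd)

/-- The sequence with first term `x`, followed by the sequence `a`. -/
def seqCons (x : ℂ) (a : ℕ → ℂ) : ℕ → ℂ
  | 0 => x
  | k + 1 => a k

lemma measurable_seqCons : Measurable fun p : ℂ × (ℕ → ℂ) => seqCons p.1 p.2 := by
  refine measurable_pi_lambda _ fun k => ?_
  cases k with
  | zero => exact measurable_fst
  | succ k => exact (measurable_pi_apply k).comp measurable_snd

lemma seqCons_mem_goodSeq (x : ℂ) {a : ℕ → ℂ} (ha : a ∈ goodSeq) : seqCons x a ∈ goodSeq := by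
  refine mem_goodSeq fun n => (summable_nat_add_iff 1).1 ?_
  refine Summable.of_nonneg_of_le (fun k => by positivity) (fun k => ?_)
    ((summable_of_mem_goodSeq ha n).mul_left (n : ℝ))
  change ‖a k‖ * _ ≤ _
  rw [mul_left_comm, ← mul_div_assoc (n : ℝ), ← pow_succ']
  gcongr
  omega

lemma single_mem_goodSeq (k : ℕ) (x : ℂ) : Pi.single k x ∈ goodSeq := by
  refine mem_goodSeq fun n => summable_of_ne_finset_zero (s := {k}) fun j hj => ?_
  rw [Pi.single_eq_of_ne (by simpa using hj)]
  simp

lemma derivSeries_single_add (j : Fin 3) (k : ℕ) (x : ℂ) {a : ℕ → ℂ} (ha : a ∈ goodSeq) (z : ℂ) :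
    derivSeries j (Pi.single k x + a) z = x * basisFun j k z + derivSeries j a z := by
  unfold derivSeries
  simp only [Pi.add_apply, add_mul]
  rw [(summable_derivSeries (single_mem_goodSeq k x) j z).tsum_add (summable_derivSeries ha j z),
    tsum_eq_single k]
  · simp
  · intro m hm
    simp [Pi.single_eq_of_ne hm]

lemma seqCons_eq (x : ℂ) (a : ℕ → ℂ) : seqCons x a = Pi.single 0 x + seqCons 0 a := by
  ext k
  rcases k with _ | k <;> simp [seqCons]

lemma seqCons_single_add (k : ℕ) (x : ℂ) (a : ℕ → ℂ) :
    seqCons 0 (Pi.single k x + a) = Pi.single (k + 1) x + seqCons 0 a := by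
  ext m
  rcases m with _ | m
  · simp [seqCons]
  · simp [seqCons, Pi.single_apply]

/-- Two coefficients followed by a tail. -/
lemma derivSeries_seqCons_seqCons (j : Fin 3) (x y : ℂ) {a : ℕ → ℂ} (ha : a ∈ goodSeq) (z : ℂ) :
    derivSeries j (seqCons x (seqCons y a)) z =
      x * basisFun j 0 z + y * basisFun j 1 z + derivSeries j (seqCons 0 (seqCons 0 a)) z := by
  have h := seqCons_mem_goodSeq 0 ha
  rw [seqCons_eq x, derivSeries_single_add _ _ _ (seqCons_mem_goodSeq _ (seqCons_mem_goodSeq _ ha)),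
    seqCons_eq y, seqCons_single_add, derivSeries_single_add _ _ _ (seqCons_mem_goodSeq _ h),
    add_assoc]

lemma derivSeries_tail_seqCons (j : Fin 3) (w : ℂ) {a : ℕ → ℂ} (ha : a ∈ goodSeq) (z : ℂ) :
    derivSeries j (seqCons 0 (seqCons 0 (seqCons w a))) z =
      w * basisFun j 2 z + derivSeries j (seqCons 0 (seqCons 0 (seqCons 0 a))) z := by
  have h := seqCons_mem_goodSeq 0 ha
  rw [seqCons_eq w, seqCons_single_add, seqCons_single_add, derivSeries_single_add _ _ _
    (seqCons_mem_goodSeq _ (seqCons_mem_goodSeq _ h))]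

/-- The part of the series of degree at least two, with coefficients `a₀, a₁, …`; set to zero
when the series does not converge. -/
noncomputable def tailFun (a : ℕ → ℂ) : ℂ → ℂ :=
  open Classical in if a ∈ goodSeq then gef (seqCons 0 (seqCons 0 a)) else 0

/-- Thanks to the default value `0` there is no exceptional sequence, as required by the area
formula, whose hypotheses range over all parameters. -/
lemma differentiable_tailFun (a : ℕ → ℂ) : Differentiable ℂ (tailFun a) := by
  unfold tailFun
  split_ifs with h
  · exact differentiable_gef (seqCons_mem_goodSeq _ (seqCons_mem_goodSeq _ h))
  · exact differentiable_const 0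

lemma iterate_deriv_tailFun (j : Fin 3) :
    (fun p : (ℕ → ℂ) × ℂ => deriv^[j] (tailFun p.1) p.2) =
      (goodSeq ×ˢ univ).indicator fun p => derivSeries j (seqCons 0 (seqCons 0 p.1)) p.2 := by
  ext ⟨a, z⟩
  by_cases h : a ∈ goodSeq
  · have h' := seqCons_mem_goodSeq 0 (seqCons_mem_goodSeq 0 h)
    rw [indicator_of_mem (by simpa using h)]
    simp only [tailFun, h, if_true]
    fin_cases j
    · simp [gef_eq_derivSeries]
    · simp [deriv_gef h']
    · simp [deriv_deriv_gef h']
  · rw [indicator_of_notMem (by simpa using h)]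
    simp only [tailFun, h, if_false]
    have hz : deriv (0 : ℂ → ℂ) = 0 := by ext; simp
    fin_cases j <;> simp [hz]

lemma measurable_iterate_deriv_tailFun (j : Fin 3) :
    Measurable fun p : (ℕ → ℂ) × ℂ => deriv^[j] (tailFun p.1) p.2 := by
  rw [iterate_deriv_tailFun]
  refine Measurable.indicator ?_ (measurableSet_goodSeq.prod MeasurableSet.univ)
  refine (measurable_derivSeries j).comp (Measurable.prodMk ?_ measurable_snd)
  exact measurable_seqCons.comp (measurable_const.prodMk
    (measurable_seqCons.comp (measurable_const.prodMk measurable_fst)))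

lemma measurable_tailFun : Measurable fun p : (ℕ → ℂ) × ℂ => tailFun p.1 p.2 :=
  measurable_iterate_deriv_tailFun 0

lemma measurable_deriv_tailFun : Measurable fun p : (ℕ → ℂ) × ℂ => deriv (tailFun p.1) p.2 :=
  measurable_iterate_deriv_tailFun 1

lemma measurable_deriv_deriv_tailFun :
    Measurable fun p : (ℕ → ℂ) × ℂ => deriv (deriv (tailFun p.1)) p.2 :=
  measurable_iterate_deriv_tailFun 2

lemma gef_seqCons_seqCons (x y : ℂ) {a : ℕ → ℂ} (ha : a ∈ goodSeq) (z : ℂ) :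
    gef (seqCons x (seqCons y a)) z = x + y * z + tailFun a z := by
  rw [gef_eq_derivSeries, derivSeries_seqCons_seqCons _ _ _ ha]
  simp [basisFun, tailFun, ha, gef_eq_derivSeries]

attribute [irreducible] tailFun

end Series
end GaussianEntire

namespace GaussianEntire
-- The i.i.d. Gaussian sequence: convergence and characteristic functions.
section GaussianSequence
open Set Filter Topology

lemma measurable_gaussianDensity :
    Measurable fun z : ℂ => ENNReal.ofReal (Real.pi⁻¹ * Real.exp (-‖z‖ ^ 2)) := by
  fun_prop

lemma lintegral_stdComplexGaussian {f : ℂ → ℝ≥0∞} (hf : Measurable f) :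
    ∫⁻ z, f z ∂stdComplexGaussian =
      ∫⁻ z, ENNReal.ofReal (Real.pi⁻¹ * Real.exp (-‖z‖ ^ 2)) * f z := by
  rw [stdComplexGaussian, lintegral_withDensity_eq_lintegral_mul _ measurable_gaussianDensity hf]
  rfl

lemma integral_stdComplexGaussian (f : ℂ → ℂ) :
    ∫ z, f z ∂stdComplexGaussian = ∫ z, ((Real.pi⁻¹ * Real.exp (-‖z‖ ^ 2) : ℝ) : ℂ) * f z := by
  rw [stdComplexGaussian, integral_withDensity_eq_integral_toReal_smul measurable_gaussianDensity
    (by simp)]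
  congr 1
  ext z
  rw [ENNReal.toReal_ofReal (by positivity), Complex.real_smul]

lemma integrable_exp_neg_mul_sq_norm {b : ℝ} (hb : 0 < b) :
    Integrable fun z : ℂ => Real.exp (-b * ‖z‖ ^ 2) := by
  have := (GaussianFourier.integrable_cexp_neg_mul_sq_norm_add (V := ℂ) (b := b) (by simpa) 0 0).re
  refine this.congr (Eventually.of_forall fun z => ?_)
  have e : -(b : ℂ) * (‖z‖ : ℂ) ^ 2 + 0 * ((inner ℝ 0 z : ℝ) : ℂ) =
      ((-b * ‖z‖ ^ 2 : ℝ) : ℂ) := by push_cast; ring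
  simp only [e]
  exact Complex.exp_ofReal_re _

instance : IsProbabilityMeasure stdComplexGaussian := by
  constructor
  rw [← setLIntegral_one, setLIntegral_univ, lintegral_stdComplexGaussian measurable_const]
  simp only [mul_one]
  have h := integrable_exp_neg_mul_sq_norm one_pos
  have h1 := GaussianFourier.integral_rexp_neg_mul_sq_norm (V := ℂ) one_pos
  simp only [neg_mul, one_mul, div_one, Complex.finrank_real_complex, Nat.cast_ofNat, ne_eq,
    OfNat.ofNat_ne_zero, not_false_eq_true, div_self, Real.rpow_one] at h h1
  rw [← ofReal_integral_eq_lintegral_ofReal (h.const_mul _)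
    (Eventually.of_forall fun z => by positivity), integral_const_mul, h1,
    inv_mul_cancel₀ Real.pi_ne_zero, ENNReal.ofReal_one]

/-- Since E|z|² = 1 is shared by two real coordinates, the inner product with `w` has variance
|w|²/2; hence the 1/4. -/
lemma integral_cexp_inner_stdComplexGaussian (w : ℂ) :
    ∫ z, Complex.exp (Complex.I * (inner ℝ w z : ℝ)) ∂stdComplexGaussian =
      Complex.exp (-(‖w‖ ^ 2 / 4 : ℝ)) := by
  rw [integral_stdComplexGaussian]
  have h := GaussianFourier.integral_cexp_neg_mul_sq_norm_add (V := ℂ) (b := 1) (by simp)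
    Complex.I w
  simp only [div_one, Complex.finrank_real_complex, Nat.cast_ofNat, ne_eq, mul_one,
    OfNat.ofNat_ne_zero, not_false_eq_true, div_self, Complex.cpow_one, Complex.I_sq] at h
  have h2 : (Real.pi : ℂ) ≠ 0 := by exact_mod_cast Real.pi_ne_zero
  calc _ = ∫ z : ℂ, (Real.pi : ℂ)⁻¹ *
        Complex.exp (-1 * (‖z‖ : ℂ) ^ 2 + Complex.I * (inner ℝ w z : ℝ)) := by
        congr 1
        ext z
        rw [Complex.exp_add]
        push_cast
        rw [neg_one_mul]
        ring
    _ = _ := by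
        rw [integral_const_mul, h, inv_mul_cancel_left₀ h2]
        congr 1
        push_cast
        ring

lemma lintegral_norm_stdComplexGaussian_lt_top :
    ∫⁻ z, ENNReal.ofReal ‖z‖ ∂stdComplexGaussian < ∞ := by
  rw [lintegral_stdComplexGaussian (by fun_prop)]
  have h := (integrable_exp_neg_mul_sq_norm (b := 1 / 2) (by norm_num)).const_mul Real.pi⁻¹
  refine lt_of_le_of_lt (lintegral_mono fun z => ?_) h.lintegral_lt_top
  rw [← ENNReal.ofReal_mul (by positivity)]
  refine ENNReal.ofReal_le_ofReal ?_
  rw [mul_assoc]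
  refine mul_le_mul_of_nonneg_left ?_ (by positivity)
  have h1 : ‖z‖ ≤ Real.exp (‖z‖ ^ 2 / 2) := by
    have := Real.add_one_le_exp (‖z‖ ^ 2 / 2)
    nlinarith [sq_nonneg (‖z‖ - 1)]
  calc _ ≤ Real.exp (-‖z‖ ^ 2) * Real.exp (‖z‖ ^ 2 / 2) := by gcongr
    _ = _ := by rw [← Real.exp_add]; congr 1; ring

/-- The law of an i.i.d. sequence of standard complex Gaussian variables. -/
noncomputable def gaussianSeq : Measure (ℕ → ℂ) :=
  Measure.infinitePi fun _ => stdComplexGaussian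

instance : IsProbabilityMeasure gaussianSeq := by
  unfold gaussianSeq; infer_instance

/-- This self-similarity lets leading coefficients be integrated out one at a time, the remaining
sequence having the same law. By uniqueness of the product measure it suffices to test cylinders. -/
lemma map_seqCons_gaussianSeq :
    (stdComplexGaussian.prod gaussianSeq).map (fun p => seqCons p.1 p.2) = gaussianSeq := by
  refine Measure.eq_infinitePi _ fun s t ht => ?_
  have hm : MeasurableSet ((s : Set ℕ).pi t) := MeasurableSet.pi s.countable_toSet fun i _ => ht i
  classical
  have hs : ∀ k ∉ s, k ∈ s → False := fun k h h' => h h'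
  -- Unconstrained coordinates receive `univ`, so that the cylinder lives on an initial segment of
  -- indices, which can be shifted by one.
  let t' : ℕ → Set ℂ := fun k => if k ∈ s then t k else univ
  have ht' : ∀ k, MeasurableSet (t' k) := fun k => by
    simp only [t']; split_ifs
    · exact ht k
    · exact MeasurableSet.univ
  obtain ⟨n, hn⟩ := s.exists_nat_subset_range
  have e1 : (fun p : ℂ × (ℕ → ℂ) => seqCons p.1 p.2) ⁻¹' ((s : Set ℕ).pi t) =
      t' 0 ×ˢ ((Finset.range n : Set ℕ).pi fun k => t' (k + 1)) := by
    ext ⟨x, a⟩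
    simp only [mem_preimage, Set.mem_pi, mem_prod, t']
    constructor
    · refine fun h => ⟨?_, fun k _ => ?_⟩
      · split_ifs with h0
        · exact h 0 h0
        · trivial
      · split_ifs with h0
        · exact h (k + 1) h0
        · trivial
    · rintro ⟨h0, h1⟩ k hk
      have hk' : k ∈ s := hk
      rcases k with _ | k
      · simpa [hk', seqCons] using h0
      · have := h1 k (by simpa using (Nat.lt_succ_self k).trans (Finset.mem_range.1 (hn hk')))
        simpa [hk', seqCons] using this
  rw [Measure.map_apply measurable_seqCons hm, e1, Measure.prod_prod, gaussianSeq,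
    Measure.infinitePi_pi _ (fun k _ => ht' (k + 1)),
    ← Finset.prod_range_succ' (fun k => stdComplexGaussian (t' k)) n |>.trans (mul_comm _ _)]
  have hsub : s ⊆ Finset.range (n + 1) := hn.trans (by simp)
  rw [← Finset.prod_subset hsub fun k _ hk => by simp [t', hk]]
  exact Finset.prod_congr rfl fun k hk => by simp [t', hk]

lemma lintegral_gaussianSeq {f : (ℕ → ℂ) → ℝ≥0∞} (hf : Measurable f) :
    ∫⁻ a, f a ∂gaussianSeq =
      ∫⁻ a, ∫⁻ x, f (seqCons x a) ∂stdComplexGaussian ∂gaussianSeq := by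
  conv_lhs => rw [← map_seqCons_gaussianSeq]
  rw [lintegral_map hf measurable_seqCons,
    lintegral_prod_symm (fun p : ℂ × (ℕ → ℂ) => f (seqCons p.1 p.2))
      (hf.comp measurable_seqCons).aemeasurable]

/-- Write the term as (2n)ᵏ/√(k!) times 2⁻ᵏ. Since xy ≤ x² + y² for x, y ≥ 0, it is dominated by
(4n²)ᵏ/k! + 4⁻ᵏ. -/
lemma summable_pow_div_sqrt_factorial (n : ℕ) :
    Summable fun k : ℕ => (n : ℝ) ^ k / Real.sqrt (k.factorial : ℝ) := by
  have h1 := (Real.summable_pow_div_factorial (4 * (n : ℝ) ^ 2))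
  have h2 : Summable fun k : ℕ => (1 / 4 : ℝ) ^ k :=
    summable_geometric_of_lt_one (by norm_num) (by norm_num)
  refine Summable.of_nonneg_of_le (fun k => by positivity) (fun k => ?_) (h1.add h2)
  have hk : (0 : ℝ) < Real.sqrt (k.factorial : ℝ) := Real.sqrt_pos.2 (by positivity)
  have e : (4 * (n : ℝ) ^ 2) ^ k / (k.factorial : ℝ) =
      ((2 * n : ℝ) ^ k / Real.sqrt (k.factorial : ℝ)) ^ 2 := by
    rw [div_pow, Real.sq_sqrt (by positivity), ← pow_mul, mul_comm k, pow_mul (2 * (n : ℝ))]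
    congr 2
    ring
  have e2 : (1 / 4 : ℝ) ^ k = ((1 / 2 : ℝ) ^ k) ^ 2 := by
    rw [← pow_mul, mul_comm k, pow_mul]; norm_num
  have e3 : (n : ℝ) ^ k / Real.sqrt (k.factorial : ℝ) =
      ((2 * n : ℝ) ^ k / Real.sqrt (k.factorial : ℝ)) * (1 / 2 : ℝ) ^ k := by
    rw [div_mul_eq_mul_div, ← mul_pow]; congr 2; ring
  rw [e, e2, e3]
  nlinarith [sq_nonneg ((2 * n : ℝ) ^ k / Real.sqrt (k.factorial : ℝ) - (1 / 2 : ℝ) ^ k),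
    sq_nonneg ((2 * n : ℝ) ^ k / Real.sqrt (k.factorial : ℝ)), sq_nonneg ((1 / 2 : ℝ) ^ k)]

/-- At each integer radius the series of absolute values has finite expectation, because E|aₖ| does
not depend on k. -/
lemma ae_mem_goodSeq : ∀ᵐ a ∂gaussianSeq, a ∈ goodSeq := by
  refine ae_all_iff.2 fun n => ?_
  have hm : ∀ k : ℕ, Measurable fun a : ℕ → ℂ =>
      ENNReal.ofReal (‖a k‖ * (n ^ k / Real.sqrt (k.factorial : ℝ))) := fun k =>
    ((measurable_pi_apply k).norm.mul_const _).ennreal_ofReal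
  have h : ∫⁻ a, ∑' k : ℕ, ENNReal.ofReal (‖a k‖ * (n ^ k / Real.sqrt (k.factorial : ℝ)))
      ∂gaussianSeq ≠ ∞ := by
    rw [lintegral_tsum fun k => (hm k).aemeasurable]
    have e : ∀ k : ℕ, ∫⁻ a, ENNReal.ofReal (‖a k‖ * (n ^ k / Real.sqrt (k.factorial : ℝ)))
        ∂gaussianSeq = (∫⁻ z, ENNReal.ofReal ‖z‖ ∂stdComplexGaussian) *
          ENNReal.ofReal (n ^ k / Real.sqrt (k.factorial : ℝ)) := by
      intro k
      have hp := measurePreserving_eval_infinitePi (fun _ : ℕ => stdComplexGaussian) k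
      rw [← lintegral_mul_const _ (by fun_prop), ← hp.lintegral_comp (by fun_prop)]
      congr 1
      ext a
      rw [ENNReal.ofReal_mul (by positivity)]
    simp_rw [e]
    rw [ENNReal.tsum_mul_left]
    refine ENNReal.mul_ne_top lintegral_norm_stdComplexGaussian_lt_top.ne ?_
    rw [← ENNReal.ofReal_tsum_of_nonneg (fun k => by positivity) (summable_pow_div_sqrt_factorial n)]
    exact ENNReal.ofReal_ne_top
  filter_upwards [ae_lt_top (Measurable.tsum hm) h] with a ha using ha.ne

lemma integral_cexp_sum_inner_gaussianSeq (n : ℕ) (c : ℕ → ℂ) :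
    ∫ a, Complex.exp (Complex.I * (∑ k ∈ Finset.range n, inner ℝ (c k) (a k) : ℝ)) ∂gaussianSeq =
      Complex.exp (-(∑ k ∈ Finset.range n, ‖c k‖ ^ 2 / 4 : ℝ)) := by
  induction n generalizing c with
  | zero => simp
  | succ n ih =>
    have hm : Measurable fun a : ℕ → ℂ => Complex.exp (Complex.I *
        (∑ k ∈ Finset.range (n + 1), inner ℝ (c k) (a k) : ℝ)) := by fun_prop
    conv_lhs => rw [← map_seqCons_gaussianSeq]
    rw [integral_map measurable_seqCons.aemeasurable hm.aestronglyMeasurable]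
    have e : ∀ p : ℂ × (ℕ → ℂ), Complex.exp (Complex.I * (∑ k ∈ Finset.range (n + 1),
        inner ℝ (c k) (seqCons p.1 p.2 k) : ℝ)) =
        Complex.exp (Complex.I * (inner ℝ (c 0) p.1 : ℝ)) * Complex.exp (Complex.I *
          (∑ k ∈ Finset.range n, inner ℝ (c (k + 1)) (p.2 k) : ℝ)) := by
      intro p
      rw [← Complex.exp_add, Finset.sum_range_succ']
      simp only [seqCons]
      push_cast
      ring_nf
    simp_rw [e]
    rw [integral_prod_mul (fun x : ℂ => Complex.exp (Complex.I * (inner ℝ (c 0) x : ℝ)))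
      (fun a : ℕ → ℂ => Complex.exp (Complex.I *
          (∑ k ∈ Finset.range n, inner ℝ (c (k + 1)) (a k) : ℝ))), ih fun k => c (k + 1),
      integral_cexp_inner_stdComplexGaussian, ← Complex.exp_add, Finset.sum_range_succ']
    push_cast
    ring_nf

/-- The characteristic function of a series of independent Gaussian variables. -/
lemma integral_cexp_series_gaussianSeq {c : ℕ → ℂ} {σ : ℝ} (hc : HasSum (fun k => ‖c k‖ ^ 2) σ)
    {X : (ℕ → ℂ) → ℝ} (hX : ∀ᵐ a ∂gaussianSeq, HasSum (fun k => inner ℝ (c k) (a k)) (X a)) :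
    ∫ a, Complex.exp (Complex.I * (X a : ℝ)) ∂gaussianSeq = Complex.exp (-(σ / 4 : ℝ)) := by
  have h1 : Tendsto (fun n => ∫ a, Complex.exp (Complex.I *
      (∑ k ∈ Finset.range n, inner ℝ (c k) (a k) : ℝ)) ∂gaussianSeq) atTop
      (𝓝 (∫ a, Complex.exp (Complex.I * (X a : ℝ)) ∂gaussianSeq)) := by
    refine tendsto_integral_of_dominated_convergence (fun _ => 1) (fun n => ?_)
      (integrable_const 1) (fun n => Eventually.of_forall fun a => ?_) ?_
    · have : Measurable fun a : ℕ → ℂ => Complex.exp (Complex.I *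
        (∑ k ∈ Finset.range n, inner ℝ (c k) (a k) : ℝ)) := by fun_prop
      exact this.aestronglyMeasurable
    · rw [mul_comm, Complex.norm_exp_ofReal_mul_I]
    · filter_upwards [hX] with a ha
      have hcont : Continuous fun x : ℝ => Complex.exp (Complex.I * x) := by fun_prop
      exact (hcont.tendsto _).comp ha.tendsto_sum_nat
  simp_rw [integral_cexp_sum_inner_gaussianSeq] at h1
  refine tendsto_nhds_unique h1 ?_
  have hcont : Continuous fun x : ℝ => Complex.exp (-(x : ℂ)) := by fun_prop
  exact (hcont.tendsto _).comp (hc.div_const 4).tendsto_sum_nat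

end GaussianSequence
end GaussianEntire

namespace GaussianEntire
-- Independence of the function and its covariant derivatives at a point.
section PointLaw
open Set Filter Topology

lemma hasSum_congr_of_eq {f g : ℕ → ℝ} {a b : ℝ} (h : HasSum f a) (hf : ∀ k, g k = f k)
    (ha : b = a) : HasSum g b := by
  rw [funext hf, ha]
  exact h

/-- Up to the factor exp(−r) these are the factorial moments of a Poisson variable: the falling
factorial cancels against k!, leaving a shifted exponential series. -/
lemma hasSum_descFactorial_mul (r : ℝ) (m : ℕ) :
    HasSum (fun k : ℕ => (k.descFactorial m : ℝ) * (r ^ k / k.factorial)) (r ^ m * Real.exp r) := by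
  have h : HasSum (fun k : ℕ => r ^ k / (k.factorial : ℝ)) (Real.exp r) := by
    rw [Real.exp_eq_exp_ℝ]
    exact NormedSpace.expSeries_div_hasSum_exp r
  have h2 := (hasSum_nat_add_iff (f := fun k : ℕ =>
    (k.descFactorial m : ℝ) * (r ^ k / k.factorial)) (g := r ^ m * Real.exp r) m).1 (by
      rw [show (fun k : ℕ => ((k + m).descFactorial m : ℝ) * (r ^ (k + m) / (k + m).factorial)) =
        fun k : ℕ => r ^ m * (r ^ k / k.factorial) from ?_]
      · simpa using h.mul_left (r ^ m)
      funext k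
      have h3 : ((k + m).descFactorial m : ℝ) * k.factorial = (k + m).factorial := by
        have := Nat.factorial_mul_descFactorial (Nat.le_add_left m k)
        rw [Nat.add_sub_cancel] at this
        rw [mul_comm]
        exact_mod_cast this
      have h4 : (k.factorial : ℝ) ≠ 0 := by positivity
      have h5 : ((k + m).factorial : ℝ) ≠ 0 := by positivity
      field_simp
      rw [← h3, pow_add]
      ring)
  rwa [Finset.sum_eq_zero, add_zero] at h2
  intro i hi
  rw [Nat.descFactorial_eq_zero_iff_lt.2 (Finset.mem_range.1 hi)]
  simp

lemma cast_descFactorial_succ (k m : ℕ) :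
    (k.descFactorial (m + 1) : ℝ) = (k - m) * k.descFactorial m := by
  rw [Nat.descFactorial_succ]
  rcases lt_or_ge k m with h | h
  · simp [Nat.descFactorial_eq_zero_iff_lt.2 h]
  · push_cast [Nat.cast_sub h]; rfl

/-- Orthogonality of the Charlier polynomials of degree at most two. -/
lemma hasSum_charlier (r : ℝ) (s τ₁ τ₂ : ℂ) :
    HasSum (fun k : ℕ => Real.exp (-r) * (r ^ k / k.factorial) *
      ‖s + τ₁ * ((k - r : ℝ) : ℂ) + τ₂ * ((k * (k - 1) - 2 * r * k + r ^ 2 : ℝ) : ℂ)‖ ^ 2)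
      (‖s‖ ^ 2 + ‖τ₁‖ ^ 2 * r + ‖τ₂‖ ^ 2 * (2 * r ^ 2)) := by
  have d := hasSum_descFactorial_mul r
  set A := ‖s‖ ^ 2
  set B := ‖τ₁‖ ^ 2
  set C := ‖τ₂‖ ^ 2
  set p := 2 * (s * conj τ₁).re
  set q := 2 * (s * conj τ₂).re
  set w := 2 * (τ₁ * conj τ₂).re
  have key : ∀ x y : ℝ, ‖s + τ₁ * (x : ℂ) + τ₂ * (y : ℂ)‖ ^ 2 =
      A + B * x ^ 2 + C * y ^ 2 + p * x + q * y + w * (x * y) := by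
    intro x y
    simp only [A, B, C, p, q, w, ← Complex.normSq_eq_norm_sq, Complex.normSq_apply]
    simp
    ring
  -- coefficients with respect to the falling factorials
  have h := ((((((d 0).mul_left (A + B * r ^ 2 + C * r ^ 4 - p * r + q * r ^ 2 - w * r ^ 3)).add
    ((d 1).mul_left (B * (1 - 2 * r) + C * (4 * r ^ 2 - 4 * r ^ 3) + p - 2 * r * q +
      w * (3 * r ^ 2 - 2 * r)))).add
    ((d 2).mul_left (B + C * (2 - 8 * r + 6 * r ^ 2) + q + w * (2 - 3 * r)))).add
    ((d 3).mul_left (C * (4 - 4 * r) + w))).add ((d 4).mul_left C)).mul_left (Real.exp (-r))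
  have he : Real.exp (-r) * Real.exp r = 1 := by rw [← Real.exp_add]; simp
  refine hasSum_congr_of_eq h (fun k => ?_) ?_
  · rw [key]
    simp only [cast_descFactorial_succ, Nat.descFactorial_zero]
    push_cast
    ring
  · linear_combination (-(A + B * r + C * (2 * r ^ 2))) * he

/-- The coefficients of the values at `z` of the function and of its first two covariant
derivatives, normalised to have unit variance. -/
noncomputable def normCoeff (z : ℂ) (e : Fin 3 → ℂ) : ℂ × ℂ × ℂ :=
  ((Real.exp (-‖z‖ ^ 2 / 2) : ℂ) * e 0,
    (Real.exp (-‖z‖ ^ 2 / 2) : ℂ) * (e 1 - conj z * e 0),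
    (Real.exp (-‖z‖ ^ 2 / 2) : ℂ) * ((e 2 - 2 * conj z * e 1 + conj z ^ 2 * e 0) /
      (Real.sqrt 2 : ℂ)))

/-- With r = |z|² and z̄ = r/z, the k-th coefficients are exp(−r/2) zᵏ/√(k!) times multiples of the
first three Charlier polynomials in k. Their squared moduli carry Poisson weights, so orthogonality
applies. The division by z excludes `z = 0`, a null set in the later integrals. -/
lemma hasSum_normCoeff {z : ℂ} (hz : z ≠ 0) (s₀ s₁ s₂ : ℂ) :
    HasSum (fun k : ℕ => ‖s₀ * (normCoeff z fun j => basisFun j k z).1 +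
      s₁ * (normCoeff z fun j => basisFun j k z).2.1 +
      s₂ * (normCoeff z fun j => basisFun j k z).2.2‖ ^ 2) (‖s₀‖ ^ 2 + ‖s₁‖ ^ 2 + ‖s₂‖ ^ 2) := by
  have h := hasSum_charlier (‖z‖ ^ 2) s₀ (s₁ / z) (s₂ / (Real.sqrt 2 * z ^ 2))
  have hz' : ‖z‖ ≠ 0 := norm_ne_zero_iff.2 hz
  have h2 : (Real.sqrt 2 : ℂ) ≠ 0 := by
    exact_mod_cast (Real.sqrt_pos.2 (by norm_num : (0 : ℝ) < 2)).ne'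
  have hzz : z * conj z = ((‖z‖ ^ 2 : ℝ) : ℂ) := by
    rw [Complex.mul_conj, Complex.normSq_eq_norm_sq]
  convert h using 1
  · ext k
    have e1 : (k : ℂ) * z ^ (k - 1) = z ^ k * (k / z) := by
      rcases k with _ | k
      · simp
      · field_simp
        simp
        ring
    have e2 : (k : ℂ) * ((k - 1 : ℕ) * z ^ (k - 1 - 1)) = z ^ k * (k * (k - 1) / z ^ 2) := by
      rcases k with _ | _ | k
      · simp
      · simp
      · field_simp
        simp
        ring
    have e0 : s₀ * (normCoeff z fun j => basisFun j k z).1 +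
      s₁ * (normCoeff z fun j => basisFun j k z).2.1 +
      s₂ * (normCoeff z fun j => basisFun j k z).2.2 =
        (Real.exp (-‖z‖ ^ 2 / 2) : ℂ) * (z ^ k / (Real.sqrt (k.factorial : ℝ) : ℂ)) *
        (s₀ + s₁ / z * ((k - ‖z‖ ^ 2 : ℝ) : ℂ) + s₂ / (Real.sqrt 2 * z ^ 2) *
          ((k * (k - 1) - 2 * ‖z‖ ^ 2 * k + (‖z‖ ^ 2) ^ 2 : ℝ) : ℂ)) := by
      simp only [normCoeff, basisFun]
      rw [e1, e2]
      have e3 : conj z = ((‖z‖ ^ 2 : ℝ) : ℂ) / z := by rw [← hzz]; field_simp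
      rw [e3]
      have hk : (Real.sqrt (k.factorial : ℝ) : ℂ) ≠ 0 := by
        exact_mod_cast (Real.sqrt_pos.2 (by positivity)).ne'
      push_cast
      field_simp
      try ring
    rw [e0, norm_mul, norm_mul, norm_div, norm_pow, Complex.norm_real, Complex.norm_real, mul_pow,
      mul_pow, div_pow, Real.norm_of_nonneg (Real.exp_pos _).le,
      Real.norm_of_nonneg (Real.sqrt_nonneg _), Real.sq_sqrt (by positivity), ← Real.exp_nat_mul,
      ← pow_mul, ← pow_mul, ← pow_mul, mul_comm k 2]
    congr 3
    push_cast
    ring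
  · rw [norm_div, norm_div, norm_mul, norm_pow, Complex.norm_real,
      Real.norm_of_nonneg (Real.sqrt_nonneg _), div_pow, div_pow, mul_pow,
      Real.sq_sqrt (by norm_num)]
    field_simp

lemma exists_inner_eq (L : StrongDual ℝ ℂ) : ∃ t : ℂ, ∀ v, L v = inner ℝ t v :=
  ⟨(InnerProductSpace.toDual ℝ ℂ).symm L, fun v => by simp⟩

lemma charFunDual_stdComplexGaussian (L : StrongDual ℝ ℂ) (t : ℂ) (h : ∀ v, L v = inner ℝ t v) :
    charFunDual stdComplexGaussian L = Complex.exp (-(‖t‖ ^ 2 / 4 : ℝ)) := by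
  rw [charFunDual_apply, ← integral_cexp_inner_stdComplexGaussian]
  simp_rw [h, mul_comm]

lemma measurable_normCoeff_derivSeries (z : ℂ) :
    Measurable fun a : ℕ → ℂ => normCoeff z fun j => derivSeries j a z := by
  have h : ∀ j, Measurable fun a : ℕ → ℂ => derivSeries j a z := fun j =>
    (measurable_derivSeries j).comp (measurable_id.prodMk measurable_const)
  have h0 := h 0
  have h1 := h 1
  have h2 := h 2
  unfold normCoeff
  fun_prop

/-- The values at a point of the Gaussian entire function and of its first two covariant
derivatives are independent Gaussian variables. -/
lemma map_normCoeff_gaussianSeq {z : ℂ} (hz : z ≠ 0) :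
    gaussianSeq.map (fun a => normCoeff z fun j => derivSeries j a z) =
      stdComplexGaussian.prod (stdComplexGaussian.prod stdComplexGaussian) := by
  have hmeas := measurable_normCoeff_derivSeries z
  have : IsProbabilityMeasure (gaussianSeq.map fun a => normCoeff z fun j => derivSeries j a z) :=
    Measure.isProbabilityMeasure_map hmeas.aemeasurable
  refine Measure.ext_of_charFunDual ?_
  ext L
  obtain ⟨t₀, h0⟩ := exists_inner_eq (L ∘SL ContinuousLinearMap.inl ℝ ℂ (ℂ × ℂ))
  obtain ⟨t₁, h1⟩ := exists_inner_eq ((L ∘SL ContinuousLinearMap.inr ℝ ℂ (ℂ × ℂ)) ∘SL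
    ContinuousLinearMap.inl ℝ ℂ ℂ)
  obtain ⟨t₂, h2⟩ := exists_inner_eq ((L ∘SL ContinuousLinearMap.inr ℝ ℂ (ℂ × ℂ)) ∘SL
    ContinuousLinearMap.inr ℝ ℂ ℂ)
  have hL : ∀ v : ℂ × ℂ × ℂ, L v = inner ℝ t₀ v.1 + inner ℝ t₁ v.2.1 + inner ℝ t₂ v.2.2 := by
    intro v
    rw [← h0, ← h1, ← h2]
    simp only [ContinuousLinearMap.comp_apply, ContinuousLinearMap.inl_apply,
      ContinuousLinearMap.inr_apply, ← map_add]
    simp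
  rw [charFunDual_prod, charFunDual_prod, charFunDual_stdComplexGaussian _ t₀ h0,
    charFunDual_stdComplexGaussian _ t₁ h1, charFunDual_stdComplexGaussian _ t₂ h2,
    charFunDual_apply, integral_map hmeas.aemeasurable
      (Continuous.aestronglyMeasurable (by fun_prop))]
  set f : ℕ → ℂ × ℂ × ℂ := fun k => normCoeff z fun j => basisFun j k z
  -- The conjugates arise because, for the real inner product, ⟨t, a f⟩ = ⟨t f̄, a⟩.
  set c : ℕ → ℂ := fun k => t₀ * conj (f k).1 + t₁ * conj (f k).2.1 + t₂ * conj (f k).2.2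
  have hc : HasSum (fun k => ‖c k‖ ^ 2) (‖t₀‖ ^ 2 + ‖t₁‖ ^ 2 + ‖t₂‖ ^ 2) := by
    have := hasSum_normCoeff hz (conj t₀) (conj t₁) (conj t₂)
    simp only [RCLike.norm_conj] at this
    convert this using 3 with k
    rw [← RCLike.norm_conj]
    simp [c, f]
  have hX : ∀ᵐ a ∂gaussianSeq, HasSum (fun k => inner ℝ (c k) (a k))
      (L (normCoeff z fun j => derivSeries j a z)) := by
    filter_upwards [ae_mem_goodSeq] with a ha
    have hs : ∀ j, HasSum (fun k => a k * basisFun j k z) (derivSeries j a z) := fun j =>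
      (summable_derivSeries ha j z).hasSum
    have hv : HasSum (fun k => a k • f k) (normCoeff z fun j => derivSeries j a z) := by
      have e0 := (hs 0).mul_left (Real.exp (-‖z‖ ^ 2 / 2) : ℂ)
      have e1 := ((hs 1).sub ((hs 0).mul_left (conj z))).mul_left (Real.exp (-‖z‖ ^ 2 / 2) : ℂ)
      have e2 := ((((hs 2).sub ((hs 1).mul_left (2 * conj z))).add
        ((hs 0).mul_left (conj z ^ 2))).div_const (Real.sqrt 2 : ℂ)).mul_left
          (Real.exp (-‖z‖ ^ 2 / 2) : ℂ)
      have e3 := e0.prodMk (e1.prodMk e2)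
      rw [show (fun k => a k • f k) = _ from ?_]
      · exact e3
      · ext k <;> simp [f, normCoeff] <;> ring
    have hv' := hv.mapL L
    rw [show (fun k => inner ℝ (c k) (a k)) = fun k => L (a k • f k) from ?_]
    · exact hv'
    funext k
    rw [hL]
    simp only [c, Complex.inner, Prod.smul_fst, Prod.smul_snd, smul_eq_mul, ← Complex.add_re]
    congr 1
    simp
    ring
  have := integral_cexp_series_gaussianSeq hc hX
  simp_rw [mul_comm Complex.I] at this
  rw [this, ← Complex.exp_add, ← Complex.exp_add]
  congr 1
  push_cast
  ring

end PointLaw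
end GaussianEntire

namespace GaussianEntire
-- The density of the normalised jet at a point, at every value.
section PointDensity
open Set Filter Topology

/-- The density of the standard complex Gaussian law. -/
noncomputable def gaussDens (w : ℂ) : ℝ := Real.pi⁻¹ * Real.exp (-‖w‖ ^ 2)

/-- The density of three independent standard complex Gaussian variables. -/
noncomputable def gaussDens₃ (p : ℂ × ℂ × ℂ) : ℝ :=
  gaussDens p.1 * (gaussDens p.2.1 * gaussDens p.2.2)

lemma gaussDens_nonneg (w : ℂ) : 0 ≤ gaussDens w := by unfold gaussDens; positivity

lemma gaussDens_le (w : ℂ) : gaussDens w ≤ 1 := by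
  unfold gaussDens
  have h1 : Real.exp (-‖w‖ ^ 2) ≤ 1 := Real.exp_le_one_iff.2 (by nlinarith [sq_nonneg ‖w‖])
  have h2 : Real.pi⁻¹ ≤ 1 := inv_le_one_of_one_le₀ (by linarith [Real.pi_gt_three])
  exact mul_le_one₀ h2 (Real.exp_pos _).le h1

lemma gaussDens₃_nonneg (p : ℂ × ℂ × ℂ) : 0 ≤ gaussDens₃ p :=
  mul_nonneg (gaussDens_nonneg _) (mul_nonneg (gaussDens_nonneg _) (gaussDens_nonneg _))

lemma gaussDens₃_le (p : ℂ × ℂ × ℂ) : gaussDens₃ p ≤ 1 :=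
  mul_le_one₀ (gaussDens_le _) (mul_nonneg (gaussDens_nonneg _) (gaussDens_nonneg _))
    (mul_le_one₀ (gaussDens_le _) (gaussDens_nonneg _) (gaussDens_le _))

@[fun_prop]
lemma continuous_gaussDens : Continuous gaussDens := by unfold gaussDens; fun_prop

@[fun_prop]
lemma continuous_gaussDens₃ : Continuous gaussDens₃ := by unfold gaussDens₃; fun_prop

lemma prod_stdComplexGaussian_eq_withDensity :
    stdComplexGaussian.prod (stdComplexGaussian.prod stdComplexGaussian) =
      (volume : Measure (ℂ × ℂ × ℂ)).withDensity fun p => ENNReal.ofReal (gaussDens₃ p) := by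
  have h : stdComplexGaussian = volume.withDensity fun z => ENNReal.ofReal (gaussDens z) := rfl
  have hm : Measurable fun z => ENNReal.ofReal (gaussDens z) := by fun_prop
  rw [h, prod_withDensity hm hm, prod_withDensity hm (by fun_prop)]
  rw [Measure.volume_eq_prod ℂ (ℂ × ℂ), Measure.volume_eq_prod ℂ ℂ]
  congr 1
  ext p
  rw [gaussDens₃, ENNReal.ofReal_mul (gaussDens_nonneg _), ENNReal.ofReal_mul (gaussDens_nonneg _)]

lemma lintegral_affine {c : ℝ} (hc : c ≠ 0) (b : ℂ) (f : ℂ → ℝ≥0∞) :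
    ∫⁻ x, f x = ENNReal.ofReal (c ^ 2) * ∫⁻ x : ℂ, f (c * x + b) := by
  rw [lintegral_add_right_eq_self (fun y => f y) b |>.symm]
  have h := Measure.map_addHaar_smul (volume : Measure ℂ) hc
  have h1 : ∫⁻ x : ℂ, f (c * x + b) = ∫⁻ x, f (x + b) ∂(volume.map fun x : ℂ => c • x) := by
    have := lintegral_map_equiv (μ := volume) (fun x => f (x + b))
      (Homeomorph.smulOfNeZero c hc (α := ℂ)).toMeasurableEquiv
    rw [show ((Homeomorph.smulOfNeZero c hc (α := ℂ)).toMeasurableEquiv : ℂ → ℂ) =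
      fun x => c • x from rfl] at this
    rw [this]
    simp
  rw [h1, h, lintegral_smul_measure, smul_eq_mul, ← mul_assoc, ← ENNReal.ofReal_mul (by positivity)]
  rw [Complex.finrank_real_complex, abs_of_nonneg (by positivity), mul_inv_cancel₀ (by positivity)]
  simp

/-- Integrating the coordinates in their order of dependence reduces everything to translations and
real dilations of ℂ, a dilation by `c` having Jacobian c². -/
lemma lintegral_lower_triangular {c₀ c₁ c₂ : ℝ} (h₀ : c₀ ≠ 0) (h₁ : c₁ ≠ 0) (h₂ : c₂ ≠ 0)
    {b₁ : ℂ → ℂ} (hb₁ : Measurable b₁) {b₂ : ℂ → ℂ → ℂ} (hb₂ : Measurable fun p : ℂ × ℂ => b₂ p.1 p.2)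
    {g : ℂ × ℂ × ℂ → ℝ≥0∞} (hg : Measurable g) :
    ∫⁻ p, g p = ENNReal.ofReal (c₀ ^ 2 * (c₁ ^ 2 * c₂ ^ 2)) *
      ∫⁻ n : ℂ × ℂ × ℂ, g (c₀ * n.1, c₁ * n.2.1 + b₁ n.1,
        c₂ * n.2.2 + b₂ (c₀ * n.1) (c₁ * n.2.1 + b₁ n.1)) := by
  have hit : ∀ {g : ℂ × ℂ × ℂ → ℝ≥0∞}, Measurable g →
      ∫⁻ p, g p = ∫⁻ x, ∫⁻ y, ∫⁻ w, g (x, y, w) := by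
    intro g hg
    rw [Measure.volume_eq_prod, lintegral_prod _ hg.aemeasurable]
    congr 1
    ext x
    rw [Measure.volume_eq_prod, lintegral_prod (fun q : ℂ × ℂ => g (x, q))
      (hg.comp measurable_prodMk_left).aemeasurable]
  have hm : Measurable fun n : ℂ × ℂ × ℂ => g (c₀ * n.1, c₁ * n.2.1 + b₁ n.1,
      c₂ * n.2.2 + b₂ (c₀ * n.1) (c₁ * n.2.1 + b₁ n.1)) := by
    refine hg.comp ?_
    have e1 : Measurable fun n : ℂ × ℂ × ℂ => (c₀ : ℂ) * n.1 := by fun_prop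
    have e2 : Measurable fun n : ℂ × ℂ × ℂ => (c₁ : ℂ) * n.2.1 + b₁ n.1 := by fun_prop
    exact e1.prodMk (e2.prodMk (Measurable.add (by fun_prop) (hb₂.comp (e1.prodMk e2))))
  rw [hit hg, hit hm, lintegral_affine h₀ 0]
  simp_rw [add_zero]
  rw [ENNReal.ofReal_mul (by positivity), mul_assoc]
  congr 1
  rw [← lintegral_const_mul' _ _ ENNReal.ofReal_ne_top]
  congr 1
  ext x
  rw [lintegral_affine h₁ (b₁ x), ENNReal.ofReal_mul (by positivity), mul_assoc]
  congr 1
  rw [← lintegral_const_mul' _ _ ENNReal.ofReal_ne_top]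
  congr 1
  ext y
  rw [lintegral_affine h₂ (b₂ (c₀ * x) (c₁ * y + b₁ x))]

lemma lintegral_upper_triangular {c : ℝ} (hc : c ≠ 0) (b₂ : ℂ)
    {b₁ : ℂ → ℂ} (hb₁ : Measurable b₁) {b₀ : ℂ → ℂ → ℂ} (hb₀ : Measurable fun p : ℂ × ℂ => b₀ p.1 p.2)
    {g : ℂ × ℂ × ℂ → ℝ≥0∞} (hg : Measurable g) :
    ∫⁻ p, g p = ENNReal.ofReal (c ^ 2) *
      ∫⁻ v : ℂ × ℂ × ℂ, g (v.1 + b₀ (v.2.1 + b₁ (c * v.2.2 + b₂)) (c * v.2.2 + b₂),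
        v.2.1 + b₁ (c * v.2.2 + b₂), c * v.2.2 + b₂) := by
  have hit : ∀ {g : ℂ × ℂ × ℂ → ℝ≥0∞}, Measurable g →
      ∫⁻ p, g p = ∫⁻ w, ∫⁻ y, ∫⁻ x, g (x, y, w) := by
    intro g hg
    rw [Measure.volume_eq_prod, lintegral_prod_symm _ hg.aemeasurable, Measure.volume_eq_prod,
      lintegral_prod_symm]
    exact (Measurable.lintegral_prod_right (f := fun (y : ℂ × ℂ) (x : ℂ) => g (x, y))
      (hg.comp measurable_swap)).aemeasurable
  have hm : Measurable fun v : ℂ × ℂ × ℂ =>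
      g (v.1 + b₀ (v.2.1 + b₁ (c * v.2.2 + b₂)) (c * v.2.2 + b₂),
        v.2.1 + b₁ (c * v.2.2 + b₂), c * v.2.2 + b₂) := by
    refine hg.comp ?_
    have e1 : Measurable fun v : ℂ × ℂ × ℂ => (c : ℂ) * v.2.2 + b₂ := by fun_prop
    have e2 : Measurable fun v : ℂ × ℂ × ℂ => v.2.1 + b₁ (c * v.2.2 + b₂) := by fun_prop
    exact (Measurable.add (by fun_prop) (hb₀.comp (e2.prodMk e1))).prodMk (e2.prodMk e1)
  rw [hit hg, hit hm, lintegral_affine hc b₂]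
  congr 2
  ext w
  rw [← lintegral_add_right_eq_self (fun y => ∫⁻ x, g (x, y, c * w + b₂)) (b₁ (c * w + b₂))]
  congr 1
  ext y
  rw [← lintegral_add_right_eq_self (fun x => g (x, y + b₁ (c * w + b₂), c * w + b₂))
    (b₀ (y + b₁ (c * w + b₂)) (c * w + b₂))]

/-- The first three coefficients, as a function of the values `v` at `z` of the function and of
its first two derivatives, and of the contributions `σ` of the other coefficients. -/
noncomputable def coeffOfJet (z : ℂ) (σ : Fin 3 → ℂ) (v : ℂ × ℂ × ℂ) : ℂ × ℂ × ℂ :=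
  let w := (v.2.2 - σ 2) / (Real.sqrt 2 : ℂ)
  let y := v.2.1 - Real.sqrt 2 * z * w - σ 1
  (v.1 - z * y - z ^ 2 / Real.sqrt 2 * w - σ 0, y, w)

/-- The values at `z` of the function and of its first two derivatives, as a function of the
normalised covariant derivatives `n`. -/
noncomputable def jetOfNorm (z : ℂ) (n : ℂ × ℂ × ℂ) : ℂ × ℂ × ℂ :=
  let ρ : ℝ := Real.exp (‖z‖ ^ 2 / 2)
  let v₀ := (ρ : ℂ) * n.1
  let v₁ := (ρ : ℂ) * n.2.1 + conj z * v₀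
  (v₀, v₁, ((Real.sqrt 2 * ρ : ℝ) : ℂ) * n.2.2 + (2 * conj z * v₁ - conj z ^ 2 * v₀))

lemma sqrt_two_ne_zero' : (Real.sqrt 2 : ℂ) ≠ 0 := by
  exact_mod_cast (Real.sqrt_pos.2 (by norm_num : (0 : ℝ) < 2)).ne'

lemma sqrt_two_mul_self' : (Real.sqrt 2 : ℂ) * Real.sqrt 2 = 2 := by
  exact_mod_cast Real.mul_self_sqrt (by norm_num : (0 : ℝ) ≤ 2)

@[fun_prop]
lemma continuous_jetOfNorm (z : ℂ) : Continuous (jetOfNorm z) := by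
  unfold jetOfNorm; fun_prop

@[fun_prop]
lemma continuous_coeffOfJet (z : ℂ) (σ : Fin 3 → ℂ) : Continuous (coeffOfJet z σ) := by
  unfold coeffOfJet; fun_prop

lemma basisFun_two (z : ℂ) : basisFun 0 2 z = z ^ 2 / Real.sqrt 2 ∧
    basisFun 1 2 z = Real.sqrt 2 * z ∧ basisFun 2 2 z = Real.sqrt 2 := by
  have h := sqrt_two_ne_zero'
  have h2 := sqrt_two_mul_self'
  refine ⟨by simp [basisFun], ?_, ?_⟩
  · simp [basisFun]
    field_simp
    linear_combination (-z) * h2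
  · simp [basisFun]
    field_simp
    linear_combination -h2

lemma normCoeff_coeffOfJet (z : ℂ) (σ : Fin 3 → ℂ) (n : ℂ × ℂ × ℂ) :
    (normCoeff z fun j => (coeffOfJet z σ (jetOfNorm z n)).1 * basisFun j 0 z +
      (coeffOfJet z σ (jetOfNorm z n)).2.1 * basisFun j 1 z +
      (coeffOfJet z σ (jetOfNorm z n)).2.2 * basisFun j 2 z + σ j) = n := by
  obtain ⟨h0, h1, h2⟩ := basisFun_two z
  have hs := sqrt_two_ne_zero'
  have he : (Real.exp (-‖z‖ ^ 2 / 2) : ℂ) * (Real.exp (‖z‖ ^ 2 / 2) : ℂ) = 1 := by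
    rw [← Complex.ofReal_mul, ← Real.exp_add]
    simp [neg_div]
  set v := jetOfNorm z n with hv
  have a0 : ∀ j : Fin 3, (coeffOfJet z σ v).1 * basisFun j 0 z +
      (coeffOfJet z σ v).2.1 * basisFun j 1 z +
      (coeffOfJet z σ v).2.2 * basisFun j 2 z + σ j = ![v.1, v.2.1, v.2.2] j := by
    intro j
    fin_cases j
    · simp only [Fin.zero_eta, h0, coeffOfJet]
      simp [basisFun]
      ring
    · simp only [Fin.mk_one, h1, coeffOfJet]
      simp [basisFun]
      ring
    · simp only [Fin.reduceFinMk, h2, coeffOfJet]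
      simp [basisFun]
  simp_rw [a0]
  simp only [normCoeff, hv, jetOfNorm, Matrix.cons_val]
  ext1
  · simp only
    linear_combination n.1 * he
  ext1
  · simp only
    linear_combination n.2.1 * he
  · simp only
    simp only [Complex.ofReal_mul]
    generalize (Real.exp (-‖z‖ ^ 2 / 2) : ℂ) = A at he ⊢
    generalize (Real.exp (‖z‖ ^ 2 / 2) : ℂ) = B at he ⊢
    field_simp
    linear_combination (Real.sqrt 2 : ℂ) * n.2.2 * he

/-- The contribution of the coefficients of index at least three. -/
noncomputable def tailJet (z : ℂ) (a : ℕ → ℂ) (j : Fin 3) : ℂ :=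
  derivSeries j (seqCons 0 (seqCons 0 (seqCons 0 a))) z

lemma measurable_tailJet (z : ℂ) (j : Fin 3) : Measurable fun a => tailJet z a j := by
  refine (measurable_derivSeries j).comp (Measurable.prodMk ?_ measurable_const)
  exact measurable_seqCons.comp (measurable_const.prodMk
    (measurable_seqCons.comp (measurable_const.prodMk
      (measurable_seqCons.comp (measurable_const.prodMk measurable_id)))))

lemma measurable_coeffOfJet_tailJet (z : ℂ) :
    Measurable fun q : (ℕ → ℂ) × (ℂ × ℂ × ℂ) => coeffOfJet z (tailJet z q.1) (jetOfNorm z q.2) := by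
  have h0 : Measurable fun q : (ℕ → ℂ) × (ℂ × ℂ × ℂ) => tailJet z q.1 0 :=
    (measurable_tailJet z 0).comp measurable_fst
  have h1 : Measurable fun q : (ℕ → ℂ) × (ℂ × ℂ × ℂ) => tailJet z q.1 1 :=
    (measurable_tailJet z 1).comp measurable_fst
  have h2 : Measurable fun q : (ℕ → ℂ) × (ℂ × ℂ × ℂ) => tailJet z q.1 2 :=
    (measurable_tailJet z 2).comp measurable_fst
  have h3 : Measurable fun q : (ℕ → ℂ) × (ℂ × ℂ × ℂ) => jetOfNorm z q.2 :=
    (continuous_jetOfNorm z).measurable.comp measurable_snd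
  have h4 := h3.fst
  have h5 := h3.snd.fst
  have h6 := h3.snd.snd
  have hw := (h6.sub h2).div_const (Real.sqrt 2 : ℂ)
  have hy := (h5.sub (hw.const_mul (Real.sqrt 2 * z))).sub h1
  exact (((h4.sub (hy.const_mul z)).sub (hw.const_mul (z ^ 2 / Real.sqrt 2))).sub h0).prodMk
    (hy.prodMk hw)

/-- Two triangular changes of variables are composed. With ρ = exp(‖z‖²/2) their Jacobians are 1/2
and 2ρ⁶, so the total is ρ⁶ whatever the tail `σ`. -/
lemma lintegral_coeffOfJet (z : ℂ) (σ : Fin 3 → ℂ) {g : ℂ × ℂ × ℂ → ℝ≥0∞} (hg : Measurable g) :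
    ∫⁻ p, g p = ENNReal.ofReal (Real.exp (3 * ‖z‖ ^ 2)) *
      ∫⁻ n, g (coeffOfJet z σ (jetOfNorm z n)) := by
  have hs : Real.sqrt 2 ≠ 0 := (Real.sqrt_pos.2 (by norm_num : (0 : ℝ) < 2)).ne'
  have hρ : Real.exp (‖z‖ ^ 2 / 2) ≠ 0 := (Real.exp_pos _).ne'
  have h1 := lintegral_upper_triangular (c := (Real.sqrt 2)⁻¹) (inv_ne_zero hs)
    (-(σ 2 / (Real.sqrt 2 : ℂ))) (b₁ := fun w => -(Real.sqrt 2 * z * w) - σ 1) (by fun_prop)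
    (b₀ := fun y w => -(z * y) - z ^ 2 / Real.sqrt 2 * w - σ 0) (by fun_prop) hg
  have h2 := lintegral_lower_triangular hρ hρ (mul_ne_zero hs hρ)
    (b₁ := fun n₀ => conj z * ((Real.exp (‖z‖ ^ 2 / 2) : ℝ) * n₀)) (by fun_prop)
    (b₂ := fun v₀ v₁ => 2 * conj z * v₁ - conj z ^ 2 * v₀) (by fun_prop)
    (g := fun v => g (coeffOfJet z σ v)) (hg.comp (continuous_coeffOfJet z σ).measurable)
  have e1 : ∀ v : ℂ × ℂ × ℂ, coeffOfJet z σ v =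
      (v.1 + (-(z * (v.2.1 + (-(Real.sqrt 2 * z * (((Real.sqrt 2)⁻¹ : ℝ) * v.2.2 +
        -(σ 2 / (Real.sqrt 2 : ℂ)))) - σ 1))) - z ^ 2 / Real.sqrt 2 *
        (((Real.sqrt 2)⁻¹ : ℝ) * v.2.2 + -(σ 2 / (Real.sqrt 2 : ℂ))) - σ 0),
        v.2.1 + (-(Real.sqrt 2 * z * (((Real.sqrt 2)⁻¹ : ℝ) * v.2.2 +
        -(σ 2 / (Real.sqrt 2 : ℂ)))) - σ 1),
        ((Real.sqrt 2)⁻¹ : ℝ) * v.2.2 + -(σ 2 / (Real.sqrt 2 : ℂ))) := by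
    intro v
    simp only [coeffOfJet]
    push_cast
    ext1
    · simp only; ring
    ext1 <;> · simp only; ring
  rw [h1]
  simp_rw [← e1]
  rw [h2, ← mul_assoc, ← ENNReal.ofReal_mul (by positivity)]
  congr 2
  have h3 : Real.exp (3 * ‖z‖ ^ 2) = (Real.exp (‖z‖ ^ 2 / 2)) ^ 6 := by
    rw [← Real.exp_nat_mul]; congr 1; push_cast; ring
  rw [h3]
  field_simp

lemma lintegral_prod_stdComplexGaussian {f : ℂ × ℂ × ℂ → ℝ≥0∞} (hf : Measurable f) :
    ∫⁻ p, f p ∂(stdComplexGaussian.prod (stdComplexGaussian.prod stdComplexGaussian)) =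
      ∫⁻ p, ENNReal.ofReal (gaussDens₃ p) * f p := by
  rw [prod_stdComplexGaussian_eq_withDensity,
    lintegral_withDensity_eq_lintegral_mul _ (by fun_prop) hf]
  rfl

lemma measurable_seqCons₃ : Measurable fun q : (ℂ × ℂ × ℂ) × (ℕ → ℂ) =>
    seqCons q.1.1 (seqCons q.1.2.1 (seqCons q.1.2.2 q.2)) :=
  measurable_seqCons.comp (Measurable.prodMk (by fun_prop)
    (measurable_seqCons.comp (Measurable.prodMk (by fun_prop)
      (measurable_seqCons.comp (Measurable.prodMk (by fun_prop) measurable_snd)))))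

lemma lintegral_gaussianSeq₃ {f : (ℕ → ℂ) → ℝ≥0∞} (hf : Measurable f) :
    ∫⁻ a, f a ∂gaussianSeq = ∫⁻ a, ∫⁻ p : ℂ × ℂ × ℂ,
      f (seqCons p.1 (seqCons p.2.1 (seqCons p.2.2 a)))
        ∂(stdComplexGaussian.prod (stdComplexGaussian.prod stdComplexGaussian)) ∂gaussianSeq := by
  have h1 : Measurable fun a => ∫⁻ x, f (seqCons x a) ∂stdComplexGaussian :=
    Measurable.lintegral_prod_right (f := fun (a : ℕ → ℂ) (x : ℂ) => f (seqCons x a))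
      (hf.comp (measurable_seqCons.comp measurable_swap))
  have h2 : Measurable fun a => ∫⁻ y, ∫⁻ x, f (seqCons x (seqCons y a)) ∂stdComplexGaussian
      ∂stdComplexGaussian :=
    Measurable.lintegral_prod_right (f := fun (a : ℕ → ℂ) (y : ℂ) =>
      ∫⁻ x, f (seqCons x (seqCons y a)) ∂stdComplexGaussian)
      (h1.comp (measurable_seqCons.comp measurable_swap))
  rw [lintegral_gaussianSeq hf, lintegral_gaussianSeq h1, lintegral_gaussianSeq h2]
  congr 1
  ext a
  have h3 : Measurable fun p : ℂ × ℂ × ℂ => f (seqCons p.1 (seqCons p.2.1 (seqCons p.2.2 a))) :=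
    hf.comp (measurable_seqCons₃.comp (measurable_id.prodMk measurable_const))
  rw [lintegral_prod_symm _ h3.aemeasurable, lintegral_prod_symm]
  exact (Measurable.lintegral_prod_right (f := fun (q : ℂ × ℂ) (x : ℂ) =>
    f (seqCons x (seqCons q.1 (seqCons q.2 a)))) (h3.comp measurable_swap)).aemeasurable

lemma normCoeff_derivSeries_coeffOfJet (z : ℂ) {a : ℕ → ℂ} (ha : a ∈ goodSeq) (n : ℂ × ℂ × ℂ) :
    (normCoeff z fun j => derivSeries j
      (seqCons (coeffOfJet z (tailJet z a) (jetOfNorm z n)).1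
        (seqCons (coeffOfJet z (tailJet z a) (jetOfNorm z n)).2.1
          (seqCons (coeffOfJet z (tailJet z a) (jetOfNorm z n)).2.2 a))) z) = n := by
  conv_rhs => rw [← normCoeff_coeffOfJet z (tailJet z a) n]
  congr 1
  funext j
  rw [derivSeries_seqCons_seqCons _ _ _ (seqCons_mem_goodSeq _ ha),
    derivSeries_tail_seqCons _ _ ha, tailJet]
  ring

/-- The joint density of the coefficients and of the tail, in terms of the normalised jet. -/
noncomputable def jetDensity (z : ℂ) (n : ℂ × ℂ × ℂ) (a : ℕ → ℂ) : ℝ :=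
  gaussDens₃ (coeffOfJet z (tailJet z a) (jetOfNorm z n))

lemma jetDensity_nonneg (z : ℂ) (n : ℂ × ℂ × ℂ) (a : ℕ → ℂ) : 0 ≤ jetDensity z n a :=
  gaussDens₃_nonneg _

lemma jetDensity_le (z : ℂ) (n : ℂ × ℂ × ℂ) (a : ℕ → ℂ) : jetDensity z n a ≤ 1 :=
  gaussDens₃_le _

lemma measurable_jetDensity (z : ℂ) :
    Measurable fun q : (ℕ → ℂ) × (ℂ × ℂ × ℂ) => jetDensity z q.2 q.1 :=
  continuous_gaussDens₃.measurable.comp (measurable_coeffOfJet_tailJet z)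

lemma continuous_jetDensity (z : ℂ) (a : ℕ → ℂ) : Continuous fun n => jetDensity z n a :=
  continuous_gaussDens₃.comp ((continuous_coeffOfJet z _).comp (continuous_jetOfNorm z))

attribute [irreducible] jetDensity

lemma measurable_jetDensity_right (z : ℂ) (n : ℂ × ℂ × ℂ) :
    Measurable fun a => jetDensity z n a := by
  have h : Measurable fun a : ℕ → ℂ => (a, n) := measurable_id.prodMk measurable_const
  exact (measurable_jetDensity z).comp h

/-- Given the coefficients of index at least three, the normalised jet is an invertible affine
function of the first three; the change of variables produces its conditional density. -/
lemma lintegral_seqCons₃_normCoeff (z : ℂ) {a : ℕ → ℂ} (ha : a ∈ goodSeq)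
    {f : ℂ × ℂ × ℂ → ℝ≥0∞} (hf : Measurable f) :
    ∫⁻ p : ℂ × ℂ × ℂ, f (normCoeff z fun j =>
      derivSeries j (seqCons p.1 (seqCons p.2.1 (seqCons p.2.2 a))) z)
        ∂(stdComplexGaussian.prod (stdComplexGaussian.prod stdComplexGaussian)) =
      ENNReal.ofReal (Real.exp (3 * ‖z‖ ^ 2)) *
        ∫⁻ n, ENNReal.ofReal (jetDensity z n a) * f n := by
  have hm : Measurable fun p : ℂ × ℂ × ℂ => f (normCoeff z fun j =>
      derivSeries j (seqCons p.1 (seqCons p.2.1 (seqCons p.2.2 a))) z) :=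
    hf.comp ((measurable_normCoeff_derivSeries z).comp
      (measurable_seqCons₃.comp (measurable_id.prodMk measurable_const)))
  rw [lintegral_prod_stdComplexGaussian hm, lintegral_coeffOfJet z (tailJet z a)
    (g := fun p => ENNReal.ofReal (gaussDens₃ p) * f (normCoeff z fun j =>
      derivSeries j (seqCons p.1 (seqCons p.2.1 (seqCons p.2.2 a))) z))
    (Measurable.mul (by fun_prop) hm)]
  simp only [normCoeff_derivSeries_coeffOfJet z ha, jetDensity]

/-- Both sides compute the mean of `f` at the normalised jet: one from its joint law, the other by
conditioning on the coefficients of index at least three. Varying `f` identifies the averaged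
`jetDensity` almost everywhere. -/
lemma lintegral_normCoeff {z : ℂ} (hz : z ≠ 0) {f : ℂ × ℂ × ℂ → ℝ≥0∞} (hf : Measurable f) :
    ∫⁻ n, ENNReal.ofReal (gaussDens₃ n) * f n =
      ∫⁻ n, (ENNReal.ofReal (Real.exp (3 * ‖z‖ ^ 2)) *
        ∫⁻ a, ENNReal.ofReal (jetDensity z n a) ∂gaussianSeq) * f n := by
  have hκ := (measurable_jetDensity z).ennreal_ofReal
  have hmul : Measurable (Function.uncurry fun (a : ℕ → ℂ) (n : ℂ × ℂ × ℂ) =>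
      ENNReal.ofReal (jetDensity z n a) * f n) :=
    Measurable.mul (f := fun q : (ℕ → ℂ) × (ℂ × ℂ × ℂ) => ENNReal.ofReal (jetDensity z q.2 q.1))
      hκ (hf.comp measurable_snd)
  have hc := measurable_normCoeff_derivSeries z
  have step : ∀ᵐ a ∂gaussianSeq, ∫⁻ p : ℂ × ℂ × ℂ, f (normCoeff z fun j =>
      derivSeries j (seqCons p.1 (seqCons p.2.1 (seqCons p.2.2 a))) z)
        ∂(stdComplexGaussian.prod (stdComplexGaussian.prod stdComplexGaussian)) =
      ENNReal.ofReal (Real.exp (3 * ‖z‖ ^ 2)) *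
        ∫⁻ n, ENNReal.ofReal (jetDensity z n a) * f n := by
    filter_upwards [ae_mem_goodSeq] with a ha using lintegral_seqCons₃_normCoeff z ha hf
  rw [← lintegral_prod_stdComplexGaussian hf, ← map_normCoeff_gaussianSeq hz, lintegral_map hf hc,
    lintegral_gaussianSeq₃ (f := fun a => f (normCoeff z fun j => derivSeries j a z)) (hf.comp hc),
    lintegral_congr_ae step, lintegral_const_mul' _ _ ENNReal.ofReal_ne_top,
    lintegral_lintegral_swap hmul.aemeasurable,
    ← lintegral_const_mul' _ _ ENNReal.ofReal_ne_top]
  refine lintegral_congr fun n => ?_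
  rw [mul_assoc]
  exact congrArg _ (lintegral_mul_const _ (measurable_jetDensity_right z n).ennreal_ofReal)

/-- The density of the normalised jet at a point, at every value. -/
lemma lintegral_jetDensity {z : ℂ} (hz : z ≠ 0) (n : ℂ × ℂ × ℂ) :
    ∫⁻ a, ENNReal.ofReal (jetDensity z n a) ∂gaussianSeq =
      ENNReal.ofReal (Real.exp (-(3 * ‖z‖ ^ 2)) * gaussDens₃ n) := by
  have hκa : ∀ n, Measurable (jetDensity z n) := measurable_jetDensity_right z
  have hint : ∀ n, Integrable (jetDensity z n) gaussianSeq := fun n =>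
    Integrable.of_bound (hκa n).aestronglyMeasurable 1 (Eventually.of_forall fun a => by
      rw [Real.norm_of_nonneg (jetDensity_nonneg _ _ _)]; exact jetDensity_le _ _ _)
  obtain ⟨I, hI'⟩ : ∃ I : ℂ × ℂ × ℂ → ℝ, ∀ n, I n = ∫ a, jetDensity z n a ∂gaussianSeq :=
    ⟨_, fun _ => rfl⟩
  have hI0 : ∀ n, 0 ≤ I n := fun n => by
    rw [hI']; exact integral_nonneg fun a => jetDensity_nonneg _ _ _
  have hI : ∀ n, ∫⁻ a, ENNReal.ofReal (jetDensity z n a) ∂gaussianSeq = ENNReal.ofReal (I n) :=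
    fun n => by
      rw [hI', ofReal_integral_eq_lintegral_ofReal (hint n)
        (Eventually.of_forall fun a => jetDensity_nonneg _ _ _)]
  -- Continuity upgrades the almost everywhere identity to a pointwise one. It will be used on the
  -- null set where the first covariant derivative vanishes.
  have hIc : Continuous I := by
    rw [funext hI']
    refine continuous_of_dominated (bound := fun _ => 1) (fun n => (hκa n).aestronglyMeasurable)
      (fun n => Eventually.of_forall fun a => ?_) (integrable_const 1)
      (Eventually.of_forall fun a => continuous_jetDensity z a)
    rw [Real.norm_of_nonneg (jetDensity_nonneg _ _ _)]; exact jetDensity_le _ _ _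
  have hJ := fun f hf => lintegral_normCoeff hz (f := f) hf
  simp_rw [hI, ← ENNReal.ofReal_mul (Real.exp_pos (3 * ‖z‖ ^ 2)).le] at hJ
  have hm : Measurable fun n => ENNReal.ofReal (Real.exp (3 * ‖z‖ ^ 2) * I n) :=
    (hIc.measurable.const_mul _).ennreal_ofReal
  have hae : (fun n => ENNReal.ofReal (gaussDens₃ n)) =ᵐ[volume] fun n =>
      ENNReal.ofReal (Real.exp (3 * ‖z‖ ^ 2) * I n) := by
    refine ae_eq_of_forall_setLIntegral_eq_of_sigmaFinite
      continuous_gaussDens₃.measurable.ennreal_ofReal hm fun s hs _ => ?_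
    have := hJ (s.indicator 1) (measurable_one.indicator hs)
    have e : ∀ (F : ℂ × ℂ × ℂ → ℝ≥0∞) n, F n * s.indicator 1 n = s.indicator F n := by
      intro F n
      by_cases hn : n ∈ s <;> simp [hn]
    rw [← lintegral_indicator hs, ← lintegral_indicator hs]
    simpa only [e fun n => ENNReal.ofReal (gaussDens₃ n),
      e fun n => ENNReal.ofReal (Real.exp (3 * ‖z‖ ^ 2) * I n)] using this
  have hae' : (fun n => gaussDens₃ n) =ᵐ[volume] fun n => Real.exp (3 * ‖z‖ ^ 2) * I n := by
    filter_upwards [hae] with n hn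
    exact (ENNReal.ofReal_eq_ofReal_iff (gaussDens₃_nonneg _)
      (mul_nonneg (Real.exp_pos _).le (hI0 n))).1 hn
  have heq := congrFun ((Continuous.ae_eq_iff_eq volume continuous_gaussDens₃
    (continuous_const.mul hIc)).1 hae') n
  rw [hI, show gaussDens₃ n = Real.exp (3 * ‖z‖ ^ 2) * I n from heq, ← mul_assoc, ← Real.exp_add,
    neg_add_cancel, Real.exp_zero, one_mul]

end PointDensity
end GaussianEntire

namespace GaussianEntire
-- The intensity of critical points at a fixed point and value.
section Intensity
open Set Filter Topology

lemma iterate_deriv_tailFun_seqCons (j : Fin 3) (w : ℂ) {a : ℕ → ℂ} (ha : a ∈ goodSeq) (z : ℂ) :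
    deriv^[j] (tailFun (seqCons w a)) z = w * basisFun j 2 z + tailJet z a j := by
  have h := congrFun (iterate_deriv_tailFun j) (seqCons w a, z)
  rw [indicator_of_mem (by simpa using seqCons_mem_goodSeq w ha)] at h
  rw [tailJet, ← derivSeries_tail_seqCons j w ha]
  exact h

/-- The coefficient a₂ = `w` is chosen to give the second covariant derivative the value √2
exp(‖z‖²/2) s. The three Gaussian factors then form the jet density, and the middle entry `0` of the
jet is the critical point equation. -/
lemma gaussDens_mul_critMap (z u s : ℂ) {a : ℕ → ℂ} (ha : a ∈ goodSeq) :
    let w : ℂ := (Real.exp (‖z‖ ^ 2 / 2) : ℝ) * s + (conj z ^ 2 * u - tailJet z a 2) / Real.sqrt 2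
    deriv (deriv (tailFun (seqCons w a))) z - conj z ^ 2 * u =
        (Real.sqrt 2 * Real.exp (‖z‖ ^ 2 / 2) : ℝ) * s ∧
      gaussDens w * (gaussDens (critMap (tailFun (seqCons w a)) (z, u)).1 *
        gaussDens (critMap (tailFun (seqCons w a)) (z, u)).2) =
        jetDensity z ((Real.exp (-‖z‖ ^ 2 / 2) : ℝ) * u, 0, s) a := by
  intro w
  obtain ⟨h0, h1, h2⟩ := basisFun_two z
  have e0 : tailFun (seqCons w a) z = w * (z ^ 2 / Real.sqrt 2) + tailJet z a 0 := by
    rw [← h0]; exact iterate_deriv_tailFun_seqCons 0 w ha z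
  have e1 : deriv (tailFun (seqCons w a)) z = w * (Real.sqrt 2 * z) + tailJet z a 1 := by
    rw [← h1]; exact iterate_deriv_tailFun_seqCons 1 w ha z
  have e2 : deriv (deriv (tailFun (seqCons w a))) z = w * Real.sqrt 2 + tailJet z a 2 := by
    conv_rhs => rw [← h2]
    exact iterate_deriv_tailFun_seqCons 2 w ha z
  have hs := sqrt_two_ne_zero'
  have he : (Real.exp (‖z‖ ^ 2 / 2) : ℂ) * ((Real.exp (-‖z‖ ^ 2 / 2) : ℂ) * u) = u := by
    rw [← mul_assoc, ← Complex.ofReal_mul, ← Real.exp_add]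
    simp [neg_div]
  constructor
  · rw [e2]
    simp only [w]
    rw [Complex.ofReal_mul]
    field_simp
    ring
  · have hv : jetOfNorm z ((Real.exp (-‖z‖ ^ 2 / 2) : ℝ) * u, 0, s) =
        (u, conj z * u, ((Real.sqrt 2 * Real.exp (‖z‖ ^ 2 / 2) : ℝ) : ℂ) * s + conj z ^ 2 * u) := by
      simp only [jetOfNorm]
      rw [he]
      ext1
      · rfl
      ext1 <;> · simp only; ring
    have hw : (((Real.sqrt 2 * Real.exp (‖z‖ ^ 2 / 2) : ℝ) : ℂ) * s + conj z ^ 2 * u -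
        tailJet z a 2) / Real.sqrt 2 = w := by
      simp only [w]
      rw [Complex.ofReal_mul]
      field_simp
      ring
    have hc : coeffOfJet z (tailJet z a)
        (jetOfNorm z ((Real.exp (-‖z‖ ^ 2 / 2) : ℝ) * u, 0, s)) =
        ((critMap (tailFun (seqCons w a)) (z, u)).1, (critMap (tailFun (seqCons w a)) (z, u)).2,
          w) := by
      rw [hv]
      simp only [coeffOfJet, hw, critMap, e0, e1]
      ext1
      · simp only; ring
      ext1
      · simp only; ring
      · rfl
    rw [jetDensity, hc, gaussDens₃]
    ring

lemma measurable_critMap_tailFun :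
    Measurable fun q : (ℕ → ℂ) × (ℂ × ℂ) => critMap (tailFun q.1) q.2 := by
  have hp : Measurable fun q : (ℕ → ℂ) × (ℂ × ℂ) => (q.1, q.2.1) :=
    measurable_fst.prodMk measurable_snd.fst
  have h0 : Measurable fun q : (ℕ → ℂ) × (ℂ × ℂ) => tailFun q.1 q.2.1 :=
    (measurable_tailFun.comp hp :)
  have h1 : Measurable fun q : (ℕ → ℂ) × (ℂ × ℂ) => deriv (tailFun q.1) q.2.1 :=
    (measurable_deriv_tailFun.comp hp :)
  have hz : Measurable fun q : (ℕ → ℂ) × (ℂ × ℂ) => q.2.1 := measurable_snd.fst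
  have hu : Measurable fun q : (ℕ → ℂ) × (ℂ × ℂ) => q.2.2 := measurable_snd.snd
  have hc : Measurable fun q : (ℕ → ℂ) × (ℂ × ℂ) => conj q.2.1 :=
    (Complex.continuous_conj.measurable.comp hz :)
  have h2 := (hc.mul hu).sub h1
  exact ((hu.sub (hz.mul h2)).sub h0).prodMk h2

/-- The second covariant derivative at a critical point `z` with value `u`. -/
noncomputable def secondCov (R : ℂ → ℂ) (p : ℂ × ℂ) : ℂ :=
  deriv (deriv R) p.1 - conj p.1 ^ 2 * p.2

lemma measurable_secondCov_tailFun :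
    Measurable fun q : (ℕ → ℂ) × (ℂ × ℂ) => secondCov (tailFun q.1) q.2 := by
  have hp : Measurable fun q : (ℕ → ℂ) × (ℂ × ℂ) => (q.1, q.2.1) :=
    measurable_fst.prodMk measurable_snd.fst
  have h2 : Measurable fun q : (ℕ → ℂ) × (ℂ × ℂ) => deriv (deriv (tailFun q.1)) q.2.1 :=
    (measurable_deriv_deriv_tailFun.comp hp :)
  have hc : Measurable fun q : (ℕ → ℂ) × (ℂ × ℂ) => conj q.2.1 :=
    (Complex.continuous_conj.measurable.comp measurable_snd.fst :)
  exact (h2.sub ((hc.pow_const 2).mul measurable_snd.snd) :)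

lemma measurable_gaussDens_critMap : Measurable fun q : (ℕ → ℂ) × (ℂ × ℂ) =>
    ENNReal.ofReal (gaussDens (critMap (tailFun q.1) q.2).1 *
      gaussDens (critMap (tailFun q.1) q.2).2) :=
  (((continuous_gaussDens.measurable.comp measurable_critMap_tailFun.fst).mul
    (continuous_gaussDens.measurable.comp measurable_critMap_tailFun.snd)).ennreal_ofReal :)

lemma gaussDens_zero : gaussDens 0 = Real.pi⁻¹ := by simp [gaussDens]

/-- The conditional intensity at a critical point `z` with value `u`, integrated against a
function of the second covariant derivative. -/
lemma lintegral_secondCov {z : ℂ} (hz : z ≠ 0) (u : ℂ) {G : ℂ → ℝ≥0∞} (hG : Measurable G) :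
    ∫⁻ a, ENNReal.ofReal (gaussDens (critMap (tailFun a) (z, u)).1 *
        gaussDens (critMap (tailFun a) (z, u)).2) * G (secondCov (tailFun a) (z, u)) ∂gaussianSeq =
      ENNReal.ofReal (Real.exp (-(2 * ‖z‖ ^ 2)) * Real.pi⁻¹ *
        gaussDens ((Real.exp (-‖z‖ ^ 2 / 2) : ℝ) * u)) *
        ∫⁻ s, G ((Real.sqrt 2 * Real.exp (‖z‖ ^ 2 / 2) : ℝ) * s) ∂stdComplexGaussian := by
  have hsec : Measurable fun a : ℕ → ℂ => (a, (z, u)) := measurable_id.prodMk measurable_const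
  have hm : Measurable fun a => ENNReal.ofReal (gaussDens (critMap (tailFun a) (z, u)).1 *
        gaussDens (critMap (tailFun a) (z, u)).2) * G (secondCov (tailFun a) (z, u)) :=
    ((measurable_gaussDens_critMap.comp hsec).mul
      (hG.comp (measurable_secondCov_tailFun.comp hsec)) :)
  set c : ℝ := Real.sqrt 2 * Real.exp (‖z‖ ^ 2 / 2) with hc
  set n : ℂ → ℂ × ℂ × ℂ := fun s => ((Real.exp (-‖z‖ ^ 2 / 2) : ℝ) * u, 0, s) with hn
  have hGc : Measurable fun s : ℂ => G (c * s) := hG.comp (by fun_prop)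
  -- Only a₂ is integrated here. Its Jacobian exp(‖z‖²) meets the exp(−3‖z‖²) of
  -- `lintegral_jetDensity`, which leaves exp(−2‖z‖²).
  have step : ∀ᵐ a ∂gaussianSeq, ∫⁻ w, ENNReal.ofReal
      (gaussDens (critMap (tailFun (seqCons w a)) (z, u)).1 *
        gaussDens (critMap (tailFun (seqCons w a)) (z, u)).2) *
          G (secondCov (tailFun (seqCons w a)) (z, u)) ∂stdComplexGaussian =
      ENNReal.ofReal (Real.exp (‖z‖ ^ 2)) *
        ∫⁻ s, ENNReal.ofReal (jetDensity z (n s) a) * G (c * s) := by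
    filter_upwards [ae_mem_goodSeq] with a ha
    have hcons : Measurable fun w : ℂ => seqCons w a :=
      measurable_seqCons.comp (measurable_id.prodMk measurable_const)
    rw [lintegral_stdComplexGaussian (f := fun w => ENNReal.ofReal
      (gaussDens (critMap (tailFun (seqCons w a)) (z, u)).1 *
        gaussDens (critMap (tailFun (seqCons w a)) (z, u)).2) *
          G (secondCov (tailFun (seqCons w a)) (z, u))) (hm.comp hcons),
      lintegral_affine (c := Real.exp (‖z‖ ^ 2 / 2)) (Real.exp_pos _).ne'
        ((conj z ^ 2 * u - tailJet z a 2) / Real.sqrt 2)]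
    have e : Real.exp (‖z‖ ^ 2 / 2) ^ 2 = Real.exp (‖z‖ ^ 2) := by
      rw [← Real.exp_nat_mul]; congr 1; push_cast; ring
    rw [e]
    congr 1
    refine lintegral_congr fun s => ?_
    obtain ⟨h1, h2⟩ := gaussDens_mul_critMap z u s ha
    rw [secondCov, h1, ← mul_assoc, ← ENNReal.ofReal_mul (by positivity)]
    congr 2
  have hnm : Measurable n := by fun_prop
  have hmul : Measurable (Function.uncurry fun (a : ℕ → ℂ) (s : ℂ) =>
      ENNReal.ofReal (jetDensity z (n s) a) * G (c * s)) := by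
    have h1 : Measurable fun q : (ℕ → ℂ) × ℂ => (q.1, n q.2) :=
      measurable_fst.prodMk (hnm.comp measurable_snd)
    exact (((measurable_jetDensity z).comp h1).ennreal_ofReal.mul (hGc.comp measurable_snd) :)
  rw [lintegral_gaussianSeq hm, lintegral_congr_ae step,
    lintegral_const_mul' _ _ ENNReal.ofReal_ne_top, lintegral_lintegral_swap hmul.aemeasurable,
    lintegral_stdComplexGaussian hGc, ← lintegral_const_mul' _ _ ENNReal.ofReal_ne_top,
    ← lintegral_const_mul' _ _ ENNReal.ofReal_ne_top]
  refine lintegral_congr fun s => ?_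
  rw [lintegral_mul_const _ (measurable_jetDensity_right z (n s)).ennreal_ofReal,
    lintegral_jetDensity hz, ← mul_assoc, ← mul_assoc, ← ENNReal.ofReal_mul (Real.exp_pos _).le,
    ← ENNReal.ofReal_mul (mul_nonneg (by positivity) (gaussDens_nonneg _))]
  congr 2
  simp only [gaussDens₃, hn, gaussDens_zero]
  have e : Real.exp (-(2 * ‖z‖ ^ 2)) = Real.exp (‖z‖ ^ 2) * Real.exp (-(3 * ‖z‖ ^ 2)) := by
    rw [← Real.exp_add]; congr 1; ring
  rw [e, ← gaussDens]
  ring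

/-- The contribution of a critical point `z` with value `u` to the sum over the points of
`K` of the type described by `S`. -/
noncomputable def pointWeight (K : Set ℂ) (S : Set (ℝ × ℝ)) (ψ : ℝ → ℝ≥0∞)
    (q : (ℕ → ℂ) × (ℂ × ℂ)) : ℝ≥0∞ :=
  K.indicator 1 q.2.1 * ψ (‖q.2.2‖ * Real.exp (-‖q.2.1‖ ^ 2 / 2)) *
    S.indicator 1 (‖q.2.2‖ ^ 2, ‖secondCov (tailFun q.1) q.2‖ ^ 2)

lemma measurable_pointWeight {K : Set ℂ} (hK : MeasurableSet K) {S : Set (ℝ × ℝ)}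
    (hS : MeasurableSet S) {ψ : ℝ → ℝ≥0∞} (hψ : Measurable ψ) : Measurable (pointWeight K S ψ) := by
  have hz : Measurable fun q : (ℕ → ℂ) × (ℂ × ℂ) => q.2.1 := measurable_snd.fst
  have hu : Measurable fun q : (ℕ → ℂ) × (ℂ × ℂ) => q.2.2 := measurable_snd.snd
  refine (((measurable_one.indicator hK).comp hz).mul (hψ.comp ?_)).mul
    ((measurable_one.indicator hS).comp ?_)
  · exact hu.norm.mul (((hz.norm.pow_const 2).neg.div_const 2).exp)
  · exact (hu.norm.pow_const 2).prodMk (measurable_secondCov_tailFun.norm.pow_const 2)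

/-- The nondegenerate critical points. -/
def nondegSet : Set ((ℕ → ℂ) × (ℂ × ℂ)) :=
  {q | (fderiv ℝ (critMap (tailFun q.1)) q.2).det ≠ 0}

/-- The sum over the nondegenerate critical points, as a function of the coefficients. -/
noncomputable def critSum (K : Set ℂ) (S : Set (ℝ × ℝ)) (ψ : ℝ → ℝ≥0∞) (a : ℕ → ℂ) : ℝ≥0∞ :=
  fiberSum (fun a => critMap (tailFun a)) nondegSet (pointWeight K S ψ)
    (fun k => a (k + 2), (a 0, a 1))

/-- The mean weight of a critical point, for a pair of independent Gaussian variables. -/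
noncomputable def heightIntegral (S : Set (ℝ × ℝ)) (ψ : ℝ → ℝ≥0∞) : ℝ≥0∞ :=
  ∫⁻ u, ψ ‖u‖ * ∫⁻ s, S.indicator 1 (‖u‖ ^ 2, 2 * ‖s‖ ^ 2) *
    ENNReal.ofReal |‖u‖ ^ 2 - 2 * ‖s‖ ^ 2| ∂stdComplexGaussian ∂stdComplexGaussian

end Intensity
end GaussianEntire

namespace GaussianEntire
-- The mean of a sum over the nondegenerate critical points.
section CriticalSum
open Set Filter Topology

lemma lintegral_prod_stdComplexGaussian₂ {f : ℂ × ℂ → ℝ≥0∞} (hf : Measurable f) :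
    ∫⁻ p, f p ∂(stdComplexGaussian.prod stdComplexGaussian) =
      ∫⁻ p, ENNReal.ofReal (gaussDens p.1 * gaussDens p.2) * f p := by
  have h : stdComplexGaussian = volume.withDensity fun z => ENNReal.ofReal (gaussDens z) := rfl
  have hm : Measurable fun z => ENNReal.ofReal (gaussDens z) := by fun_prop
  have h2 : stdComplexGaussian.prod stdComplexGaussian =
      (volume : Measure (ℂ × ℂ)).withDensity
        fun p => ENNReal.ofReal (gaussDens p.1 * gaussDens p.2) := by
    rw [h, prod_withDensity hm hm, Measure.volume_eq_prod ℂ ℂ]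
    congr 1
    ext p
    rw [ENNReal.ofReal_mul (gaussDens_nonneg _)]
  rw [h2, lintegral_withDensity_eq_lintegral_mul _ (by fun_prop) hf]
  rfl

lemma lintegral_gaussianSeq₂ {f : (ℕ → ℂ) → ℝ≥0∞} (hf : Measurable f) :
    ∫⁻ a, f a ∂gaussianSeq = ∫⁻ a, (∫⁻ p : ℂ × ℂ, ENNReal.ofReal (gaussDens p.1 * gaussDens p.2) *
      f (seqCons p.1 (seqCons p.2 a))) ∂gaussianSeq := by
  have h1 : Measurable fun a => ∫⁻ x, f (seqCons x a) ∂stdComplexGaussian :=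
    Measurable.lintegral_prod_right (f := fun (a : ℕ → ℂ) (x : ℂ) => f (seqCons x a))
      (hf.comp (measurable_seqCons.comp measurable_swap))
  rw [lintegral_gaussianSeq hf, lintegral_gaussianSeq h1]
  congr 1
  ext a
  have h2 : Measurable fun p : ℂ × ℂ => seqCons p.2 a :=
    (measurable_seqCons.comp (measurable_snd.prodMk measurable_const) :)
  have h3 : Measurable fun p : ℂ × ℂ => f (seqCons p.1 (seqCons p.2 a)) :=
    (hf.comp (measurable_seqCons.comp (measurable_fst.prodMk h2)) :)
  rw [← lintegral_prod_stdComplexGaussian₂ h3, lintegral_prod_symm _ h3.aemeasurable]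

lemma det_fderiv_critMap_tailFun (a : ℕ → ℂ) (p : ℂ × ℂ) :
    (fderiv ℝ (critMap (tailFun a)) p).det = ‖secondCov (tailFun a) p‖ ^ 2 - ‖p.2‖ ^ 2 :=
  det_fderiv_critMap (differentiable_tailFun a) p

lemma hasFDerivAt_critMap_tailFun (a : ℕ → ℂ) (p : ℂ × ℂ) :
    HasFDerivAt (critMap (tailFun a)) (fderiv ℝ (critMap (tailFun a)) p) p :=
  ((contDiff_critMap (differentiable_tailFun a)).differentiable (by simp) p).hasFDerivAt

lemma continuous_fderiv_critMap_tailFun (a : ℕ → ℂ) :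
    Continuous (fderiv ℝ (critMap (tailFun a))) :=
  (contDiff_critMap (differentiable_tailFun a)).continuous_fderiv (by simp)

lemma measurable_det_fderiv_critMap_tailFun : Measurable fun q : (ℕ → ℂ) × (ℂ × ℂ) =>
    (fderiv ℝ (critMap (tailFun q.1)) q.2).det := by
  simp_rw [det_fderiv_critMap_tailFun]
  exact (measurable_secondCov_tailFun.norm.pow_const 2).sub
    (measurable_snd.snd.norm.pow_const 2)

lemma measurable_fiberSum_critMap {g : (ℕ → ℂ) × (ℂ × ℂ) → ℝ≥0∞} (hg : Measurable g) :
    Measurable (fiberSum (fun a => critMap (tailFun a)) nondegSet g) ∧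
    ∀ a, ∫⁻ p : ℂ × ℂ, ENNReal.ofReal (gaussDens p.1 * gaussDens p.2) *
        fiberSum (fun a => critMap (tailFun a)) nondegSet g (a, p) =
      ∫⁻ p : ℂ × ℂ, ENNReal.ofReal (gaussDens (critMap (tailFun a) p).1 *
        gaussDens (critMap (tailFun a) p).2) * g (a, p) *
        ENNReal.ofReal |‖p.2‖ ^ 2 - ‖secondCov (tailFun a) p‖ ^ 2| := by
  have : (volume : Measure (ℂ × ℂ)).IsAddHaarMeasure :=
    inferInstanceAs (Measure.prod volume volume).IsAddHaarMeasure
  have h := measurable_fiberSum_and_lintegral (Φ := fun a : ℕ → ℂ => critMap (tailFun a))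
    measurable_critMap_tailFun hasFDerivAt_critMap_tailFun continuous_fderiv_critMap_tailFun
    measurable_det_fderiv_critMap_tailFun hg (volume : Measure (ℂ × ℂ))
    (p := fun p => ENNReal.ofReal (gaussDens p.1 * gaussDens p.2)) (by fun_prop)
  refine ⟨h.1, fun a => ?_⟩
  rw [show nondegSet = {q : (ℕ → ℂ) × (ℂ × ℂ) |
    (fderiv ℝ (critMap (tailFun q.1)) q.2).det ≠ 0} from rfl, h.2 a]
  refine lintegral_congr fun p => ?_
  rw [det_fderiv_critMap_tailFun, abs_sub_comm]

/-- The area formula is applied for a fixed tail. Tonelli's theorem then moves the average over the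
tail inside, so that z and u are frozen and the law of the jet at z becomes available. -/
lemma lintegral_critSum_eq {K : Set ℂ} (hK : MeasurableSet K) {S : Set (ℝ × ℝ)}
    (hS : MeasurableSet S) {ψ : ℝ → ℝ≥0∞} (hψ : Measurable ψ) :
    Measurable (critSum K S ψ) ∧ ∫⁻ a, critSum K S ψ a ∂gaussianSeq =
      ∫⁻ z, ∫⁻ u, ∫⁻ a, ENNReal.ofReal (gaussDens (critMap (tailFun a) (z, u)).1 *
        gaussDens (critMap (tailFun a) (z, u)).2) * (pointWeight K S ψ (a, (z, u)) *
        ENNReal.ofReal |‖u‖ ^ 2 - ‖secondCov (tailFun a) (z, u)‖ ^ 2|) ∂gaussianSeq := by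
  have hw := measurable_pointWeight hK hS hψ
  obtain ⟨h1, h2⟩ := measurable_fiberSum_critMap hw
  have hshift : Measurable fun a : ℕ → ℂ => ((fun k => a (k + 2), (a 0, a 1)) : (ℕ → ℂ) × (ℂ × ℂ)) :=
    (measurable_pi_lambda _ fun k => measurable_pi_apply (k + 2)).prodMk
      ((measurable_pi_apply 0).prodMk (measurable_pi_apply 1))
  have hm : Measurable (critSum K S ψ) := (h1.comp hshift :)
  refine ⟨hm, ?_⟩
  have e : ∀ x y a, critSum K S ψ (seqCons x (seqCons y a)) =
      fiberSum (fun a => critMap (tailFun a)) nondegSet (pointWeight K S ψ) (a, (x, y)) :=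
    fun x y a => rfl
  rw [lintegral_gaussianSeq₂ hm]
  simp_rw [e, h2]
  have hdet : Measurable fun q : (ℕ → ℂ) × (ℂ × ℂ) =>
      ENNReal.ofReal |‖q.2.2‖ ^ 2 - ‖secondCov (tailFun q.1) q.2‖ ^ 2| :=
    ((measurable_snd.snd.norm.pow_const 2).sub
      (measurable_secondCov_tailFun.norm.pow_const 2)).abs.ennreal_ofReal
  let F : (ℕ → ℂ) × (ℂ × ℂ) → ℝ≥0∞ := fun q => ENNReal.ofReal
    (gaussDens (critMap (tailFun q.1) q.2).1 * gaussDens (critMap (tailFun q.1) q.2).2) *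
    pointWeight K S ψ q * ENNReal.ofReal |‖q.2.2‖ ^ 2 - ‖secondCov (tailFun q.1) q.2‖ ^ 2|
  have hF : Measurable F := (measurable_gaussDens_critMap.mul hw).mul hdet
  have hF' : Measurable fun p : ℂ × ℂ => ∫⁻ a, F (a, p) ∂gaussianSeq :=
    Measurable.lintegral_prod_left hF
  change ∫⁻ a, (∫⁻ p, F (a, p)) ∂gaussianSeq = _
  rw [lintegral_lintegral_swap (f := fun a p => F (a, p)) hF.aemeasurable,
    Measure.volume_eq_prod, lintegral_prod _ hF'.aemeasurable]
  simp only [F, mul_assoc]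

/-- The mean of the sum over the critical points. -/
theorem lintegral_critSum {K : Set ℂ} (hK : MeasurableSet K) {S : Set (ℝ × ℝ)}
    (hS : MeasurableSet S) (hcone : ∀ c > 0, ∀ x y : ℝ, (c * x, c * y) ∈ S ↔ (x, y) ∈ S)
    {ψ : ℝ → ℝ≥0∞} (hψ : Measurable ψ) :
    ∫⁻ a, critSum K S ψ a ∂gaussianSeq = areaMeasure K * heightIntegral S ψ := by
  rw [(lintegral_critSum_eq hK hS hψ).2]
  have hz0 : ∀ᵐ z : ℂ, z ≠ 0 := by simp [ae_iff]
  have hH : Measurable fun q : ℂ × ℂ => S.indicator (1 : ℝ × ℝ → ℝ≥0∞)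
      (‖q.1‖ ^ 2, 2 * ‖q.2‖ ^ 2) * ENNReal.ofReal |‖q.1‖ ^ 2 - 2 * ‖q.2‖ ^ 2| := by
    refine Measurable.mul ?_ (by fun_prop)
    exact ((measurable_one.indicator hS).comp (g := S.indicator (1 : ℝ × ℝ → ℝ≥0∞))
      (f := fun q : ℂ × ℂ => (‖q.1‖ ^ 2, 2 * ‖q.2‖ ^ 2)) (by fun_prop) :)
  have hHi : Measurable fun u : ℂ => ∫⁻ s, S.indicator 1 (‖u‖ ^ 2, 2 * ‖s‖ ^ 2) *
      ENNReal.ofReal |‖u‖ ^ 2 - 2 * ‖s‖ ^ 2| ∂stdComplexGaussian :=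
    Measurable.lintegral_prod_right hH
  have hψu : Measurable fun u : ℂ => ψ ‖u‖ := hψ.comp measurable_norm
  have key : ∀ z : ℂ, z ≠ 0 → ∫⁻ u, ∫⁻ a, ENNReal.ofReal
        (gaussDens (critMap (tailFun a) (z, u)).1 * gaussDens (critMap (tailFun a) (z, u)).2) *
        (pointWeight K S ψ (a, (z, u)) *
        ENNReal.ofReal |‖u‖ ^ 2 - ‖secondCov (tailFun a) (z, u)‖ ^ 2|) ∂gaussianSeq =
      ENNReal.ofReal Real.pi⁻¹ * heightIntegral S ψ * K.indicator 1 z := by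
    intro z hz
    set r := ‖z‖ ^ 2 with hr
    set ρ := Real.exp (r / 2) with hρ
    have hρ0 : 0 < ρ := Real.exp_pos _
    have hρ2 : ρ ^ 2 = Real.exp r := by
      rw [hρ, ← Real.exp_nat_mul]; congr 1; push_cast; ring
    have hρi : Real.exp (-r / 2) * ρ = 1 := by
      rw [hρ, ← Real.exp_add]; simp [neg_div]
    have inner : ∀ u : ℂ, ∫⁻ a, ENNReal.ofReal
        (gaussDens (critMap (tailFun a) (z, u)).1 * gaussDens (critMap (tailFun a) (z, u)).2) *
        (pointWeight K S ψ (a, (z, u)) *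
        ENNReal.ofReal |‖u‖ ^ 2 - ‖secondCov (tailFun a) (z, u)‖ ^ 2|) ∂gaussianSeq =
        ENNReal.ofReal (Real.exp (-(2 * r)) * Real.pi⁻¹ *
          gaussDens ((Real.exp (-r / 2) : ℝ) * u)) *
        ∫⁻ s : ℂ, K.indicator 1 z * ψ (‖u‖ * Real.exp (-r / 2)) *
          (S.indicator 1 (‖u‖ ^ 2, ‖((Real.sqrt 2 * ρ : ℝ) : ℂ) * s‖ ^ 2) *
          ENNReal.ofReal |‖u‖ ^ 2 - ‖((Real.sqrt 2 * ρ : ℝ) : ℂ) * s‖ ^ 2|)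
            ∂stdComplexGaussian := by
      intro u
      rw [← lintegral_secondCov hz u (G := fun s => K.indicator 1 z *
        ψ (‖u‖ * Real.exp (-r / 2)) * (S.indicator 1 (‖u‖ ^ 2, ‖s‖ ^ 2) *
          ENNReal.ofReal |‖u‖ ^ 2 - ‖s‖ ^ 2|))]
      · refine lintegral_congr fun a => ?_
        simp only [pointWeight, mul_assoc, hr]
      · refine Measurable.const_mul (Measurable.mul ?_ (by fun_prop)) _
        exact ((measurable_one.indicator hS).comp (g := S.indicator (1 : ℝ × ℝ → ℝ≥0∞))
          (f := fun s : ℂ => (‖u‖ ^ 2, ‖s‖ ^ 2)) (by fun_prop) :)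
    simp_rw [inner]
    -- After rescaling by `ρ` the height is |u| itself. A factor exp(r) from this substitution and
    -- another from the Jacobian of `critMap` cancel exp(−2r), which is translation invariance;
    -- `hcone` removes the same scaling from the indicator.
    rw [lintegral_affine hρ0.ne' 0, hρ2]
    have hpt : ∀ u : ℂ, ENNReal.ofReal (Real.exp (-(2 * r)) * Real.pi⁻¹ *
          gaussDens ((Real.exp (-r / 2) : ℝ) * ((ρ : ℂ) * u + 0))) *
        ∫⁻ s : ℂ, K.indicator 1 z * ψ (‖(ρ : ℂ) * u + 0‖ * Real.exp (-r / 2)) *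
          (S.indicator 1 (‖(ρ : ℂ) * u + 0‖ ^ 2, ‖((Real.sqrt 2 * ρ : ℝ) : ℂ) * s‖ ^ 2) *
          ENNReal.ofReal |‖(ρ : ℂ) * u + 0‖ ^ 2 - ‖((Real.sqrt 2 * ρ : ℝ) : ℂ) * s‖ ^ 2|)
            ∂stdComplexGaussian =
        ENNReal.ofReal (Real.exp (-r) * Real.pi⁻¹) * K.indicator 1 z *
        (ENNReal.ofReal (gaussDens u) * (ψ ‖u‖ * ∫⁻ s, S.indicator 1 (‖u‖ ^ 2, 2 * ‖s‖ ^ 2) *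
          ENNReal.ofReal |‖u‖ ^ 2 - 2 * ‖s‖ ^ 2| ∂stdComplexGaussian)) := by
      intro u
      have e1 : ((Real.exp (-r / 2) : ℝ) : ℂ) * ((ρ : ℂ) * u + 0) = u := by
        rw [add_zero, ← mul_assoc, ← Complex.ofReal_mul, hρi, Complex.ofReal_one, one_mul]
      have e2 : ‖(ρ : ℂ) * u + 0‖ = ρ * ‖u‖ := by
        rw [add_zero, norm_mul, Complex.norm_real, Real.norm_of_nonneg hρ0.le]
      have e3 : ρ * ‖u‖ * Real.exp (-r / 2) = ‖u‖ := by
        rw [mul_right_comm, mul_comm ρ, hρi, one_mul]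
      have e4 : ∀ s : ℂ, ‖((Real.sqrt 2 * ρ : ℝ) : ℂ) * s‖ ^ 2 = Real.exp r * (2 * ‖s‖ ^ 2) := by
        intro s
        rw [norm_mul, Complex.norm_real, Real.norm_of_nonneg (by positivity), mul_pow, mul_pow,
          Real.sq_sqrt (by norm_num), hρ2]
        ring
      have e5 : (ρ * ‖u‖) ^ 2 = Real.exp r * ‖u‖ ^ 2 := by rw [mul_pow, hρ2]
      rw [e1, e2, e3]
      simp_rw [e4, e5]
      have e6 : ∀ s : ℂ, S.indicator (1 : ℝ × ℝ → ℝ≥0∞)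
          (Real.exp r * ‖u‖ ^ 2, Real.exp r * (2 * ‖s‖ ^ 2)) =
          S.indicator 1 (‖u‖ ^ 2, 2 * ‖s‖ ^ 2) := by
        intro s
        have := hcone _ (Real.exp_pos r) (‖u‖ ^ 2) (2 * ‖s‖ ^ 2)
        by_cases h : (‖u‖ ^ 2, 2 * ‖s‖ ^ 2) ∈ S
        · rw [indicator_of_mem h, indicator_of_mem (this.2 h)]; rfl
        · rw [indicator_of_notMem h, indicator_of_notMem (fun h' => h (this.1 h'))]
      have e7 : ∀ s : ℂ, ENNReal.ofReal |Real.exp r * ‖u‖ ^ 2 - Real.exp r * (2 * ‖s‖ ^ 2)| =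
          ENNReal.ofReal (Real.exp r) * ENNReal.ofReal |‖u‖ ^ 2 - 2 * ‖s‖ ^ 2| := by
        intro s
        rw [← mul_sub, abs_mul, abs_of_pos (Real.exp_pos r), ENNReal.ofReal_mul (Real.exp_pos r).le]
      simp_rw [e6, e7]
      have e8 : ∀ s : ℂ, (K.indicator 1 z : ℝ≥0∞) * ψ ‖u‖ *
          (S.indicator 1 (‖u‖ ^ 2, 2 * ‖s‖ ^ 2) *
            (ENNReal.ofReal (Real.exp r) * ENNReal.ofReal |‖u‖ ^ 2 - 2 * ‖s‖ ^ 2|)) =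
          (K.indicator 1 z * ψ ‖u‖ * ENNReal.ofReal (Real.exp r)) *
            (S.indicator 1 (‖u‖ ^ 2, 2 * ‖s‖ ^ 2) * ENNReal.ofReal |‖u‖ ^ 2 - 2 * ‖s‖ ^ 2|) := by
        intro s; ring
      simp_rw [e8]
      have hHu : Measurable fun s : ℂ => S.indicator (1 : ℝ × ℝ → ℝ≥0∞)
          (‖u‖ ^ 2, 2 * ‖s‖ ^ 2) * ENNReal.ofReal |‖u‖ ^ 2 - 2 * ‖s‖ ^ 2| :=
        (hH.comp measurable_prodMk_left :)
      rw [lintegral_const_mul _ hHu]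
      have e9 : Real.exp (-(2 * r)) = Real.exp (-r) * Real.exp (-r) := by
        rw [← Real.exp_add]; congr 1; ring
      have e10 : ENNReal.ofReal (Real.exp (-r)) * ENNReal.ofReal (Real.exp r) = 1 := by
        rw [← ENNReal.ofReal_mul (Real.exp_pos _).le, ← Real.exp_add]; simp
      rw [e9, ENNReal.ofReal_mul (by positivity), ENNReal.ofReal_mul (by positivity),
        ENNReal.ofReal_mul (Real.exp_pos _).le, ENNReal.ofReal_mul (Real.exp_pos _).le]
      generalize ENNReal.ofReal (Real.exp (-r)) = A at e10 ⊢
      generalize ENNReal.ofReal (Real.exp r) = B at e10 ⊢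
      generalize (∫⁻ s, S.indicator 1 (‖u‖ ^ 2, 2 * ‖s‖ ^ 2) *
          ENNReal.ofReal |‖u‖ ^ 2 - 2 * ‖s‖ ^ 2| ∂stdComplexGaussian) = J
      calc _ = (A * B) * (A * ENNReal.ofReal Real.pi⁻¹ * K.indicator 1 z *
            (ENNReal.ofReal (gaussDens u) * (ψ ‖u‖ * J))) := by ring
        _ = _ := by rw [e10, one_mul]
    simp_rw [hpt]
    have hψH : Measurable fun u : ℂ => ψ ‖u‖ * ∫⁻ s, S.indicator 1 (‖u‖ ^ 2, 2 * ‖s‖ ^ 2) *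
        ENNReal.ofReal |‖u‖ ^ 2 - 2 * ‖s‖ ^ 2| ∂stdComplexGaussian := hψu.mul hHi
    have hgψ : Measurable fun u : ℂ => ENNReal.ofReal (gaussDens u) * (ψ ‖u‖ *
        ∫⁻ s, S.indicator 1 (‖u‖ ^ 2, 2 * ‖s‖ ^ 2) *
          ENNReal.ofReal |‖u‖ ^ 2 - 2 * ‖s‖ ^ 2| ∂stdComplexGaussian) :=
      Measurable.mul (by fun_prop) hψH
    have hJ : heightIntegral S ψ = ∫⁻ u : ℂ, ENNReal.ofReal (gaussDens u) * (ψ ‖u‖ *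
        ∫⁻ s, S.indicator 1 (‖u‖ ^ 2, 2 * ‖s‖ ^ 2) *
          ENNReal.ofReal |‖u‖ ^ 2 - 2 * ‖s‖ ^ 2| ∂stdComplexGaussian) := by
      rw [heightIntegral, lintegral_stdComplexGaussian hψH]
      rfl
    rw [lintegral_const_mul _ hgψ, ← hJ]
    have e10 : ENNReal.ofReal (Real.exp (-r)) * ENNReal.ofReal (Real.exp r) = 1 := by
      rw [← ENNReal.ofReal_mul (Real.exp_pos _).le, ← Real.exp_add]; simp
    rw [ENNReal.ofReal_mul (Real.exp_pos _).le]
    generalize ENNReal.ofReal (Real.exp (-r)) = A at e10 ⊢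
    generalize ENNReal.ofReal (Real.exp r) = B at e10 ⊢
    generalize heightIntegral S ψ = J
    calc _ = (A * B) * (ENNReal.ofReal Real.pi⁻¹ * J * K.indicator 1 z) := by ring
      _ = _ := by rw [e10, one_mul]
  rw [lintegral_congr_ae (hz0.mono key), lintegral_const_mul _ (measurable_one.indicator hK),
    lintegral_indicator_one hK, areaMeasure, Measure.smul_apply, smul_eq_mul]
  ring

end CriticalSum
end GaussianEntire

namespace GaussianEntire
-- Radial integrals and the three densities.
section RadialIntegrals
open Set Filter Topology

lemma lintegral_norm_stdComplexGaussian {f : ℝ → ℝ≥0∞} (hf : Measurable f) :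
    ∫⁻ z, f ‖z‖ ∂stdComplexGaussian =
      ∫⁻ x in Ioi (0 : ℝ), f x * ENNReal.ofReal (2 * x * Real.exp (-x ^ 2)) := by
  have hf' : Measurable fun z : ℂ => f ‖z‖ := hf.comp measurable_norm
  rw [lintegral_stdComplexGaussian hf',
    ← Complex.lintegral_comp_polarCoord_symm, polarCoord_target]
  have hg : Measurable fun p : ℝ × ℝ => ENNReal.ofReal p.1 *
      (ENNReal.ofReal (Real.pi⁻¹ * Real.exp (-p.1 ^ 2)) * f p.1) := by fun_prop
  have h1 : ∫⁻ p in Ioi (0 : ℝ) ×ˢ Ioo (-Real.pi) Real.pi, ENNReal.ofReal p.1 •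
      (ENNReal.ofReal (Real.pi⁻¹ * Real.exp (-‖Complex.polarCoord.symm p‖ ^ 2)) *
        f ‖Complex.polarCoord.symm p‖) =
      ∫⁻ p in Ioi (0 : ℝ) ×ˢ Ioo (-Real.pi) Real.pi, ENNReal.ofReal p.1 *
      (ENNReal.ofReal (Real.pi⁻¹ * Real.exp (-p.1 ^ 2)) * f p.1) := by
    refine setLIntegral_congr_fun (measurableSet_Ioi.prod measurableSet_Ioo) fun p hp => ?_
    simp only [Complex.norm_polarCoord_symm, abs_of_pos (show 0 < p.1 from hp.1), smul_eq_mul]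
  refine h1.trans ?_
  rw [Measure.volume_eq_prod, ← Measure.prod_restrict,
    lintegral_prod _ hg.aemeasurable]
  refine setLIntegral_congr_fun measurableSet_Ioi fun x hx => ?_
  have hx : 0 < x := hx
  simp only [lintegral_const, Measure.restrict_apply_univ, Real.volume_Ioo]
  have h2 : ENNReal.ofReal (2 * x * Real.exp (-x ^ 2)) = ENNReal.ofReal x *
      ENNReal.ofReal (Real.pi⁻¹ * Real.exp (-x ^ 2)) * ENNReal.ofReal (Real.pi - -Real.pi) := by
    rw [← ENNReal.ofReal_mul (by positivity), ← ENNReal.ofReal_mul (by positivity)]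
    congr 1
    field_simp
    ring
  rw [h2]
  ring

lemma hasDerivAt_radialPrimitive (b t : ℝ) :
    HasDerivAt (fun t => (2 - b + 2 * t ^ 2) * Real.exp (-t ^ 2))
      ((b - 2 * t ^ 2) * (2 * t * Real.exp (-t ^ 2))) t := by
  have h := ((((hasDerivAt_id t).pow 2).const_mul 2).const_add (2 - b)).mul
    (((hasDerivAt_id t).pow 2).neg.exp)
  refine h.congr_deriv ?_
  simp
  ring

lemma tendsto_radialPrimitive (b : ℝ) :
    Tendsto (fun t => (2 - b + 2 * t ^ 2) * Real.exp (-t ^ 2)) atTop (𝓝 0) := by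
  have h0 : Tendsto (fun t : ℝ => t ^ 2) atTop atTop := tendsto_pow_atTop two_ne_zero
  have h1 := (Real.tendsto_pow_mul_exp_neg_atTop_nhds_zero 0).comp h0
  have h2 := (Real.tendsto_pow_mul_exp_neg_atTop_nhds_zero 1).comp h0
  have h := (h1.const_mul (2 - b)).add (h2.const_mul 2)
  simp only [mul_zero, add_zero] at h
  refine h.congr fun t => ?_
  simp
  ring

lemma lintegral_radial_lt {x : ℝ} (hx : 0 ≤ x) :
    ∫⁻ t in Ioi (0 : ℝ), ENNReal.ofReal (max (x ^ 2 - 2 * t ^ 2) 0) *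
      ENNReal.ofReal (2 * t * Real.exp (-t ^ 2)) =
      ENNReal.ofReal (x ^ 2 - 2 + 2 * Real.exp (-x ^ 2 / 2)) := by
  -- The integrand's factor `x ^ 2 - 2 * t ^ 2` changes sign at `t = c`, so only `Ioc 0 c`
  -- contributes.
  set c := x / Real.sqrt 2
  have hc : 0 ≤ c := by positivity
  have hc2 : 2 * c ^ 2 = x ^ 2 := by
    rw [div_pow, Real.sq_sqrt (by norm_num)]; ring
  have hd := fun t => hasDerivAt_radialPrimitive (x ^ 2) t
  have hcont : Continuous fun t => (x ^ 2 - 2 * t ^ 2) * (2 * t * Real.exp (-t ^ 2)) := by fun_prop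
  have h1 : ∫⁻ t in Ioi (0 : ℝ), ENNReal.ofReal (max (x ^ 2 - 2 * t ^ 2) 0) *
      ENNReal.ofReal (2 * t * Real.exp (-t ^ 2)) =
      ∫⁻ t in Ioc 0 c, ENNReal.ofReal ((x ^ 2 - 2 * t ^ 2) * (2 * t * Real.exp (-t ^ 2))) := by
    rw [← Ioc_union_Ioi_eq_Ioi hc, lintegral_union measurableSet_Ioi
      (Ioc_disjoint_Ioi le_rfl)]
    rw [setLIntegral_congr_fun (g := fun _ => 0) measurableSet_Ioi, lintegral_zero, add_zero]
    · refine setLIntegral_congr_fun measurableSet_Ioc fun t ht => ?_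
      have : 0 ≤ x ^ 2 - 2 * t ^ 2 := by
        have := pow_le_pow_left₀ ht.1.le ht.2 2
        linarith
      simp only [max_eq_left this, ENNReal.ofReal_mul this]
    · intro t ht
      have : x ^ 2 - 2 * t ^ 2 ≤ 0 := by
        have := pow_le_pow_left₀ hc (mem_Ioi.1 ht).le 2
        linarith
      simp only [max_eq_right this, ENNReal.ofReal_zero, zero_mul]
  rw [h1, ← ofReal_integral_eq_lintegral_ofReal (hcont.integrableOn_Ioc)]
  · rw [← intervalIntegral.integral_of_le hc, intervalIntegral.integral_eq_sub_of_hasDerivAt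
      (fun t _ => hd t) (hcont.intervalIntegrable _ _), hc2]
    have : -c ^ 2 = -x ^ 2 / 2 := by linarith
    rw [this]
    congr 1
    simp
    ring
  · refine (ae_restrict_mem measurableSet_Ioc).mono fun t ht => ?_
    have := pow_le_pow_left₀ ht.1.le ht.2 2
    have h3 := ht.1
    exact mul_nonneg (by linarith) (by positivity)

lemma lintegral_radial_gt {x : ℝ} (hx : 0 ≤ x) :
    ∫⁻ t in Ioi (0 : ℝ), ENNReal.ofReal (max (2 * t ^ 2 - x ^ 2) 0) *
      ENNReal.ofReal (2 * t * Real.exp (-t ^ 2)) =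
      ENNReal.ofReal (2 * Real.exp (-x ^ 2 / 2)) := by
  set c := x / Real.sqrt 2
  have hc : 0 ≤ c := by positivity
  have hc2 : 2 * c ^ 2 = x ^ 2 := by
    rw [div_pow, Real.sq_sqrt (by norm_num)]; ring
  have hd : ∀ t, HasDerivAt (fun t => -((2 - x ^ 2 + 2 * t ^ 2) * Real.exp (-t ^ 2)))
      ((2 * t ^ 2 - x ^ 2) * (2 * t * Real.exp (-t ^ 2))) t := fun t =>
    (hasDerivAt_radialPrimitive (x ^ 2) t).neg.congr_deriv (by ring)
  have hpos : ∀ t ∈ Ioi c, 0 ≤ (2 * t ^ 2 - x ^ 2) * (2 * t * Real.exp (-t ^ 2)) := by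
    intro t ht
    have := pow_le_pow_left₀ hc (mem_Ioi.1 ht).le 2
    have h3 := hc.trans (mem_Ioi.1 ht).le
    exact mul_nonneg (by linarith) (by positivity)
  have hlim : Tendsto (fun t => -((2 - x ^ 2 + 2 * t ^ 2) * Real.exp (-t ^ 2))) atTop (𝓝 0) := by
    simpa using (tendsto_radialPrimitive (x ^ 2)).neg
  have h1 : ∫⁻ t in Ioi (0 : ℝ), ENNReal.ofReal (max (2 * t ^ 2 - x ^ 2) 0) *
      ENNReal.ofReal (2 * t * Real.exp (-t ^ 2)) =
      ∫⁻ t in Ioi c, ENNReal.ofReal ((2 * t ^ 2 - x ^ 2) * (2 * t * Real.exp (-t ^ 2))) := by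
    rw [← Ioc_union_Ioi_eq_Ioi hc, lintegral_union measurableSet_Ioi
      (Ioc_disjoint_Ioi le_rfl)]
    rw [setLIntegral_congr_fun (g := fun _ => 0) measurableSet_Ioc, lintegral_zero, zero_add]
    · refine setLIntegral_congr_fun measurableSet_Ioi fun t ht => ?_
      have : 0 ≤ 2 * t ^ 2 - x ^ 2 := by
        have := pow_le_pow_left₀ hc (mem_Ioi.1 ht).le 2
        linarith
      simp only [max_eq_left this, ENNReal.ofReal_mul this]
    · intro t ht
      have : 2 * t ^ 2 - x ^ 2 ≤ 0 := by
        have := pow_le_pow_left₀ ht.1.le ht.2 2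
        linarith
      simp only [max_eq_right this, ENNReal.ofReal_zero, zero_mul]
  rw [h1, ← ofReal_integral_eq_lintegral_ofReal]
  · rw [integral_Ioi_of_hasDerivAt_of_nonneg' (fun t _ => hd t) hpos hlim, hc2]
    have : -c ^ 2 = -x ^ 2 / 2 := by linarith
    rw [this]
    congr 1
    ring
  · exact integrableOn_Ioi_deriv_of_nonneg' (fun t _ => hd t) hpos hlim
  · exact (ae_restrict_mem measurableSet_Ioi).mono hpos

lemma lintegral_indicator_lt (u : ℂ) :
    ∫⁻ s, {p : ℝ × ℝ | p.2 < p.1}.indicator 1 (‖u‖ ^ 2, 2 * ‖s‖ ^ 2) *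
      ENNReal.ofReal |‖u‖ ^ 2 - 2 * ‖s‖ ^ 2| ∂stdComplexGaussian =
      ENNReal.ofReal (‖u‖ ^ 2 - 2 + 2 * Real.exp (-‖u‖ ^ 2 / 2)) := by
  rw [← lintegral_radial_lt (norm_nonneg u), ← lintegral_norm_stdComplexGaussian (by fun_prop)]
  refine lintegral_congr fun s => ?_
  by_cases h : 2 * ‖s‖ ^ 2 < ‖u‖ ^ 2
  · rw [indicator_of_mem (by exact h), abs_of_pos (by linarith), max_eq_left (by linarith)]
    simp
  · rw [indicator_of_notMem (by exact h), max_eq_right (by linarith)]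
    simp

lemma lintegral_indicator_gt (u : ℂ) :
    ∫⁻ s, {p : ℝ × ℝ | p.1 < p.2}.indicator 1 (‖u‖ ^ 2, 2 * ‖s‖ ^ 2) *
      ENNReal.ofReal |‖u‖ ^ 2 - 2 * ‖s‖ ^ 2| ∂stdComplexGaussian =
      ENNReal.ofReal (2 * Real.exp (-‖u‖ ^ 2 / 2)) := by
  rw [← lintegral_radial_gt (norm_nonneg u), ← lintegral_norm_stdComplexGaussian (by fun_prop)]
  refine lintegral_congr fun s => ?_
  by_cases h : ‖u‖ ^ 2 < 2 * ‖s‖ ^ 2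
  · rw [indicator_of_mem (by exact h), abs_of_neg (by linarith), max_eq_left (by linarith)]
    simp
  · rw [indicator_of_notMem (by exact h), max_eq_right (by linarith)]
    simp

lemma radial_lt_nonneg (x : ℝ) : 0 ≤ x ^ 2 - 2 + 2 * Real.exp (-x ^ 2 / 2) := by
  linarith [Real.add_one_le_exp (-x ^ 2 / 2)]

/-- An absolute value is the sum of its positive and negative parts, so the two preceding radial
integrals add up. -/
lemma lintegral_indicator_univ (u : ℂ) :
    ∫⁻ s, (univ : Set (ℝ × ℝ)).indicator 1 (‖u‖ ^ 2, 2 * ‖s‖ ^ 2) *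
      ENNReal.ofReal |‖u‖ ^ 2 - 2 * ‖s‖ ^ 2| ∂stdComplexGaussian =
      ENNReal.ofReal (‖u‖ ^ 2 - 2 + 4 * Real.exp (-‖u‖ ^ 2 / 2)) := by
  have h1 : ‖u‖ ^ 2 - 2 + 4 * Real.exp (-‖u‖ ^ 2 / 2) =
      (‖u‖ ^ 2 - 2 + 2 * Real.exp (-‖u‖ ^ 2 / 2)) + 2 * Real.exp (-‖u‖ ^ 2 / 2) := by ring
  have hm : Measurable fun t : ℝ => ENNReal.ofReal (max (‖u‖ ^ 2 - 2 * t ^ 2) 0) := by fun_prop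
  have hmn : Measurable fun s : ℂ => ENNReal.ofReal (max (‖u‖ ^ 2 - 2 * ‖s‖ ^ 2) 0) := by fun_prop
  have hm' : Measurable fun t : ℝ => ENNReal.ofReal (max (2 * t ^ 2 - ‖u‖ ^ 2) 0) := by fun_prop
  rw [h1, ENNReal.ofReal_add (radial_lt_nonneg _) (by positivity),
    ← lintegral_radial_lt (norm_nonneg u), ← lintegral_radial_gt (norm_nonneg u),
    ← lintegral_norm_stdComplexGaussian hm, ← lintegral_norm_stdComplexGaussian hm',
    ← lintegral_add_left hmn]
  refine lintegral_congr fun s => ?_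
  rw [← ENNReal.ofReal_add (le_max_right _ _) (le_max_right _ _), indicator_of_mem (mem_univ _),
    Pi.one_apply, one_mul]
  congr 1
  rcases le_total (‖u‖ ^ 2) (2 * ‖s‖ ^ 2) with h | h
  · rw [abs_of_nonpos (by linarith), max_eq_right (by linarith), max_eq_left (by linarith)]; ring
  · rw [abs_of_nonneg (by linarith), max_eq_left (by linarith), max_eq_right (by linarith)]; ring

lemma heightIntegral_eq {S : Set (ℝ × ℝ)} {j : ℝ → ℝ} (hj : Measurable j)
    (hj0 : ∀ x, 0 ≤ j x)
    (h : ∀ u : ℂ, ∫⁻ s, S.indicator 1 (‖u‖ ^ 2, 2 * ‖s‖ ^ 2) *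
      ENNReal.ofReal |‖u‖ ^ 2 - 2 * ‖s‖ ^ 2| ∂stdComplexGaussian = ENNReal.ofReal (j ‖u‖))
    {ψ : ℝ → ℝ≥0∞} (hψ : Measurable ψ) :
    heightIntegral S ψ = ∫⁻ x in Ioi (0 : ℝ), ψ x *
      ENNReal.ofReal (2 * x * j x * Real.exp (-x ^ 2)) := by
  have hm : Measurable fun x => ψ x * ENNReal.ofReal (j x) := by fun_prop
  unfold heightIntegral
  simp_rw [h]
  rw [lintegral_norm_stdComplexGaussian hm]
  refine lintegral_congr fun x => ?_
  rw [mul_assoc, ← ENNReal.ofReal_mul (hj0 x)]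
  congr 2
  ring

lemma heightIntegral_lt {ψ : ℝ → ℝ≥0∞} (hψ : Measurable ψ) :
    heightIntegral {p | p.2 < p.1} ψ =
      ∫⁻ x in Ioi (0 : ℝ), ψ x * ENNReal.ofReal (densityMax x) :=
  heightIntegral_eq (by fun_prop) radial_lt_nonneg lintegral_indicator_lt hψ

lemma heightIntegral_gt {ψ : ℝ → ℝ≥0∞} (hψ : Measurable ψ) :
    heightIntegral {p | p.1 < p.2} ψ =
      ∫⁻ x in Ioi (0 : ℝ), ψ x * ENNReal.ofReal (densitySaddle x) := by
  rw [heightIntegral_eq (j := fun x => 2 * Real.exp (-x ^ 2 / 2)) (by fun_prop)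
    (fun x => by positivity) lintegral_indicator_gt hψ]
  refine lintegral_congr fun x => ?_
  rw [densitySaddle, show -(3 / 2) * x ^ 2 = -x ^ 2 / 2 + -x ^ 2 by ring, Real.exp_add]
  congr 2
  ring

lemma heightIntegral_univ {ψ : ℝ → ℝ≥0∞} (hψ : Measurable ψ) :
    heightIntegral univ ψ =
      ∫⁻ x in Ioi (0 : ℝ), ψ x * ENNReal.ofReal (densityCrit x) :=
  heightIntegral_eq (by fun_prop)
    (fun x => by linarith [radial_lt_nonneg x, Real.exp_pos (-x ^ 2 / 2)])
    lintegral_indicator_univ hψ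

lemma densityMax_nonneg {x : ℝ} (hx : 0 ≤ x) : 0 ≤ densityMax x :=
  mul_nonneg (mul_nonneg (by positivity) (radial_lt_nonneg x)) (Real.exp_pos _).le

lemma densitySaddle_nonneg {x : ℝ} (hx : 0 ≤ x) : 0 ≤ densitySaddle x := by
  unfold densitySaddle; positivity

lemma densityCrit_eq_add (x : ℝ) : densityCrit x = densitySaddle x + densityMax x := by
  rw [densityCrit, densitySaddle, densityMax,
    show -(3 / 2) * x ^ 2 = -x ^ 2 / 2 + -x ^ 2 by ring, Real.exp_add]
  ring

end RadialIntegrals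
end GaussianEntire

namespace GaussianEntire
-- Almost sure regularity and transfer to the random entire function.
section HeightDensity
open Set Filter Topology

/-- The pair (a₀, a₁) is absolutely continuous and independent of the other coefficients, so null
sections suffice. -/
lemma ae_gaussianSeq_split_notMem {B : Set ((ℕ → ℂ) × (ℂ × ℂ))} (hB : MeasurableSet B)
    (h : ∀ᵐ θ ∂gaussianSeq, volume {p : ℂ × ℂ | (θ, p) ∈ B} = 0) :
    ∀ᵐ a ∂gaussianSeq, ((fun k => a (k + 2), (a 0, a 1)) : (ℕ → ℂ) × (ℂ × ℂ)) ∉ B := by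
  have hs : Measurable fun a : ℕ → ℂ => ((fun k => a (k + 2), (a 0, a 1)) : (ℕ → ℂ) × (ℂ × ℂ)) :=
    (measurable_pi_lambda _ fun k => measurable_pi_apply (k + 2)).prodMk
      ((measurable_pi_apply 0).prodMk (measurable_pi_apply 1))
  rw [ae_iff]
  simp only [not_not]
  have hB' : MeasurableSet
      {a : ℕ → ℂ | ((fun k => a (k + 2), (a 0, a 1)) : (ℕ → ℂ) × (ℂ × ℂ)) ∈ B} := hs hB
  rw [← lintegral_indicator_one hB', lintegral_gaussianSeq₂ (measurable_one.indicator hB')]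
  refine (lintegral_congr_ae (h.mono fun θ hθ => ?_)).trans lintegral_zero
  refine (lintegral_congr_ae (measure_eq_zero_iff_ae_notMem.1 hθ |>.mono fun p hp => ?_)).trans
    lintegral_zero
  rw [indicator_of_notMem (by exact hp), mul_zero]

lemma seqCons_split (a : ℕ → ℂ) : seqCons (a 0) (seqCons (a 1) fun k => a (k + 2)) = a := by
  ext k
  rcases k with _ | _ | k <;> rfl

/-- The coefficient sequences for which the series converges everywhere and all the critical
points are nondegenerate. -/
def IsRegular (a : ℕ → ℂ) : Prop :=
  (fun k => a (k + 2)) ∈ goodSeq ∧ ∀ p, critMap (tailFun fun k => a (k + 2)) p = (a 0, a 1) →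
    (fderiv ℝ (critMap (tailFun fun k => a (k + 2))) p).det ≠ 0

/-- A degenerate critical point makes (a₀, a₁) a critical value of the map attached to the tail, and
by Sard's theorem these values are null for every tail. -/
lemma ae_isRegular : ∀ᵐ a ∂gaussianSeq, IsRegular a := by
  have : (volume : Measure (ℂ × ℂ)).IsAddHaarMeasure :=
    inferInstanceAs (Measure.prod volume volume).IsAddHaarMeasure
  have hcrit := criticalValues_measurable_null (Φ := fun a : ℕ → ℂ => critMap (tailFun a))
    measurable_critMap_tailFun hasFDerivAt_critMap_tailFun continuous_fderiv_critMap_tailFun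
    measurable_det_fderiv_critMap_tailFun (volume : Measure (ℂ × ℂ))
  have h1 := ae_gaussianSeq_split_notMem hcrit.1 (Eventually.of_forall hcrit.2)
  have h2 := ae_gaussianSeq_split_notMem (measurableSet_goodSeq.compl.prod MeasurableSet.univ)
    (ae_mem_goodSeq.mono fun θ hθ => by simp [hθ])
  filter_upwards [h1, h2] with a ha ha'
  exact ⟨by simpa using ha', fun p hp h0 => ha ⟨p, hp, h0⟩⟩

variable {a : ℕ → ℂ}

lemma IsRegular.mem_goodSeq (ha : IsRegular a) : a ∈ goodSeq := by
  rw [← seqCons_split a]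
  exact seqCons_mem_goodSeq _ (seqCons_mem_goodSeq _ ha.1)

lemma IsRegular.gef_eq (ha : IsRegular a) :
    gef a = fun z => a 0 + a 1 * z + tailFun (fun k => a (k + 2)) z := by
  ext z
  conv_lhs => rw [← seqCons_split a]
  exact gef_seqCons_seqCons _ _ ha.1 z

lemma IsRegular.deriv_gef_eq (ha : IsRegular a) :
    deriv (gef a) = fun z => a 1 + deriv (tailFun fun k => a (k + 2)) z := by
  ext z
  rw [ha.gef_eq]
  have h := (((hasDerivAt_id z).const_mul (a 1)).const_add (a 0)).add
    (differentiable_tailFun (fun k => a (k + 2)) z).hasDerivAt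
  rw [mul_one] at h
  exact h.deriv

lemma IsRegular.deriv_deriv_gef_eq (ha : IsRegular a) (z : ℂ) :
    deriv (deriv (gef a)) z = deriv (deriv (tailFun fun k => a (k + 2))) z := by
  rw [ha.deriv_gef_eq, deriv_const_add]

lemma IsRegular.critMap_eq_iff (ha : IsRegular a) (p : ℂ × ℂ) :
    critMap (tailFun fun k => a (k + 2)) p = (a 0, a 1) ↔
      p.2 = gef a p.1 ∧ p.1 ∈ criticalPoints (gef a) := by
  obtain ⟨z, u⟩ := p
  simp only [critMap, Prod.mk.injEq, criticalPoints, mem_ofPred_eq, chernDeriv]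
  rw [ha.deriv_gef_eq, ha.gef_eq]
  dsimp only
  constructor
  · rintro ⟨h1, h2⟩
    rw [h2] at h1
    have hu : u = a 0 + a 1 * z + tailFun (fun k => a (k + 2)) z := by linear_combination h1
    exact ⟨hu, by rw [← hu]; linear_combination -h2⟩
  · rintro ⟨hu, h⟩
    rw [← hu] at h
    have h2 : conj z * u - deriv (tailFun fun k => a (k + 2)) z = a 1 := by
      linear_combination -h
    refine ⟨?_, h2⟩
    rw [h2, hu]
    ring

lemma IsRegular.norm_ne (ha : IsRegular a) {ξ : ℂ} (hξ : ξ ∈ criticalPoints (gef a)) :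
    ‖deriv (deriv (gef a)) ξ - conj ξ ^ 2 * gef a ξ‖ ≠ ‖gef a ξ‖ := by
  have h := ha.2 (ξ, gef a ξ) ((ha.critMap_eq_iff _).2 ⟨rfl, hξ⟩)
  rw [det_fderiv_critMap_tailFun] at h
  rw [ha.deriv_deriv_gef_eq]
  intro h'
  refine h ?_
  simp only [secondCov, h', sub_self]

lemma IsRegular.indicator_critSum (ha : IsRegular a) (K : Set ℂ) (S : Set (ℝ × ℝ)) (ψ : ℝ → ℝ≥0∞)
    (z : ℂ) : {x | critMap (tailFun fun k => a (k + 2)) x = (a 0, a 1) ∧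
      ((fun k => a (k + 2)), x) ∈ nondegSet}.indicator
        (fun x => pointWeight K S ψ ((fun k => a (k + 2)), x)) (z, gef a z) =
      {ξ | ξ ∈ K ∧ ξ ∈ criticalPoints (gef a) ∧ (‖gef a ξ‖ ^ 2,
        ‖deriv (deriv (gef a)) ξ - conj ξ ^ 2 * gef a ξ‖ ^ 2) ∈ S}.indicator
        (fun ξ => ψ (height (gef a) ξ)) z := by
  by_cases hz : z ∈ criticalPoints (gef a)
  · have h := (ha.critMap_eq_iff (z, gef a z)).2 ⟨rfl, hz⟩
    rw [indicator_of_mem (by exact ⟨h, ha.2 _ h⟩)]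
    simp only [pointWeight, secondCov, ← ha.deriv_deriv_gef_eq]
    by_cases hK : z ∈ K
    · by_cases hS : (‖gef a z‖ ^ 2, ‖deriv (deriv (gef a)) z - conj z ^ 2 * gef a z‖ ^ 2) ∈ S
      · rw [indicator_of_mem hK, indicator_of_mem hS, indicator_of_mem (by exact ⟨hK, hz, hS⟩)]
        simp [height]
      · rw [indicator_of_notMem hS, mul_zero, indicator_of_notMem (by exact fun h => hS h.2.2)]
    · rw [indicator_of_notMem hK, zero_mul, zero_mul,
        indicator_of_notMem (by exact fun h => hK h.1)]
  · rw [indicator_of_notMem (by exact fun h => hz ((ha.critMap_eq_iff _).1 h.1).2),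
      indicator_of_notMem (by exact fun h => hz h.2.1)]

/-- Points of the fibre lie on the graph of F, so the sum over ℂ² collapses to a sum over z;
regularity makes the restriction to `nondegSet` harmless. -/
lemma IsRegular.critSum_eq (ha : IsRegular a) (K : Set ℂ) (S : Set (ℝ × ℝ)) (ψ : ℝ → ℝ≥0∞) :
    critSum K S ψ a = ∑' ξ, {ξ | ξ ∈ K ∧ ξ ∈ criticalPoints (gef a) ∧ (‖gef a ξ‖ ^ 2,
        ‖deriv (deriv (gef a)) ξ - conj ξ ^ 2 * gef a ξ‖ ^ 2) ∈ S}.indicator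
        (fun ξ => ψ (height (gef a) ξ)) ξ := by
  have hinj : Function.Injective fun z => (z, gef a z) := fun _ _ h => congrArg Prod.fst h
  rw [critSum, fiberSum, ← hinj.tsum_eq]
  · exact tsum_congr fun z => ha.indicator_critSum K S ψ z
  · intro p hp
    have hp' := ((ha.critMap_eq_iff p).1 (mem_of_indicator_ne_zero hp).1).1
    exact ⟨p.1, Prod.ext rfl hp'.symm⟩

/-- The mean formula is applied to all of ℂ with the indicator of height zero as test function. Its
height integral is taken over x > 0 and vanishes, so the mean is ∞ · 0 = 0. -/
lemma ae_gef_ne_zero : ∀ᵐ a ∂gaussianSeq, ∀ ξ ∈ criticalPoints (gef a), gef a ξ ≠ 0 := by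
  have hψ : Measurable (({0} : Set ℝ).indicator (1 : ℝ → ℝ≥0∞)) :=
    measurable_one.indicator (measurableSet_singleton 0)
  have hI : heightIntegral univ (({0} : Set ℝ).indicator (1 : ℝ → ℝ≥0∞)) = 0 := by
    rw [heightIntegral_univ hψ, setLIntegral_congr_fun (g := fun _ => 0) measurableSet_Ioi,
      lintegral_zero]
    intro x hx
    dsimp only
    rw [indicator_of_notMem (by simpa using (mem_Ioi.1 hx).ne'), zero_mul]
  have h := lintegral_critSum MeasurableSet.univ MeasurableSet.univ (by simp) hψ
  rw [hI, mul_zero, lintegral_eq_zero_iff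
    (lintegral_critSum_eq MeasurableSet.univ MeasurableSet.univ hψ).1] at h
  filter_upwards [h, ae_isRegular] with a h0 ha ξ hξ hF
  rw [ha.critSum_eq, Pi.zero_apply, ENNReal.tsum_eq_zero] at h0
  have := h0 ξ
  rw [indicator_of_mem (by exact ⟨mem_univ _, hξ, mem_univ _⟩)] at this
  simp [height, hF] at this

lemma map_eq_gaussianSeq {Ω : Type*} [MeasurableSpace Ω] {P : Measure Ω}
    {a : ℕ → Ω → ℂ} (hindep : iIndepFun a P) (hlaw : ∀ k, HasLaw (a k) stdComplexGaussian P) :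
    P.map (fun ω k => a k ω) = gaussianSeq := by
  rw [hindep.map_fun_eq_infinitePi_map₀' fun k => (hlaw k).aemeasurable, gaussianSeq]
  congr 1
  exact funext fun k => (hlaw k).map_eq

lemma areaMeasure_lt_top {K : Set ℂ} (hK : IsCompact K) : areaMeasure K < ∞ := by
  rw [areaMeasure, Measure.smul_apply, smul_eq_mul]
  exact ENNReal.mul_lt_top ENNReal.ofReal_lt_top hK.measure_lt_top

/-- Mean densities of the heights at the critical points selected by a homogeneous condition on
the value and the second covariant derivative. -/
theorem isExpectedHeightDensity_of_select {Ω : Type*} [MeasurableSpace Ω] {P : Measure Ω}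
    {a : ℕ → Ω → ℂ} (hindep : iIndepFun a P) (hlaw : ∀ k, HasLaw (a k) stdComplexGaussian P)
    {X : (ℂ → ℂ) → Set ℂ} {D : ℝ → ℝ} {S : Set (ℝ × ℝ)} (hS : MeasurableSet S)
    (hcone : ∀ c > 0, ∀ x y : ℝ, (c * x, c * y) ∈ S ↔ (x, y) ∈ S)
    (hD : ∀ x, 0 ≤ x → 0 ≤ D x)
    (hI : ∀ ψ : ℝ → ℝ≥0∞, Measurable ψ →
      heightIntegral S ψ = ∫⁻ x in Ioi (0 : ℝ), ψ x * ENNReal.ofReal (D x))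
    (hX : ∀ F, X F ⊆ criticalPoints F)
    (hXS : ∀ F, Differentiable ℂ F → ∀ ξ ∈ criticalPoints F, F ξ ≠ 0 →
      ‖deriv (deriv F) ξ - conj ξ ^ 2 * F ξ‖ ≠ ‖F ξ‖ →
      (ξ ∈ X F ↔ (‖F ξ‖ ^ 2, ‖deriv (deriv F) ξ - conj ξ ^ 2 * F ξ‖ ^ 2) ∈ S)) :
    IsExpectedHeightDensity P (fun ω => gef fun k => a k ω) X D := by
  refine ⟨hD, fun K hK hK0 ψ hψ => ?_⟩
  have hmap := map_eq_gaussianSeq hindep hlaw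
  have hm : AEMeasurable (fun ω k => a k ω) P :=
    aemeasurable_pi_iff.2 fun k => (hlaw k).aemeasurable
  have hcs := (lintegral_critSum_eq hK.measurableSet hS hψ).1
  -- The two sums agree only almost surely: `hXS` decides membership by `S` only when F(ξ) ≠ 0 and
  -- |∇'²F(ξ)| ≠ |F(ξ)|.
  have hsum : ∀ᵐ b ∂gaussianSeq,
      critSum K S ψ b = ∑' ξ : (K ∩ X (gef b) : Set ℂ), ψ (height (gef b) ξ) := by
    filter_upwards [ae_isRegular, ae_gef_ne_zero] with b hb hb0
    rw [hb.critSum_eq, tsum_subtype (K ∩ X (gef b)) fun ξ => ψ (height (gef b) ξ)]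
    have hset : {ξ | ξ ∈ K ∧ ξ ∈ criticalPoints (gef b) ∧ (‖gef b ξ‖ ^ 2,
        ‖deriv (deriv (gef b)) ξ - conj ξ ^ 2 * gef b ξ‖ ^ 2) ∈ S} = K ∩ X (gef b) := by
      ext ξ
      refine and_congr_right fun _ => ⟨fun h => ?_, fun h => ⟨hX _ h, ?_⟩⟩
      · exact (hXS _ (differentiable_gef hb.mem_goodSeq) ξ h.1 (hb0 ξ h.1) (hb.norm_ne h.1)).2 h.2
      · have h' := hX _ h
        exact (hXS _ (differentiable_gef hb.mem_goodSeq) ξ h' (hb0 ξ h') (hb.norm_ne h')).1 h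
    rw [hset]
  rw [← hmap] at hsum
  have hsumΩ := ae_of_ae_map hm hsum
  have hae : AEMeasurable (fun ω => critSum K S ψ fun k => a k ω) P := hcs.comp_aemeasurable hm
  have hae' : AEMeasurable (fun ω => ∑' ξ : (K ∩ X (gef fun k => a k ω) : Set ℂ),
      ψ (height (gef fun k => a k ω) ξ)) P := hae.congr hsumΩ
  refine ⟨hae', ?_⟩
  rw [lintegral_const_mul'' _ hae', ← lintegral_congr_ae hsumΩ,
    ← lintegral_map' hcs.aemeasurable hm, hmap, lintegral_critSum hK.measurableSet hS hcone hψ,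
    hI ψ hψ, ← mul_assoc, ENNReal.inv_mul_cancel hK0.ne' (areaMeasure_lt_top hK).ne, one_mul]

end HeightDensity
end GaussianEntire

end

/-! ### The three kinds of points as sign conditions on the Jacobian. -/

theorem theorem2 {Ω : Type*} [MeasurableSpace Ω] (P : Measure Ω) [IsProbabilityMeasure P]
    (a : ℕ → Ω → ℂ) (hindep : iIndepFun a P)
    (hlaw : ∀ k : ℕ, HasLaw (a k) GaussianEntire.stdComplexGaussian P) :
    GaussianEntire.IsExpectedHeightDensity P
        (fun ω => GaussianEntire.gef (fun k => a k ω))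
        GaussianEntire.maxPoints GaussianEntire.densityMax ∧
      GaussianEntire.IsExpectedHeightDensity P
        (fun ω => GaussianEntire.gef (fun k => a k ω))
        GaussianEntire.saddlePoints GaussianEntire.densitySaddle ∧
      GaussianEntire.IsExpectedHeightDensity P
        (fun ω => GaussianEntire.gef (fun k => a k ω))
        GaussianEntire.criticalPoints GaussianEntire.densityCrit ∧
      (∀ x : ℝ, GaussianEntire.densityCrit x =
        GaussianEntire.densitySaddle x + GaussianEntire.densityMax x) := by
  refine ⟨?_, ?_, ?_, GaussianEntire.densityCrit_eq_add⟩
  · refine GaussianEntire.isExpectedHeightDensity_of_select hindep hlaw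
      (S := {p | p.2 < p.1}) (measurableSet_lt measurable_snd measurable_fst)
      (fun c hc x y => by simp [hc]) (fun x hx => GaussianEntire.densityMax_nonneg hx)
      (fun ψ hψ => GaussianEntire.heightIntegral_lt hψ) (fun F ξ h => h.1)
      fun F hF ξ hξ h0 hne => ?_
    simp only [Set.mem_ofPred_eq, sq_lt_sq₀ (norm_nonneg _) (norm_nonneg _)]
    refine ⟨fun h => ?_, fun h => ⟨hξ, GaussianEntire.isLocalMax_height hF hξ h⟩⟩
    -- Ties being excluded, failure of the strict inequality gives the opposite strict one, which
    -- rules out any extremum.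
    by_contra hlt
    exact GaussianEntire.not_isLocalExtr_height hF hξ h0 (lt_of_le_of_ne (not_lt.1 hlt) hne.symm)
      (Or.inr h.2)
  · refine GaussianEntire.isExpectedHeightDensity_of_select hindep hlaw
      (S := {p | p.1 < p.2}) (measurableSet_lt measurable_fst measurable_snd)
      (fun c hc x y => by simp [hc]) (fun x hx => GaussianEntire.densitySaddle_nonneg hx)
      (fun ψ hψ => GaussianEntire.heightIntegral_gt hψ) (fun F ξ h => h.1)
      fun F hF ξ hξ h0 hne => ?_
    simp only [Set.mem_ofPred_eq, sq_lt_sq₀ (norm_nonneg _) (norm_nonneg _)]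
    refine ⟨fun h => ?_, fun h => ⟨hξ, GaussianEntire.not_isLocalExtr_height hF hξ h0 h⟩⟩
    by_contra hlt
    exact h.2 (Or.inr (GaussianEntire.isLocalMax_height hF hξ (lt_of_le_of_ne (not_lt.1 hlt) hne)))
  · exact GaussianEntire.isExpectedHeightDensity_of_select hindep hlaw
      (S := Set.univ) MeasurableSet.univ (by simp)
      (fun x hx => by
        rw [GaussianEntire.densityCrit_eq_add]
        exact add_nonneg (GaussianEntire.densitySaddle_nonneg hx)
          (GaussianEntire.densityMax_nonneg hx))
      (fun ψ hψ => GaussianEntire.heightIntegral_univ hψ) (fun F => subset_rfl)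
      fun F _ ξ hξ _ _ => by simp [hξ]
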